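/- **Theorem 2.4 (Profile decomposition).** Let $(\tau_z f)(x)=f(x-z)$, fix $r\in(2,\infty)$, and let $A$ be a self-adjoint operator on $L^2(\mathbb R)$ with complex-valued functions. For $z\in\mathbb R$ write $A_z=\tau_{-z}A\tau_z$. Assume: - **A1.** $(Av,v)\ge 0$ for all $v\in D(A)$; $D(A)\subset H^1(\mathbb R)$ and $A$ extends to a bounded operator $A:H^1\to H^{-1}$; and for some $c_0>0$, $(A_zv,v)_{L^2}+c_0\|v\|_{L^2}^2\simeq\|v\|_{H^1}^2$ for $v\in H^1$, uniformly in $z\in\mathbb R$ (here and below $(\cdot,\cdot)_{L^2}$ also denotes the pairing of $H^{-1}$ with $H^1$). - **A2.** $\|e^{-itA}\psi\|_{H^1}\lesssim\|\psi\|_{H^1}$ for $\psi\in H^1$, uniformly in $t\in\mathbb R$. Moreover, for all $\psi\in H^1$ and all real sequences $(x_k)_{k\ge1}$, $(s_k)_{k\ge1}$: - **A3.** $(A_{x_k}\psi)_{k}$ is precompact in $H^{-1}$. - **A4.** If $s_k\to\bar s\in\mathbb R$, then $(e^{-is_kA_{x_k}}\psi)_k$ is precompact in $H^1$. - **A5.**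 $(e^{-is_kA_{x_k}}\psi)_k$ is precompact in $L^r$. - **A6.** If $|s_k|\to+\infty$, then $e^{is_kA_{x_k}}\psi\rightharpoonup0$ weakly in $H^1$ up to a subsequence. Call a real sequence $(x_n)$ *standard* if $x_n\to+\infty$, or $x_n\to-\infty$, or $x_n=0$ for all $n$. Then there is a constant $C>0$, depending only on $A$ and $r$, such that every bounded sequence in $H^1(\mathbb R)$ has a subsequence $(u_n)_{n\ge1}$ for which there exist, for each $j\ge1$, a function $\psi_j\in H^1$ and standard sequences $(t_j^n)_{n\ge1}$, $(x_j^n)_{n\ge1}$, and, for each $J\ge1$, functions $R_J^n\in H^1$ such that for all $J,n\ge1$ $$u_n=\sum_{j=1}^{J}e^{it_j^nA}\tau_{x_j^n}\psi_j+R_J^n ,$$ and such that: - (a) $|t_j^n-t_k^n|+|x_j^n-x_k^n|\to+\infty$ as $n\to\infty$, for all $j\ne k$; - (b) $\displaystyle\limsup_{n\to\infty}\|e^{-itA}R_J^n\|_{L^\infty_tL^\infty_x}\le C\,\|\psi_J\|_{L^2}^{1/2}\,\sup_n\|u_n\|_{H^1}^{1/2}$ for every $J\ge1$, and both sides tend to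 $0$ as $J\to\infty$; - (c) for each $J\ge1$, as $n\to\infty$, $$\|u_n\|_{L^2}^2=\sum_{j=1}^J\|\psi_j\|_{L^2}^2+\|R_J^n\|_{L^2}^2+o(1),$$ $$(Au_n,u_n)_{L^2}=\sum_{j=1}^J(A\tau_{x_j^n}\psi_j,\tau_{x_j^n}\psi_j)_{L^2}+(AR_J^n,R_J^n)_{L^2}+o(1),$$ $$\|u_n\|_{L^r}^r=\sum_{j=1}^J\|e^{it_j^nA}\tau_{x_j^n}\psi_j\|_{L^r}^r+\|R_J^n\|_{L^r}^r+o(1);$$ - (d) if $\psi_J=0$ for some $J\ge1$, then $\psi_j=0$ for all $j\ge J$; - (e) $\|\psi_j\|_{H^1}+\|R_J^n\|_{H^1}\le C\sup_m\|u_m\|_{H^1}$ for all $j,J,n\ge1$. -/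

import Mathlib

open MeasureTheory Filter Topology Set
open scoped ENNReal ContDiff

noncomputable section

namespace ProfileDecomposition

/-! ### Function spaces on the line -/

/-- The complex Hilbert space `L²(ℝ)`. Note that `inner ℂ g f` is linear in `f`, so the scalar
product `(f, g)` of the literature, linear in its first entry, is `inner ℂ g f`. -/
abbrev L2 : Type := Lp ℂ 2 (volume : Measure ℝ)

/-- `g` is the weak derivative of `f` on the line. -/
def IsWeakDeriv (f g : ℝ → ℂ) : Prop :=
  ∀ η : ℝ → ℝ, ContDiff ℝ ∞ η → HasCompactSupport η →
    ∫ x, deriv η x • f x = - ∫ x, η x • g x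

theorem integrable_test {η : ℝ → ℝ} (hη : Continuous η) (hc : HasCompactSupport η) (f : L2) :
    Integrable (fun x => η x • f x) :=
  (((Lp.memLp f).locallyIntegrable (by norm_num)).integrable_smul_left_of_hasCompactSupport hη hc)

theorem continuous_deriv_test {η : ℝ → ℝ} (hη : ContDiff ℝ ∞ η) : Continuous (deriv η) :=
  hη.continuous_deriv (by simp)

/-- The Sobolev space `H¹(ℝ)`, realized as the space of the pairs `(f, f')` with `f ∈ L²(ℝ)` whose
weak derivative `f'` is in `L²(ℝ)`. It inherits the norm `‖f‖² = ‖f‖²_{L²} + ‖f'‖²_{L²}` and the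
corresponding scalar product. -/
def H1 : Submodule ℂ (WithLp 2 (L2 × L2)) where
  carrier := {v | IsWeakDeriv v.fst v.snd}
  zero_mem' := by
    intro η hη hc
    have h0 : ∀ᵐ x : ℝ, (0 : L2) x = 0 := Lp.coeFn_zero ℂ 2 volume
    have h1 : ∫ x, deriv η x • (0 : L2) x = 0 := by
      rw [integral_congr_ae (g := fun _ => 0) (by filter_upwards [h0] with x hx; rw [hx, smul_zero])]; simp
    have h2 : ∫ x, η x • (0 : L2) x = 0 := by
      rw [integral_congr_ae (g := fun _ => 0) (by filter_upwards [h0] with x hx; rw [hx, smul_zero])]; simp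
    simp only [WithLp.zero_fst, WithLp.zero_snd]
    rw [h1, h2, neg_zero]
  add_mem' := by
    intro v w hv hw η hη hc
    have key : ∀ {θ : ℝ → ℝ}, Continuous θ → HasCompactSupport θ → ∀ a b : L2,
        ∫ x, θ x • (a + b) x = (∫ x, θ x • a x) + ∫ x, θ x • b x := by
      intro θ hθ hθc a b
      rw [← integral_add (integrable_test hθ hθc a) (integrable_test hθ hθc b)]
      refine integral_congr_ae ?_
      filter_upwards [Lp.coeFn_add a b] with x hx
      rw [hx, Pi.add_apply, smul_add]
    simp only [WithLp.add_fst, WithLp.add_snd]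
    rw [key (continuous_deriv_test hη) hc.deriv, key hη.continuous hc, hv η hη hc, hw η hη hc]
    abel
  smul_mem' := by
    intro c v hv η hη hc
    have key : ∀ (θ : ℝ → ℝ) (a : L2), ∫ x, θ x • (c • a) x = c * ∫ x, θ x • a x := by
      intro θ a
      rw [← integral_const_mul]
      refine integral_congr_ae ?_
      filter_upwards [Lp.coeFn_smul c a] with x hx
      simp only [hx, Pi.smul_apply, smul_eq_mul, Complex.real_smul]
      ring
    simp only [WithLp.smul_fst, WithLp.smul_snd]
    rw [key, key, hv η hη hc]
    ring

/-- The inclusion of `H¹(ℝ)` into `L²(ℝ)`. -/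
def toL2 : H1 →ₗ[ℂ] L2 where
  toFun v := (v : WithLp 2 (L2 × L2)).fst
  map_add' _ _ := rfl
  map_smul' _ _ := rfl

/-- `H⁻¹(ℝ)`, the space of bounded antilinear functionals on `H¹(ℝ)` with the dual norm;
`T w` is the pairing `(T, w)` that extends the scalar product of `L²(ℝ)`. -/
abbrev Hneg1 : Type := H1 →L⋆[ℂ] ℂ

/-! ### Translations -/

/-- The translation `(τ_z f)(x) = f (x - z)` on `L²(ℝ)`. -/
def transl (z : ℝ) : L2 →ₗᵢ[ℂ] L2 :=
  Lp.compMeasurePreservingₗᵢ ℂ (fun x : ℝ => x - z) (measurePreserving_sub_right volume z)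

theorem integral_transl (θ : ℝ → ℝ) (f : L2) (z : ℝ) :
    ∫ x, θ x • transl z f x = ∫ x, θ (x + z) • f x := by
  have h : ∀ᵐ x : ℝ, transl z f x = f (x - z) :=
    Lp.coeFn_compMeasurePreserving f (measurePreserving_sub_right volume z)
  rw [← integral_sub_right_eq_self (fun x => θ (x + z) • f x) z]
  refine integral_congr_ae ?_
  filter_upwards [h] with x hx
  simp [hx]

/-- The translation `(τ_z f)(x) = f (x - z)` on `H¹(ℝ)`. -/
def translH1 (z : ℝ) : H1 →ₗᵢ[ℂ] H1 where
  toFun v := ⟨WithLp.toLp 2 (transl z (v : WithLp 2 (L2 × L2)).fst,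
      transl z (v : WithLp 2 (L2 × L2)).snd), by
    intro η hη hc
    have h := v.2 (fun x => η (x + z)) (hη.comp (contDiff_id.add contDiff_const))
      (hc.comp_homeomorph (Homeomorph.addRight z))
    have hd : deriv (fun x => η (x + z)) = fun x => deriv η (x + z) := by
      ext x; exact deriv_comp_add_const η z x
    rw [hd] at h
    change ∫ x, deriv η x • transl z (v : WithLp 2 (L2 × L2)).fst x =
      - ∫ x, η x • transl z (v : WithLp 2 (L2 × L2)).snd x
    rw [integral_transl, integral_transl]
    exact h⟩
  map_add' v w := by
    ext1; apply WithLp.ofLp_injective 2; simp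
  map_smul' c v := by
    ext1; apply WithLp.ofLp_injective 2; simp
  norm_map' v := by
    simp [WithLp.prod_norm_eq_of_L2]

/-! ### The operator, its translates and its flow -/

/-- `U t = e^{itA}` for all `t`: a strongly continuous one-parameter group of isometries whose
derivative at `0` is `i A` on the domain of `A`. For a self-adjoint `A` there is exactly one such
group (Stone's theorem), and then the domain of its generator is exactly that of `A`. -/
structure IsUnitaryGroup (A : L2 →ₗ.[ℂ] L2) (U : ℝ → L2 →L[ℂ] L2) : Prop where
  zero : U 0 = ContinuousLinearMap.id ℂ L2
  add : ∀ s t, U (s + t) = (U s).comp (U t)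
  norm_map : ∀ t v, ‖U t v‖ = ‖v‖
  continuous : ∀ v, Continuous fun t => U t v
  hasDerivAt : ∀ v : A.domain, HasDerivAt (fun t => U t v) (Complex.I • A v) 0

open Classical in
/-- The unitary group `e^{itA}` of a self-adjoint operator `A` on `L²(ℝ)`
(with the value `0` for operators `A` that do not generate one). -/
def expI (A : L2 →ₗ.[ℂ] L2) : ℝ → L2 →L[ℂ] L2 :=
  if h : ∃ U, IsUnitaryGroup A U then h.choose else fun _ => 0

/-- The translated operator `A_z = τ_{-z} A τ_z`, with its natural domain
`{v | τ_z v ∈ D(A)}`. -/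
def translOp (A : L2 →ₗ.[ℂ] L2) (z : ℝ) : L2 →ₗ.[ℂ] L2 where
  domain := A.domain.comap (transl z).toLinearMap
  toFun :=
    { toFun := fun v => transl (-z) (A ⟨transl z v, v.2⟩)
      map_add' := by
        intro v w
        rw [← map_add, ← LinearPMap.map_add]
        congr 2
        ext1
        simp
      map_smul' := by
        intro c v
        rw [RingHom.id_apply, ← map_smul, ← LinearPMap.map_smul]
        congr 2
        ext1
        simp }

/-- `B : H¹ → H⁻¹` extends `A`: the domain of `A` lies in `H¹`, and `B v = A v` there. -/
def Extends (A : L2 →ₗ.[ℂ] L2) (B : H1 →L[ℂ] Hneg1) : Prop :=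
  ∀ v : A.domain, ∃ w : H1, toL2 w = v ∧ ∀ y : H1, B w y = inner ℂ (toL2 y) (A v)

/-- `A_z v = τ_{-z} A τ_z v ∈ H⁻¹` for `v ∈ H¹`, where `B : H¹ → H⁻¹` extends `A`;
the pairing of `τ_{-z} T` with `y` is that of `T` with `τ_z y`. -/
def translExt (B : H1 →L[ℂ] Hneg1) (z : ℝ) (v : H1) : Hneg1 :=
  (B (translH1 z v)).comp (translH1 z).toContinuousLinearMap

/-- The range of the sequence has compact closure. -/
def Precompact {X : Type*} [TopologicalSpace X] (w : ℕ → X) : Prop :=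
  IsCompact (closure (range w))

/-- Weak convergence to `0` in `H¹(ℝ)`. -/
def WeaklyNull (w : ℕ → H1) : Prop :=
  ∀ ℓ : H1 →L[ℂ] ℂ, Tendsto (fun k => ℓ (w k)) atTop (𝓝 0)

/-! ### The assumptions on the operator -/

/-- `A` is a nonnegative self-adjoint operator, `B : H¹ → H⁻¹` is its bounded extension, and
`(A_z v, v) + c₀ ‖v‖²_{L²} ≃ ‖v‖²_{H¹}` uniformly in `z`. -/
structure A1 (A : L2 →ₗ.[ℂ] L2) (B : H1 →L[ℂ] Hneg1) : Prop where
  selfAdjoint : IsSelfAdjoint A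
  nonneg : ∀ v : A.domain, 0 ≤ (inner ℂ (v : L2) (A v)).re
  extends_ : Extends A B
  equiv : ∃ c₀ > 0, ∃ m > 0, ∃ M > 0, ∀ (z : ℝ) (v : H1),
    m * ‖v‖ ^ 2 ≤ (translExt B z v v).re + c₀ * ‖toL2 v‖ ^ 2 ∧
    (translExt B z v v).re + c₀ * ‖toL2 v‖ ^ 2 ≤ M * ‖v‖ ^ 2

/-- `e^{-itA}` is bounded on `H¹` uniformly in `t`. -/
def A2 (A : L2 →ₗ.[ℂ] L2) : Prop :=
  ∃ M : ℝ, ∀ (t : ℝ) (ψ : H1), ∃ w : H1, toL2 w = expI A (-t) (toL2 ψ) ∧ ‖w‖ ≤ M * ‖ψ‖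

/-- `(A_{x_k} ψ)` is precompact in `H⁻¹`. -/
def A3 (B : H1 →L[ℂ] Hneg1) : Prop :=
  ∀ (ψ : H1) (x : ℕ → ℝ), Precompact fun k => translExt B (x k) ψ

/-- If `(s_k)` converges then `(e^{-i s_k A_{x_k}} ψ)` is precompact in `H¹`. -/
def A4 (A : L2 →ₗ.[ℂ] L2) : Prop :=
  ∀ (ψ : H1) (x s : ℕ → ℝ) (s' : ℝ), Tendsto s atTop (𝓝 s') →
    ∃ w : ℕ → H1, (∀ k, toL2 (w k) = expI (translOp A (x k)) (-s k) (toL2 ψ)) ∧ Precompact w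

/-- `(e^{-i s_k A_{x_k}} ψ)` is precompact in `L^r`. -/
def A5 (A : L2 →ₗ.[ℂ] L2) (r : ℝ≥0∞) [Fact (1 ≤ r)] : Prop :=
  ∀ (ψ : H1) (x s : ℕ → ℝ), ∃ w : ℕ → Lp ℂ r (volume : Measure ℝ),
    (∀ k, (w k : ℝ → ℂ) =ᵐ[volume] (expI (translOp A (x k)) (-s k) (toL2 ψ) : L2)) ∧
    Precompact w

/-- If `|s_k| → ∞` then `e^{i s_k A_{x_k}} ψ ⇀ 0` in `H¹` up to a subsequence. -/
def A6 (A : L2 →ₗ.[ℂ] L2) : Prop :=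
  ∀ (ψ : H1) (x s : ℕ → ℝ), Tendsto (fun k => |s k|) atTop atTop →
    ∃ w : ℕ → H1, (∀ k, toL2 (w k) = expI (translOp A (x k)) (s k) (toL2 ψ)) ∧
      ∃ κ : ℕ → ℕ, StrictMono κ ∧ WeaklyNull (w ∘ κ)

/-! ### Notions of the conclusion -/

/-- A standard sequence tends to `+∞`, or tends to `-∞`, or is identically `0`. -/
def IsStandard (x : ℕ → ℝ) : Prop :=
  Tendsto x atTop atTop ∨ Tendsto x atTop atBot ∨ ∀ n, x n = 0

/-- The profile `e^{itA} τ_x ψ`. -/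
def bubble (A : L2 →ₗ.[ℂ] L2) (t x : ℝ) (ψ : H1) : L2 := expI A t (transl x (toL2 ψ))

/-- `‖e^{-itA} f‖_{L^∞_t L^∞_x}`, an extended nonnegative number. -/
def linftyFlowNorm (A : L2 →ₗ.[ℂ] L2) (f : L2) : ℝ≥0∞ :=
  essSup (fun t : ℝ => eLpNorm (expI A (-t) f : L2) ⊤ volume) volume

/-- `‖f‖_{L^r}^r` for `f ∈ L^r`. -/
def lrNormPow (r : ℝ≥0∞) (f : L2) : ℝ := (eLpNorm f r volume).toReal ^ r.toReal

end ProfileDecomposition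

end

/-! A bounded sequence in H¹ loses compactness only through the motions `e^{itA} τ_x`. Each profile
is a weak limit of the current remainder seen from a moving frame, `τ_{-x_n} e^{-it_n A} R_n`,
chosen so that its L² norm is at least half of the supremum over all frames; the moving profile is
then subtracted and the procedure repeated. All limits are taken along one nonprincipal ultrafilter,
where bounded families converge weakly. Only countably many properties are used, so a single
subsequence realizes them all at the end (`Extractable.exists`).

Two facts govern the frames. If the parameters of two frames diverge from each other, a profile
moving in one is weakly null in the other (`weakTendsto_pull_push`): for bounded time differences by
compactness of the translated flows and escape in space, otherwise by decay in `L^r`. If the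
parameters stay at bounded distance, the two weak limits have the same L² norm
(`exists_weakTendsto_pull`). Hence parameters can be made standard, and those of a new nonzero
profile diverge from all the old ones, since in the old frames the remainder is weakly null.

The norms decouple because the remainder in the frame of its profile is that profile plus a weakly
null part. The L² norm is invariant under the motions; the form is invariant under the flow and the
functionals `A_x ψ` stay in a compact set; in `L^r` the moving profile either vanishes, when `|t_n|
→ ∞`, or is a mere translate, and a Brezis–Lieb argument applies. Decoupling of the energy makes `∑
‖ψ_j‖²` finite, so the profiles tend to 0.

For the dispersive norm, a large value of `e^{-itA} R_n` at a point yields, in the frame of that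
point, a weak limit with a large value at 0. Interpolation bounds this value by the square root of
the product of its L² and H¹ norms, and near optimality bounds the L² norm by that of the last
profile.

The decoupling is asymptotic in n for each J, whereas (e) is required for all J and n. For this,
finitely many parameters of each profile are changed so that the cross terms of the energy have a
finite sum (`exists_bounded_remainder`). Finally, `expI` has a meaning only if the unitary group
exists; nonnegativity gives it by Yosida approximation (`exists_unitary_group`). -/

noncomputable section

namespace ProfileDecomposition

/-! ### Weak convergence in Hilbert spaces -/

section Weak

variable {E F : Type*} [NormedAddCommGroup E] [InnerProductSpace ℂ E]
  [NormedAddCommGroup F] [InnerProductSpace ℂ F] {ι : Type*} {l : Filter ι}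

/-- Weak convergence along a filter, tested against the scalar product. -/
def WeakTendsto (l : Filter ι) (w : ι → E) (ψ : E) : Prop :=
  ∀ g : E, Tendsto (fun i => inner ℂ g (w i)) l (𝓝 (inner ℂ g ψ))

theorem WeakTendsto.mono {l' : Filter ι} {w : ι → E} {ψ : E} (h : WeakTendsto l w ψ) (hl : l' ≤ l) :
    WeakTendsto l' w ψ := fun g => (h g).mono_left hl

theorem WeakTendsto.dual [CompleteSpace E] {w : ι → E} {ψ : E} (h : WeakTendsto l w ψ) (f : E →L[ℂ] ℂ) :
    Tendsto (fun i => f (w i)) l (𝓝 (f ψ)) := by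
  have := h ((InnerProductSpace.toDual ℂ E).symm f)
  simpa [InnerProductSpace.toDual_symm_apply] using this

theorem WeakTendsto.map [CompleteSpace E] [CompleteSpace F] {w : ι → E} {ψ : E} (h : WeakTendsto l w ψ) (T : E →L[ℂ] F) :
    WeakTendsto l (fun i => T (w i)) (T ψ) := by
  intro g
  simpa [ContinuousLinearMap.adjoint_inner_left] using h (ContinuousLinearMap.adjoint T g)

theorem WeakTendsto.add {w w' : ι → E} {ψ ψ' : E} (h : WeakTendsto l w ψ)
    (h' : WeakTendsto l w' ψ') : WeakTendsto l (fun i => w i + w' i) (ψ + ψ') := by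
  intro g
  simpa [inner_add_right] using (h g).add (h' g)

theorem WeakTendsto.sub {w w' : ι → E} {ψ ψ' : E} (h : WeakTendsto l w ψ)
    (h' : WeakTendsto l w' ψ') : WeakTendsto l (fun i => w i - w' i) (ψ - ψ') := by
  intro g
  simpa [inner_sub_right] using (h g).sub (h' g)

theorem weakTendsto_const (ψ : E) : WeakTendsto l (fun _ => ψ) ψ := fun _ => tendsto_const_nhds

theorem WeakTendsto.unique [l.NeBot] {w : ι → E} {ψ ψ' : E} (h : WeakTendsto l w ψ)
    (h' : WeakTendsto l w ψ') : ψ = ψ' :=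
  ext_inner_left ℂ fun g => tendsto_nhds_unique (h g) (h' g)

theorem WeakTendsto.congr' {w w' : ι → E} {ψ : E} (h : WeakTendsto l w ψ) (hw : w =ᶠ[l] w') :
    WeakTendsto l w' ψ := fun g => (h g).congr' (hw.mono fun i hi => by simp only [hi])

/-- Strong convergence against weak convergence of a bounded family. -/
theorem WeakTendsto.inner_strong {g w : ι → E} {γ ψ : E} {C : ℝ} (hg : Tendsto g l (𝓝 γ))
    (hw : WeakTendsto l w ψ) (hb : ∀ᶠ i in l, ‖w i‖ ≤ C) :
    Tendsto (fun i => inner ℂ (g i) (w i)) l (𝓝 (inner ℂ γ ψ)) := by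
  have h1 : Tendsto (fun i => inner ℂ (g i - γ) (w i)) l (𝓝 0) := by
    have h2 : Tendsto (fun i => ‖g i - γ‖ * C) l (𝓝 0) := by
      have := (tendsto_iff_norm_sub_tendsto_zero.1 hg).mul_const C
      simpa using this
    refine squeeze_zero_norm' ?_ h2
    filter_upwards [hb] with i hi
    exact (norm_inner_le_norm _ _).trans (mul_le_mul_of_nonneg_left hi (norm_nonneg _))
  simpa [inner_sub_left] using h1.add (hw γ)

theorem WeakTendsto.norm_le [l.NeBot] {w : ι → E} {ψ : E} {C : ℝ} (hw : WeakTendsto l w ψ)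
    (hb : ∀ᶠ i in l, ‖w i‖ ≤ C) : ‖ψ‖ ≤ C := by
  have h : ‖inner ℂ ψ ψ‖ ≤ ‖ψ‖ * C := by
    refine le_of_tendsto (hw ψ).norm ?_
    filter_upwards [hb] with i hi
    exact (norm_inner_le_norm _ _).trans (mul_le_mul_of_nonneg_left hi (norm_nonneg _))
  rw [inner_self_eq_norm_sq_to_K, norm_pow, RCLike.norm_ofReal, abs_norm, sq] at h
  obtain ⟨i, hi⟩ := hb.exists
  have hC : 0 ≤ C := (norm_nonneg _).trans hi
  rcases (norm_nonneg ψ).eq_or_lt with h0 | h0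
  · rw [← h0]; exact hC
  · exact le_of_mul_le_mul_left h h0

/-- Pythagoras up to `o(1)`: the cross term `2 Re (ψ, w - ψ)` tends to 0 by weak convergence. -/
theorem WeakTendsto.norm_sq_sub {w : ι → E} {ψ : E} (hw : WeakTendsto l w ψ) :
    Tendsto (fun i => ‖w i‖ ^ 2 - (‖ψ‖ ^ 2 + ‖w i - ψ‖ ^ 2)) l (𝓝 0) := by
  have h : ∀ i, ‖w i‖ ^ 2 - (‖ψ‖ ^ 2 + ‖w i - ψ‖ ^ 2) =
      2 * (RCLike.re (inner ℂ ψ (w i)) - ‖ψ‖ ^ 2) := by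
    intro i
    rw [@norm_sub_sq ℂ, ← inner_conj_symm, RCLike.conj_re]
    ring
  simp_rw [h]
  have h1 := (Complex.continuous_re.tendsto _).comp (hw ψ)
  have h2 : (inner ℂ ψ ψ).re = ‖ψ‖ ^ 2 := by
    rw [inner_self_eq_norm_sq_to_K]; norm_cast
  rw [h2] at h1
  have h3 := (h1.sub_const (‖ψ‖ ^ 2)).const_mul 2
  rw [sub_self, mul_zero] at h3
  exact h3

/-- Bounded families have weak limits along ultrafilters. -/
theorem exists_weakTendsto [CompleteSpace E] (U : Ultrafilter ι) {w : ι → E} {C : ℝ} (hw : ∀ᶠ i in U, ‖w i‖ ≤ C) :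
    ∃ ψ, WeakTendsto (U : Filter ι) w ψ := by
  let f : ι → WeakDual ℂ E := fun i => StrongDual.toWeakDual (InnerProductSpace.toDual ℂ E (w i))
  have hK := WeakDual.isCompact_closedBall (𝕜 := ℂ) (E := E) 0 C
  obtain ⟨x, -, hx⟩ := hK.ultrafilter_le_nhds (U.map f) (by
    rw [le_principal_iff]
    refine hw.mono fun i hi => ?_
    simp [f, hi])
  have hx' : Tendsto f U (𝓝 x) := hx
  refine ⟨(InnerProductSpace.toDual ℂ E).symm (WeakDual.toStrongDual x), fun g => ?_⟩
  have h1 : Tendsto (fun i => f i g) U (𝓝 (x g)) :=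
    ((WeakDual.eval_continuous g).tendsto x).comp hx'
  -- The functional attached to `w i` has `w i` in the antilinear slot, so its limit is conjugated.
  have h2 := (Complex.continuous_conj.tendsto _).comp h1
  rw [← inner_conj_symm, InnerProductSpace.toDual_symm_apply]
  refine h2.congr fun i => ?_
  rw [← inner_conj_symm g]
  rfl

end Weak

/-! ### Translations and the inclusion of `H¹` into `L²` -/

theorem transl_ae (z : ℝ) (f : L2) : ∀ᵐ x : ℝ, transl z f x = f (x - z) :=
  Lp.coeFn_compMeasurePreserving f (measurePreserving_sub_right volume z)

theorem transl_transl (a b : ℝ) (f : L2) : transl a (transl b f) = transl (a + b) f := by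
  apply Lp.ext
  have h := (measurePreserving_sub_right volume a).quasiMeasurePreserving.ae (transl_ae b f)
  filter_upwards [transl_ae a (transl b f), transl_ae (a + b) f, h] with x h1 h2 h3
  rw [h1, h2, h3, sub_sub]

@[simp] theorem transl_zero (f : L2) : transl 0 f = f := by
  apply Lp.ext
  filter_upwards [transl_ae 0 f] with x h1
  rw [h1, sub_zero]

@[simp] theorem transl_neg_transl (a : ℝ) (f : L2) : transl (-a) (transl a f) = f := by
  rw [transl_transl, neg_add_cancel, transl_zero]

@[simp] theorem transl_transl_neg (a : ℝ) (f : L2) : transl a (transl (-a) f) = f := by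
  rw [transl_transl, add_neg_cancel, transl_zero]

theorem inner_transl_left (a : ℝ) (f g : L2) :
    inner ℂ (transl a f) g = inner ℂ f (transl (-a) g) := by
  rw [← (transl (-a)).inner_map_map (transl a f) g, transl_neg_transl]

theorem inner_transl_right (a : ℝ) (f g : L2) :
    inner ℂ f (transl a g) = inner ℂ (transl (-a) f) g := by
  rw [inner_transl_left, neg_neg]

theorem continuous_transl (f : L2) : Continuous fun z => transl z f := by
  have h : Continuous fun z : ℝ => (⟨fun x : ℝ => x - z, by fun_prop⟩ : C(ℝ, ℝ)) :=
    ContinuousMap.continuous_of_continuous_uncurry _ (by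
      change Continuous fun p : ℝ × ℝ => p.2 - p.1
      fun_prop)
  exact continuous_const.compMeasurePreservingLp h
    (fun z => measurePreserving_sub_right volume z) (by norm_num)

theorem eLpNorm_transl (p : ℝ≥0∞) (z : ℝ) (f : L2) :
    eLpNorm (transl z f) p volume = eLpNorm f p volume := by
  rw [eLpNorm_congr_ae (transl_ae z f)]
  exact eLpNorm_comp_measurePreserving (Lp.aestronglyMeasurable f)
    (measurePreserving_sub_right volume z)

/-- The inclusion of `H¹` into `L²`, as a bounded operator. -/
def toL2L : H1 →L[ℂ] L2 :=
  (WithLp.fstL 2 ℂ L2 L2).comp H1.subtypeL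

/-- The weak derivative, as a bounded operator. -/
def derivL : H1 →L[ℂ] L2 :=
  (WithLp.sndL 2 ℂ L2 L2).comp H1.subtypeL

@[simp] theorem toL2L_apply (v : H1) : toL2L v = toL2 v := rfl

theorem continuous_toL2 : Continuous toL2 := toL2L.continuous

instance : Inner ℂ H1 := InnerProductSpace.toInner

theorem isWeakDeriv (v : H1) : IsWeakDeriv (toL2 v) (derivL v) := v.2

theorem norm_sq_eq (v : H1) : ‖v‖ ^ 2 = ‖toL2 v‖ ^ 2 + ‖derivL v‖ ^ 2 :=
  WithLp.prod_norm_sq_eq_of_L2 (v : WithLp 2 (L2 × L2))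

theorem norm_toL2_le (v : H1) : ‖toL2 v‖ ≤ ‖v‖ := by
  apply le_of_sq_le_sq _ (norm_nonneg _)
  rw [norm_sq_eq v]; nlinarith [norm_nonneg (derivL v)]

theorem norm_derivL_le (v : H1) : ‖derivL v‖ ≤ ‖v‖ := by
  apply le_of_sq_le_sq _ (norm_nonneg _)
  rw [norm_sq_eq v]; nlinarith [norm_nonneg (toL2 v)]

theorem toL2_translH1 (z : ℝ) (v : H1) : toL2 (translH1 z v) = transl z (toL2 v) := rfl

theorem derivL_translH1 (z : ℝ) (v : H1) : derivL (translH1 z v) = transl z (derivL v) := rfl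

/-- The weak derivative of 0 is orthogonal to all test functions. Identities in H¹ can therefore be
checked in L², where the flow is defined. -/
theorem toL2_injective : Function.Injective toL2 := by
  rw [← LinearMap.ker_eq_bot, LinearMap.ker_eq_bot']
  intro v hv
  have hd : derivL v = 0 := by
    have h0 : ∀ᵐ x : ℝ, (derivL v : ℝ → ℂ) x = 0 := by
      refine ae_eq_zero_of_integral_contDiff_smul_eq_zero
        ((Lp.memLp (derivL v)).locallyIntegrable (by norm_num)) fun η hη hc => ?_
      have h := isWeakDeriv v η hη hc
      rw [hv] at h
      have h1 : ∫ x, deriv η x • (0 : L2) x = 0 := by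
        rw [integral_congr_ae (g := fun _ => 0) (by
          filter_upwards [Lp.coeFn_zero ℂ 2 volume] with x hx
          rw [hx, Pi.zero_apply, smul_zero])]
        simp
      rw [h1] at h
      exact neg_eq_zero.1 h.symm
    apply Lp.ext
    filter_upwards [h0, Lp.coeFn_zero ℂ 2 (volume : Measure ℝ)] with x hx h2
    rw [hx, h2]; rfl
  have : ‖v‖ ^ 2 = 0 := by rw [norm_sq_eq, hv, hd]; simp
  exact norm_eq_zero.1 (pow_eq_zero_iff (by norm_num) |>.1 this)

@[simp] theorem translH1_translH1 (a b : ℝ) (v : H1) :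
    translH1 a (translH1 b v) = translH1 (a + b) v :=
  toL2_injective (by simp only [toL2_translH1, transl_transl])

@[simp] theorem translH1_zero (v : H1) : translH1 0 v = v :=
  toL2_injective (by simp only [toL2_translH1, transl_zero])

/-- The element of `L²` of a compactly supported continuous real function. -/
def testL2 (θ : ℝ → ℝ) (hθ : Continuous θ) (hc : HasCompactSupport θ) : L2 :=
  MemLp.toLp (fun x => (θ x : ℂ)) ((Complex.continuous_ofReal.comp hθ).memLp_of_hasCompactSupport
    (hc.comp_left Complex.ofReal_zero))

theorem inner_testL2 (θ : ℝ → ℝ) (hθ : Continuous θ) (hc : HasCompactSupport θ) (f : L2) :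
    inner ℂ (testL2 θ hθ hc) f = ∫ x, θ x • f x := by
  rw [L2.inner_def]
  refine integral_congr_ae ?_
  filter_upwards [MemLp.coeFn_toLp (p := 2) (μ := volume) (f := fun x => (θ x : ℂ))
    ((Complex.continuous_ofReal.comp hθ).memLp_of_hasCompactSupport
    (hc.comp_left Complex.ofReal_zero))] with x hx
  simp only [testL2]
  rw [hx]
  simp [mul_comm]

/-- Each test function imposes one closed linear condition on the pair `(f, f')`. Completeness
follows, and with it weak compactness of balls. -/
theorem isClosed_H1 : IsClosed (H1 : Set (WithLp 2 (L2 × L2))) := by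
  have h : (H1 : Set (WithLp 2 (L2 × L2))) = ⋂ (η : ℝ → ℝ) (hη : ContDiff ℝ ∞ η)
      (hc : HasCompactSupport η),
      {v | inner ℂ (testL2 (deriv η) (continuous_deriv_test hη) hc.deriv) v.fst =
        - inner ℂ (testL2 η hη.continuous hc) v.snd} := by
    ext v
    simp only [mem_iInter, mem_ofPred_eq, inner_testL2]
    rfl
  rw [h]
  refine isClosed_iInter fun η => isClosed_iInter fun hη => isClosed_iInter fun hc => ?_
  have hf : Continuous fun v : WithLp 2 (L2 × L2) => v.fst := (WithLp.fstL 2 ℂ L2 L2).continuous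
  have hs : Continuous fun v : WithLp 2 (L2 × L2) => v.snd := (WithLp.sndL 2 ℂ L2 L2).continuous
  exact isClosed_eq (continuous_const.inner hf) (continuous_const.inner hs).neg

instance : CompleteSpace H1 := isClosed_H1.completeSpace_coe

instance : Fact ((2 : ℝ≥0∞) ≠ ⊤) := ⟨by norm_num⟩

/-- Separability gives countably many functionals that detect weak convergence of bounded sequences;
see `tendsto_of_forall_weakly_null_seq`. -/
instance : SecondCountableTopology H1 := by
  have : SecondCountableTopology (WithLp 2 (L2 × L2)) :=
    (WithLp.homeomorphProd 2 L2 L2).secondCountableTopology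
  infer_instance

/-- A bounded family in `H¹` converges weakly as soon as the pairings with `H¹` functions in `L²`
converge. -/
theorem weakTendsto_of_toL2 {ι : Type*} {l : Filter ι} {w : ι → H1} {ψ : H1} {C : ℝ}
    (hb : ∀ᶠ i in l, ‖w i‖ ≤ C)
    (h : ∀ φ : H1, Tendsto (fun i => inner ℂ (toL2 φ) (toL2 (w i))) l
      (𝓝 (inner ℂ (toL2 φ) (toL2 ψ)))) : WeakTendsto l w ψ := by
  intro g
  rw [tendsto_iff_ultrafilter]
  intro U hU
  obtain ⟨ψ', hψ'⟩ := exists_weakTendsto U (hU hb)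
  have h1 := hψ'.map toL2L
  have h2 : ∀ φ : H1, inner ℂ (toL2 φ) (toL2 ψ) = inner ℂ (toL2 φ) (toL2 ψ') := fun φ =>
    tendsto_nhds_unique ((h φ).mono_left hU) (h1 (toL2 φ))
  -- The difference of the two candidate limits lies in H¹ and serves as its own test function.
  have h3 : toL2 (ψ - ψ') = 0 := by
    have := h2 (ψ - ψ')
    rw [← sub_eq_zero, ← inner_sub_right, ← map_sub, inner_self_eq_zero] at this
    exact this
  have h4 : ψ = ψ' := by
    rw [← sub_eq_zero]; exact toL2_injective (by rw [h3, map_zero])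
  rw [h4]
  exact hψ' g

/-! ### Stone's theorem for nonnegative self-adjoint operators -/

section Stone

open NormedSpace

theorem norm_sub_le_of_hasDerivAt {E : Type*} [NormedAddCommGroup E] [NormedSpace ℝ E]
    {f f' : ℝ → E} (hf : ∀ t, HasDerivAt f (f' t) t) {C t : ℝ}
    (hC : ∀ s, |s| ≤ |t| → ‖f' s‖ ≤ C) : ‖f t - f 0‖ ≤ C * |t| := by
  have h1 := (convex_Icc (-|t|) |t|).norm_image_sub_le_of_norm_hasDerivWithin_le (f := f)
    (f' := f') (x := 0) (y := t) (C := C) (fun s _ => (hf s).hasDerivWithinAt)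
    (fun s hs => hC s (abs_le.2 hs)) ⟨by simp, by simp⟩ (abs_le.1 le_rfl)
  simpa using h1

variable {E : Type*} [NormedAddCommGroup E] [InnerProductSpace ℂ E] {A : E →ₗ.[ℂ] E}

/-- Pair `v + εAv` with `v` and discard the nonnegative term. This makes `1 + εA` injective with
closed range and its inverse a contraction. -/
theorem norm_le_norm_add_smul (h0 : ∀ v : A.domain, 0 ≤ (inner ℂ (v : E) (A v)).re) {ε : ℝ}
    (hε : 0 ≤ ε) (v : A.domain) : ‖(v : E)‖ ≤ ‖(v : E) + (ε : ℂ) • A v‖ := by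
  have h1 : ‖(v : E)‖ ^ 2 ≤ (inner ℂ (v : E) ((v : E) + (ε : ℂ) • A v)).re := by
    rw [inner_add_right, inner_smul_right, inner_self_eq_norm_sq_to_K, Complex.add_re,
      Complex.re_ofReal_mul]
    have := mul_nonneg hε (h0 v)
    have h2 : (((‖(v : E)‖ : ℝ) : ℂ) ^ 2).re = ‖(v : E)‖ ^ 2 := by
      rw [← Complex.ofReal_pow, Complex.ofReal_re]
    exact h2.symm.le.trans (le_add_of_nonneg_right this)
  have h2 := h1.trans ((Complex.re_le_norm _).trans (norm_inner_le_norm _ _))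
  rcases (norm_nonneg (v : E)).eq_or_lt with h | h
  · rw [← h]; exact norm_nonneg _
  · nlinarith

/-- `K` is the inverse of `1 + ε A`. -/
def IsResolvent (A : E →ₗ.[ℂ] E) (ε : ℝ) (K : E →L[ℂ] E) : Prop :=
  ∀ x, ∃ w : A.domain, (w : E) = K x ∧ (w : E) + (ε : ℂ) • A w = x

namespace IsResolvent

variable {ε δ : ℝ} {K L : E →L[ℂ] E}

theorem norm_apply_le (hK : IsResolvent A ε K)
    (h0 : ∀ v : A.domain, 0 ≤ (inner ℂ (v : E) (A v)).re) (hε : 0 ≤ ε) (x : E) :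
    ‖K x‖ ≤ ‖x‖ := by
  obtain ⟨w, hw, hx⟩ := hK x
  rw [← hw]
  exact (norm_le_norm_add_smul h0 hε w).trans_eq (by rw [hx])

theorem apply_add_smul (hK : IsResolvent A ε K)
    (h0 : ∀ v : A.domain, 0 ≤ (inner ℂ (v : E) (A v)).re) (hε : 0 ≤ ε) (v : A.domain) :
    K ((v : E) + (ε : ℂ) • A v) = v := by
  obtain ⟨w, hw, hx⟩ := hK ((v : E) + (ε : ℂ) • A v)
  have h1 := norm_le_norm_add_smul h0 hε (w - v)
  have h2 : ((w - v : A.domain) : E) + (ε : ℂ) • A (w - v) = 0 := by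
    rw [LinearPMap.map_sub, Submodule.coe_sub, smul_sub, sub_add_sub_comm, hx, sub_self]
  rw [h2, norm_zero, norm_le_zero_iff, Submodule.coe_sub] at h1
  rw [← hw]
  exact sub_eq_zero.1 h1

/-- The resolvent maps the domain into itself and commutes with the operator there. -/
theorem exists_domain (hK : IsResolvent A ε K)
    (h0 : ∀ v : A.domain, 0 ≤ (inner ℂ (v : E) (A v)).re) (hε : 0 < ε) (v : A.domain) :
    ∃ w : A.domain, (w : E) = K v ∧ A w = K (A v) ∧ (ε : ℂ)⁻¹ • ((v : E) - K v) = K (A v) := by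
  have hε' : (ε : ℂ) ≠ 0 := by exact_mod_cast hε.ne'
  have h1 := hK.apply_add_smul h0 hε.le v
  rw [map_add, map_smul] at h1
  have h2 : (ε : ℂ)⁻¹ • ((v : E) - K v) = K (A v) := by
    rw [sub_eq_of_eq_add' h1.symm, inv_smul_smul₀ hε']
  obtain ⟨w, hw, hx⟩ := hK v
  refine ⟨w, hw, ?_, h2⟩
  rw [← h2, ← hw, sub_eq_of_eq_add' hx.symm, inv_smul_smul₀ hε']

/-- `L` preserves the domain and commutes with `A` there, so applying `1 + εA` to `L K x` gives `L
x`. Commuting resolvents give commuting Yosida approximations, whose exponentials can be compared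
directly. -/
theorem commute (hK : IsResolvent A ε K) (hL : IsResolvent A δ L)
    (h0 : ∀ v : A.domain, 0 ≤ (inner ℂ (v : E) (A v)).re) (hε : 0 < ε) (hδ : 0 < δ) :
    Commute K L := by
  refine ContinuousLinearMap.ext fun x => ?_
  change K (L x) = L (K x)
  obtain ⟨v, hv, hx⟩ := hK x
  obtain ⟨w, hw, hAw, -⟩ := hL.exists_domain h0 hδ v
  have h1 := hK.apply_add_smul h0 hε.le w
  rw [hAw, hw, ← map_smul, ← map_add, hx, hv] at h1
  exact h1

end IsResolvent

variable [CompleteSpace E]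

/-- The group `e^{itB}` of a bounded operator `B`. -/
def boundedGroup (B : E →L[ℂ] E) (t : ℝ) : E →L[ℂ] E := exp (t • Complex.I • B)

theorem boundedGroup_zero (B : E →L[ℂ] E) : boundedGroup B 0 = 1 := by
  rw [boundedGroup, zero_smul, exp_zero]

theorem boundedGroup_add (B : E →L[ℂ] E) (s t : ℝ) :
    boundedGroup B (s + t) = boundedGroup B s * boundedGroup B t := by
  let _ : NormedAlgebra ℚ (E →L[ℂ] E) := NormedAlgebra.restrictScalars ℚ ℂ _
  rw [boundedGroup, add_smul,
    exp_add_of_commute (((Commute.refl (Complex.I • B)).smul_left s).smul_right t)]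
  rfl

theorem boundedGroup_sub {B C : E →L[ℂ] E} (h : Commute B C) (t : ℝ) :
    boundedGroup (B - C) t = boundedGroup C (-t) * boundedGroup B t := by
  let _ : NormedAlgebra ℚ (E →L[ℂ] E) := NormedAlgebra.restrictScalars ℚ ℂ _
  have h1 : Commute (-t • Complex.I • C) (t • Complex.I • B) :=
    (((h.symm.smul_left Complex.I).smul_right Complex.I).smul_left (-t)).smul_right t
  rw [boundedGroup, boundedGroup, boundedGroup, ← exp_add_of_commute h1]
  congr 1
  rw [smul_sub, smul_sub, neg_smul]
  abel

theorem norm_boundedGroup_apply {B : E →L[ℂ] E} (hB : IsSelfAdjoint B) (t : ℝ) (v : E) :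
    ‖boundedGroup B t v‖ = ‖v‖ := by
  let _ : NormedAlgebra ℚ (E →L[ℂ] E) := NormedAlgebra.restrictScalars ℚ ℂ _
  have h1 : t • Complex.I • B ∈ skewAdjoint (E →L[ℂ] E) :=
    skewAdjoint.smul_mem t (hB.smul_mem_skewAdjoint Complex.conj_I)
  have h2 := exp_mem_unitary_of_mem_skewAdjoint h1
  exact ContinuousLinearMap.norm_map_of_mem_unitary h2 v

theorem hasDerivAt_boundedGroup_apply (B : E →L[ℂ] E) (v : E) (t : ℝ) :
    HasDerivAt (fun s => boundedGroup B s v) (boundedGroup B t (Complex.I • B v)) t := by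
  have h1 := hasDerivAt_exp_smul_const (𝕂 := ℝ) (Complex.I • B) t
  exact (((ContinuousLinearMap.apply ℂ E v).restrictScalars ℝ).hasFDerivAt.comp_hasDerivAt t h1)

theorem norm_boundedGroup_apply_sub_le {B : E →L[ℂ] E} (hB : IsSelfAdjoint B) (t : ℝ) (v : E) :
    ‖boundedGroup B t v - v‖ ≤ ‖B v‖ * |t| := by
  have h1 := norm_sub_le_of_hasDerivAt (hasDerivAt_boundedGroup_apply B v) (C := ‖B v‖) (t := t)
    (fun s _ => by rw [norm_boundedGroup_apply hB, norm_smul, Complex.norm_I, one_mul])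
  rwa [boundedGroup_zero] at h1

/-- For commuting generators `e^{-itC} e^{itB} = e^{it(B-C)}`, and `e^{itC}` is an isometry.
Convergence of the generators on a vector thus gives convergence of the groups on it. -/
theorem norm_boundedGroup_apply_sub_boundedGroup_apply_le {B C : E →L[ℂ] E} (hB : IsSelfAdjoint B)
    (hC : IsSelfAdjoint C) (h : Commute B C) (t : ℝ) (v : E) :
    ‖boundedGroup B t v - boundedGroup C t v‖ ≤ ‖B v - C v‖ * |t| := by
  have h1 := norm_boundedGroup_apply_sub_le (hB.sub hC) t v
  rw [boundedGroup_sub h] at h1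
  have h2 : boundedGroup C t (boundedGroup C (-t) (boundedGroup B t v) - v) =
      boundedGroup B t v - boundedGroup C t v := by
    rw [map_sub]
    change (boundedGroup C t * boundedGroup C (-t)) (boundedGroup B t v) - _ = _
    rw [← boundedGroup_add, add_neg_cancel, boundedGroup_zero]
    rfl
  rw [← h2, norm_boundedGroup_apply hC]
  exact h1

/-- Contractions that converge pointwise on a dense set converge pointwise to a bounded operator. -/
theorem exists_tendsto_of_contraction {T : ℕ → E →L[ℂ] E} (hT : ∀ n v, ‖T n v‖ ≤ ‖v‖) {D : Set E}
    (hD : Dense D) (h : ∀ v ∈ D, CauchySeq fun n => T n v) :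
    ∃ S : E →L[ℂ] E, ∀ v, Tendsto (fun n => T n v) atTop (𝓝 (S v)) := by
  have h1 : ∀ v, ∃ w, Tendsto (fun n => T n v) atTop (𝓝 w) := by
    intro v
    refine cauchySeq_tendsto_of_complete (Metric.cauchySeq_iff.2 fun ε hε => ?_)
    obtain ⟨w, hw, hvw⟩ := Metric.dense_iff.1 hD v (ε / 3) (by positivity)
    obtain ⟨N, hN⟩ := Metric.cauchySeq_iff.1 (h _ hvw) (ε / 3) (by positivity)
    refine ⟨N, fun m hm n hn => ?_⟩
    have h2 := hN m hm n hn
    have h3 := hT m (v - w)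
    have h4 := hT n (v - w)
    rw [Metric.mem_ball, dist_comm, dist_eq_norm] at hw
    rw [dist_eq_norm] at h2 ⊢
    have e : T m v - T n v = T m (v - w) + (T m w - T n w) - T n (v - w) := by
      simp only [map_sub]; abel
    rw [e]
    have h5 := norm_sub_le (T m (v - w) + (T m w - T n w)) (T n (v - w))
    have h6 := norm_add_le (T m (v - w)) (T m w - T n w)
    linarith
  choose S hS using h1
  exact ⟨continuousLinearMapOfTendsto T (tendsto_pi_nhds.2 hS), hS⟩

theorem inner_apply_left_of_isSelfAdjoint (hA : IsSelfAdjoint A) (v w : A.domain) :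
    inner ℂ (A v) (w : E) = inner ℂ (v : E) (A w) := by
  have h := LinearPMap.adjoint_isFormalAdjoint hA.dense_domain
  have hA' : A.adjoint = A := hA
  rw [hA'] at h
  exact h v w

theorem exists_domain_of_isSelfAdjoint (hA : IsSelfAdjoint A) {y z : E}
    (h : ∀ w : A.domain, inner ℂ z (w : E) = inner ℂ y (A w)) :
    ∃ w : A.domain, (w : E) = y ∧ A w = z := by
  have hmem : y ∈ A.adjoint.domain := LinearPMap.mem_adjoint_domain_of_exists _ ⟨_, h⟩
  have happ := LinearPMap.adjoint_apply_eq hA.dense_domain ⟨_, hmem⟩ h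
  have hA' : A.adjoint = A := hA
  -- The value of the adjoint depends on the proof of membership in its domain, so the adjoint is
  -- replaced by `A` in both at once.
  generalize hT : A.adjoint = T at hmem happ
  rw [hA'] at hT
  subst hT
  exact ⟨⟨_, hmem⟩, rfl, happ⟩

/-- The range is closed because `A` is closed and `1 + εA` does not decrease norms. A vector `y`
orthogonal to it lies in the domain of the adjoint, that is of `A`, with `A y = -ε⁻¹ y`, and
nonnegativity forces `y = 0`. -/
theorem exists_add_smul_eq (hA : IsSelfAdjoint A)
    (h0 : ∀ v : A.domain, 0 ≤ (inner ℂ (v : E) (A v)).re) {ε : ℝ} (hε : 0 < ε) (x : E) :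
    ∃ v : A.domain, (v : E) + (ε : ℂ) • A v = x := by
  have hε' : (ε : ℂ) ≠ 0 := by exact_mod_cast hε.ne'
  let T : A.domain →ₗ[ℂ] E := A.domain.subtype + (ε : ℂ) • A.toFun
  have hT : ∀ v, T v = (v : E) + (ε : ℂ) • A v := fun v => rfl
  have hclosed : IsClosed (LinearMap.range T : Set E) := by
    refine IsSeqClosed.isClosed fun y x hy hx => ?_
    choose v hv using hy
    have hc : CauchySeq fun n => (v n : E) := by
      refine Metric.cauchySeq_iff.2 fun η hη => ?_
      obtain ⟨N, hN⟩ := Metric.cauchySeq_iff.1 hx.cauchySeq η hη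
      refine ⟨N, fun m hm n hn => lt_of_le_of_lt ?_ (hN m hm n hn)⟩
      have := norm_le_norm_add_smul h0 hε.le (v m - v n)
      rw [← hT, map_sub, hv, hv] at this
      rwa [dist_eq_norm, dist_eq_norm]
    obtain ⟨v', hv'⟩ := cauchySeq_tendsto_of_complete hc
    have hAv : Tendsto (fun n => A (v n)) atTop (𝓝 ((ε : ℂ)⁻¹ • (x - v'))) := by
      refine ((hx.sub hv').const_smul (ε : ℂ)⁻¹).congr fun n => ?_
      rw [← hv, hT, add_sub_cancel_left, inv_smul_smul₀ hε']
    have hgr : (v', (ε : ℂ)⁻¹ • (x - v')) ∈ A.graph :=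
      hA.isClosed.isSeqClosed (fun n => A.mem_graph (v n)) (hv'.prodMk_nhds hAv)
    obtain ⟨w, hw, hw'⟩ := (LinearPMap.mem_graph_iff A).1 hgr
    refine ⟨w, ?_⟩
    simp only at hw hw'
    rw [hT, hw, hw', smul_inv_smul₀ hε', add_sub_cancel]
  have : CompleteSpace (LinearMap.range T) := hclosed.completeSpace_coe
  have htop : LinearMap.range T = ⊤ := by
    rw [← Submodule.orthogonal_eq_bot_iff, Submodule.eq_bot_iff]
    intro y hy
    have h1 : ∀ w : A.domain, inner ℂ (-(ε : ℂ)⁻¹ • y) (w : E) = inner ℂ y (A w) := by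
      intro w
      have h2 := (Submodule.mem_orthogonal' _ y).1 hy (T w) ⟨w, rfl⟩
      rw [hT, inner_add_right, inner_smul_right] at h2
      rw [inner_smul_left, map_neg, map_inv₀, Complex.conj_ofReal]
      field_simp
      linear_combination -h2
    obtain ⟨w, hw, hAw⟩ := exists_domain_of_isSelfAdjoint hA h1
    have h3 := h0 w
    rw [hAw, hw, inner_smul_right, inner_self_eq_norm_sq_to_K] at h3
    have h4 : 0 ≤ -(ε⁻¹ * ‖y‖ ^ 2) := by
      refine h3.trans_eq ?_
      have : (-(ε : ℂ)⁻¹ * ((‖y‖ : ℝ) : ℂ) ^ 2) = ((-(ε⁻¹ * ‖y‖ ^ 2) : ℝ) : ℂ) := by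
        push_cast; ring
      exact (congrArg Complex.re this).trans (Complex.ofReal_re _)
    have h5 : 0 < ε⁻¹ := by positivity
    have h6 : ‖y‖ ^ 2 = 0 := by nlinarith [sq_nonneg ‖y‖]
    simpa using h6
  have hx : x ∈ LinearMap.range T := by rw [htop]; trivial
  exact hx

theorem exists_isResolvent (hA : IsSelfAdjoint A)
    (h0 : ∀ v : A.domain, 0 ≤ (inner ℂ (v : E) (A v)).re) {ε : ℝ} (hε : 0 < ε) :
    ∃ K, IsResolvent A ε K := by
  choose k hk using exists_add_smul_eq hA h0 hε
  have huniq : ∀ v w : A.domain, (v : E) + (ε : ℂ) • A v = w + (ε : ℂ) • A w → v = w := by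
    intro v w h
    have h1 := norm_le_norm_add_smul h0 hε.le (v - w)
    rw [LinearPMap.map_sub, smul_sub] at h1
    have h2 : ((v - w : A.domain) : E) + ((ε : ℂ) • A v - (ε : ℂ) • A w) = 0 := by
      rw [Submodule.coe_sub, sub_add_sub_comm, h, sub_self]
    rw [h2, norm_zero, norm_le_zero_iff] at h1
    exact sub_eq_zero.1 (Subtype.ext h1)
  refine ⟨LinearMap.mkContinuous
    { toFun := fun x => (k x : E)
      map_add' := fun x y => ?_
      map_smul' := fun c x => ?_ } 1 fun x => ?_, fun x => ⟨k x, rfl, hk x⟩⟩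
  · rw [← Submodule.coe_add]
    congr 1
    refine huniq _ _ ?_
    rw [hk, LinearPMap.map_add, Submodule.coe_add, smul_add, add_add_add_comm, hk, hk]
  · rw [RingHom.id_apply, ← Submodule.coe_smul]
    congr 1
    refine huniq _ _ ?_
    rw [hk, LinearPMap.map_smul, Submodule.coe_smul, smul_comm, ← smul_add, hk]
  · have := norm_le_norm_add_smul h0 hε.le (k x)
    rw [hk] at this
    rw [one_mul]
    exact this

namespace IsResolvent

variable {ε : ℝ} {K : E →L[ℂ] E}

theorem isSelfAdjoint (hK : IsResolvent A ε K) (hA : IsSelfAdjoint A) : IsSelfAdjoint K := by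
  rw [ContinuousLinearMap.isSelfAdjoint_iff_isSymmetric]
  intro x y
  obtain ⟨v, hv, hx⟩ := hK x
  obtain ⟨w, hw, hy⟩ := hK y
  change inner ℂ (K x) y = inner ℂ x (K y)
  rw [← hv, ← hw, ← hx, ← hy, inner_add_right, inner_add_left, inner_smul_left, inner_smul_right,
    inner_apply_left_of_isSelfAdjoint hA, Complex.conj_ofReal]

end IsResolvent

/-- The Yosida approximations of a nonnegative self-adjoint operator. -/
theorem exists_yosida (hA : IsSelfAdjoint A)
    (h0 : ∀ v : A.domain, 0 ≤ (inner ℂ (v : E) (A v)).re) :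
    ∃ B : ℕ → E →L[ℂ] E, (∀ n, IsSelfAdjoint (B n)) ∧ (∀ m n, Commute (B m) (B n)) ∧
      (∀ n (v : A.domain), ‖B n v‖ ≤ ‖A v‖) ∧
      ∀ v : A.domain, Tendsto (fun n => B n v) atTop (𝓝 (A v)) := by
  let e : ℕ → ℝ := fun n => 1 / ((n : ℝ) + 1)
  have he : ∀ n, 0 < e n := fun n => by positivity
  have helim : Tendsto e atTop (𝓝 0) := tendsto_one_div_add_atTop_nhds_zero_nat
  choose K hK using fun n => exists_isResolvent hA h0 (he n)
  have hKle : ∀ n v, ‖K n v‖ ≤ ‖v‖ := fun n => (hK n).norm_apply_le h0 (he n).le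
  have hKA : ∀ n (v : A.domain), (e n : ℂ)⁻¹ • ((v : E) - K n v) = K n (A v) := fun n v => by
    obtain ⟨_, -, -, h⟩ := (hK n).exists_domain h0 (he n) v
    exact h
  have hK1 : ∀ v : A.domain, Tendsto (fun n => K n v) atTop (𝓝 v) := by
    intro v
    rw [tendsto_iff_norm_sub_tendsto_zero]
    refine squeeze_zero (fun _ => norm_nonneg _) (g := fun n => e n * ‖A v‖) (fun n => ?_)
      (by simpa using helim.mul_const ‖A v‖)
    have h1 : (v : E) - K n v = (e n : ℂ) • K n (A v) := by
      rw [← hKA, smul_inv_smul₀ (by exact_mod_cast (he n).ne')]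
    rw [norm_sub_rev, h1, norm_smul, Complex.norm_real, Real.norm_of_nonneg (he n).le]
    exact mul_le_mul_of_nonneg_left (hKle n _) (he n).le
  obtain ⟨S, hS⟩ := exists_tendsto_of_contraction hKle hA.dense_domain
    fun v hv => (hK1 ⟨v, hv⟩).cauchySeq
  have hS1 : ∀ v, S v = v := congrFun (Continuous.ext_on hA.dense_domain S.continuous
    continuous_id fun v hv => tendsto_nhds_unique (hS v) (hK1 ⟨v, hv⟩))
  -- On the domain the Yosida approximation is the resolvent applied to `A v`: contractivity bounds
  -- it by `‖A v‖`, and strong convergence of the resolvents to 1 gives its limit.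
  have hB : ∀ n (v : A.domain), ((e n)⁻¹ • (1 - K n)) v = K n (A v) := fun n v => by
    rw [← hKA, ← Complex.ofReal_inv]
    rfl
  refine ⟨fun n => (e n)⁻¹ • (1 - K n), fun n => ?_, fun m n => ?_, fun n v => ?_, fun v => ?_⟩
  · exact (IsSelfAdjoint.all _).smul ((IsSelfAdjoint.one _).sub ((hK n).isSelfAdjoint hA))
  · refine (Commute.smul_left ?_ _).smul_right _
    have h1 := (hK m).commute (hK n) h0 (he m) (he n)
    exact ((Commute.one_left _).sub_left ((Commute.one_right _).sub_right h1)
      : Commute (1 - K m) (1 - K n))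
  · rw [hB]; exact hKle n _
  · simp only [hB]
    have h1 := hS (A v)
    rwa [hS1] at h1

/-- Stone's theorem for a nonnegative operator: `A` generates a unitary group. -/
theorem exists_unitary_group (hA : IsSelfAdjoint A)
    (h0 : ∀ v : A.domain, 0 ≤ (inner ℂ (v : E) (A v)).re) :
    ∃ U : ℝ → E →L[ℂ] E, U 0 = ContinuousLinearMap.id ℂ E ∧
      (∀ s t, U (s + t) = (U s).comp (U t)) ∧ (∀ t v, ‖U t v‖ = ‖v‖) ∧
      (∀ v, Continuous fun t => U t v) ∧
      ∀ v : A.domain, HasDerivAt (fun t => U t v) (Complex.I • A v) 0 := by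
  obtain ⟨B, hB, hBB, hBle, hBlim⟩ := exists_yosida hA h0
  have hiso : ∀ n t v, ‖boundedGroup (B n) t v‖ = ‖v‖ := fun n => norm_boundedGroup_apply (hB n)
  have hlim : ∀ t, ∃ S : E →L[ℂ] E,
      ∀ v, Tendsto (fun n => boundedGroup (B n) t v) atTop (𝓝 (S v)) := by
    refine fun t => exists_tendsto_of_contraction (fun n v => (hiso n t v).le) hA.dense_domain
      fun v hv => Metric.cauchySeq_iff.2 fun ε hε => ?_
    obtain ⟨N, hN⟩ := Metric.cauchySeq_iff.1 (hBlim ⟨v, hv⟩).cauchySeq (ε / (|t| + 1))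
      (by positivity)
    refine ⟨N, fun m hm n hn => ?_⟩
    have h1 := hN m hm n hn
    rw [dist_eq_norm, lt_div_iff₀ (by positivity)] at h1
    rw [dist_eq_norm]
    refine (norm_boundedGroup_apply_sub_boundedGroup_apply_le (hB m) (hB n) (hBB m n) t v).trans_lt
      (lt_of_le_of_lt ?_ h1)
    gcongr
    linarith
  choose U hU using hlim
  have hzero : U 0 = ContinuousLinearMap.id ℂ E := by
    refine ContinuousLinearMap.ext fun v => tendsto_nhds_unique (hU 0 v) ?_
    simp only [boundedGroup_zero]
    exact tendsto_const_nhds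
  have hadd : ∀ s t v, U (s + t) v = U s (U t v) := by
    intro s t v
    refine tendsto_nhds_unique (hU (s + t) v) ?_
    have h1 : Tendsto (fun n => boundedGroup (B n) s (boundedGroup (B n) t v - U t v)) atTop
        (𝓝 0) := by
      rw [tendsto_zero_iff_norm_tendsto_zero]
      simp only [hiso]
      exact tendsto_iff_norm_sub_tendsto_zero.1 (hU t v)
    have h2 := h1.add (hU s (U t v))
    rw [zero_add] at h2
    refine h2.congr fun n => ?_
    rw [boundedGroup_add, map_sub, sub_add_cancel]
    rfl
  have hnorm : ∀ t v, ‖U t v‖ = ‖v‖ := fun t v =>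
    tendsto_nhds_unique (hU t v).norm (by simp only [hiso]; exact tendsto_const_nhds)
  -- Continuity at time 0 uniform in `n`, first on the domain, where `‖B n w‖ ≤ ‖A w‖`, then by
  -- density. It survives the limit and yields both strong continuity and the derivative.
  have hequi : ∀ (x : E) (η : ℝ), 0 < η →
      ∃ δ > 0, ∀ s, |s| ≤ δ → ∀ n, ‖boundedGroup (B n) s x - x‖ ≤ η := by
    intro x η hη
    obtain ⟨w, hw, hxw⟩ := Metric.dense_iff.1 hA.dense_domain x (η / 4) (by positivity)
    rw [Metric.mem_ball, dist_comm, dist_eq_norm] at hw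
    have h1 : 0 < 2 * (‖A ⟨w, hxw⟩‖ + 1) := by positivity
    refine ⟨η / (2 * (‖A ⟨w, hxw⟩‖ + 1)), by positivity, fun s hs n => ?_⟩
    rw [le_div_iff₀ h1] at hs
    have h2 : ‖boundedGroup (B n) s w - w‖ ≤ η / 2 := by
      refine (norm_boundedGroup_apply_sub_le (hB n) s w).trans ?_
      have := mul_le_mul_of_nonneg_right (hBle n ⟨w, hxw⟩) (abs_nonneg s)
      nlinarith [abs_nonneg s]
    have e : boundedGroup (B n) s x - x =
        boundedGroup (B n) s (x - w) + (boundedGroup (B n) s w - w) - (x - w) := by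
      rw [map_sub]; abel
    rw [e]
    have h3 := norm_sub_le (boundedGroup (B n) s (x - w) + (boundedGroup (B n) s w - w)) (x - w)
    have h4 := norm_add_le (boundedGroup (B n) s (x - w)) (boundedGroup (B n) s w - w)
    rw [hiso] at h4
    linarith
  refine ⟨U, hzero, fun s t => ContinuousLinearMap.ext (hadd s t), hnorm, fun v => ?_, fun v => ?_⟩
  · refine Metric.continuous_iff.2 fun t ε hε => ?_
    obtain ⟨δ, hδ, h1⟩ := hequi v (ε / 2) (by positivity)
    refine ⟨δ, hδ, fun s hs => ?_⟩
    rw [Real.dist_eq] at hs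
    have h2 : ‖U (s - t) v - v‖ ≤ ε / 2 :=
      le_of_tendsto' ((hU (s - t) v).sub_const v).norm fun n => h1 _ hs.le n
    have h3 : U s v - U t v = U t (U (s - t) v - v) := by
      rw [map_sub, ← hadd, add_sub_cancel]
    rw [dist_eq_norm, h3, hnorm]
    linarith
  · rw [hasDerivAt_iff_isLittleO, Asymptotics.isLittleO_iff]
    intro η hη
    obtain ⟨δ, hδ, h1⟩ := hequi (A v) η hη
    filter_upwards [Metric.closedBall_mem_nhds (0 : ℝ) hδ] with t ht
    rw [Metric.mem_closedBall, Real.dist_0_eq_abs] at ht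
    -- Mean value inequality for `e^{isB_n} v - s i A v`. Its derivative is `i` times the sum of
    -- `e^{isB_n}(B_n v - A v)` and `e^{isB_n} A v - A v`; the first is small for large `n`, the
    -- second for small `s` uniformly in `n`.
    have h2 : ∀ n, ‖boundedGroup (B n) t v - t • Complex.I • A v - v‖ ≤
        (‖B n v - A v‖ + η) * |t| := by
      intro n
      have h3 := norm_sub_le_of_hasDerivAt (t := t) (C := ‖B n v - A v‖ + η)
        (fun s => (hasDerivAt_boundedGroup_apply (B n) v s).sub
          ((hasDerivAt_id s).smul_const (Complex.I • A v))) (fun s hs => by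
            have e : boundedGroup (B n) s (Complex.I • B n v) - (1 : ℝ) • Complex.I • A v =
                Complex.I • (boundedGroup (B n) s (B n v - A v) +
                  (boundedGroup (B n) s (A v) - A v)) := by
              rw [one_smul, map_smul, map_sub, ← smul_sub]; abel_nf
            rw [e, norm_smul, Complex.norm_I, one_mul]
            refine (norm_add_le _ _).trans (add_le_add (hiso _ _ _).le (h1 s (hs.trans ht) n)))
      simpa [boundedGroup_zero] using h3
    have h3 : ‖U t v - t • Complex.I • A v - v‖ ≤ (0 + η) * |t| :=
      le_of_tendsto_of_tendsto' (((hU t v).sub_const _).sub_const _).norm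
        (((tendsto_iff_norm_sub_tendsto_zero.1 (hBlim v)).add_const η).mul_const |t|) h2
    rw [zero_add] at h3
    rw [hzero, sub_zero, Real.norm_eq_abs]
    have e : U t v - ContinuousLinearMap.id ℂ E (v : E) - t • Complex.I • A v =
        U t v - t • Complex.I • A v - v := by
      rw [ContinuousLinearMap.id_apply]; abel
    rwa [e]

end Stone

/-- Excludes the default value 0 in the definition of `expI`. -/
theorem A1.exists_isUnitaryGroup {A : L2 →ₗ.[ℂ] L2} {B : H1 →L[ℂ] Hneg1} (h : A1 A B) :
    ∃ U, IsUnitaryGroup A U := by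
  obtain ⟨U, h0, h1, h2, h3, h4⟩ := exists_unitary_group h.selfAdjoint h.nonneg
  exact ⟨U, h0, h1, h2, h3, h4⟩

/-! ### Unitary groups of self-adjoint operators -/

section Group

variable {A : L2 →ₗ.[ℂ] L2} {U V : ℝ → L2 →L[ℂ] L2}

theorem isUnitaryGroup_expI (h : ∃ U, IsUnitaryGroup A U) : IsUnitaryGroup A (expI A) := by
  rw [expI, dif_pos h]
  exact h.choose_spec

namespace IsUnitaryGroup

theorem apply_add (h : IsUnitaryGroup A U) (s t : ℝ) (v : L2) : U (s + t) v = U s (U t v) := by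
  rw [h.add]; rfl

theorem apply_zero (h : IsUnitaryGroup A U) (v : L2) : U 0 v = v := by
  rw [h.zero]; rfl

theorem apply_neg_apply (h : IsUnitaryGroup A U) (t : ℝ) (v : L2) : U (-t) (U t v) = v := by
  rw [← h.apply_add, neg_add_cancel, h.apply_zero]

theorem apply_apply_neg (h : IsUnitaryGroup A U) (t : ℝ) (v : L2) : U t (U (-t) v) = v := by
  rw [← h.apply_add, add_neg_cancel, h.apply_zero]

theorem inner_map_map (h : IsUnitaryGroup A U) (t : ℝ) (v w : L2) :
    inner ℂ (U t v) (U t w) = inner ℂ v w :=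
  (LinearIsometry.mk (U t : L2 →ₗ[ℂ] L2) (h.norm_map t)).inner_map_map v w

theorem inner_left (h : IsUnitaryGroup A U) (t : ℝ) (v w : L2) :
    inner ℂ (U t v) w = inner ℂ v (U (-t) w) := by
  rw [← h.inner_map_map (-t), h.apply_neg_apply]

theorem hasDerivAt_apply (h : IsUnitaryGroup A U) (v : A.domain) (t : ℝ) :
    HasDerivAt (fun s => U s v) (U t (Complex.I • A v)) t := by
  have h1 : HasDerivAt (fun s => U (s - t) v) (Complex.I • A v) t := by
    have h0 : HasDerivAt (fun s => U s v) (Complex.I • A v) (t - t) := by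
      rw [sub_self]; exact h.hasDerivAt v
    exact h0.comp_sub_const t t
  have h2 := ((U t).hasFDerivAt (x := U (t - t) v)).restrictScalars ℝ |>.comp_hasDerivAt t h1
  refine (h2.congr_of_eventuallyEq (Eventually.of_forall fun s => ?_))
  simp only [Function.comp]
  change _ = U t (U (s - t) v)
  rw [← h.apply_add, add_sub_cancel]

/-- Differentiating `(U_t v, U_s w)` at `s = 0`, with `U_s` on `w` or with its inverse on `v`, shows
that `U_t v` lies in the domain of the adjoint of `A`. -/
theorem exists_domain (h : IsUnitaryGroup A U) (hA : IsSelfAdjoint A) (t : ℝ) (v : A.domain) :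
    ∃ w : A.domain, (w : L2) = U t v ∧ A w = U t (A v) := by
  have key : ∀ w : A.domain, inner ℂ (U t (A v)) (w : L2) = inner ℂ (U t v) (A w) := by
    intro w
    have h1 : HasDerivAt (fun s => inner ℂ (U t v) (U s w))
        (inner ℂ (U t v) (Complex.I • A w)) 0 := by
      simpa using (hasDerivAt_const (0 : ℝ) (U t v)).inner ℂ (h.hasDerivAt w)
    have h2 : HasDerivAt (fun s => U (-s) v) (-(Complex.I • A v)) 0 := by
      have h0 : HasDerivAt (fun s => U s v) (Complex.I • A v) (-0) := by
        rw [neg_zero]; exact h.hasDerivAt v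
      have h6 := h0.scomp (0 : ℝ) (hasDerivAt_neg (0 : ℝ))
      rw [neg_one_smul] at h6
      exact h6
    have h3 := ((U t).hasFDerivAt (x := U (-0) v)).restrictScalars ℝ |>.comp_hasDerivAt 0 h2
    have h4 : HasDerivAt (fun s => inner ℂ (U t v) (U s w))
        (inner ℂ (U t (-(Complex.I • A v))) (w : L2)) 0 := by
      have h5 := h3.inner ℂ (hasDerivAt_const (0 : ℝ) (w : L2))
      simp only [inner_zero_right, zero_add] at h5
      refine h5.congr_of_eventuallyEq (Eventually.of_forall fun s => ?_)
      change inner ℂ (U t v) (U s w) = inner ℂ (U t (U (-s) v)) (w : L2)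
      rw [← h.apply_add, add_comm, h.apply_add, h.inner_left (-s), neg_neg]
    have h6 := h1.unique h4
    rw [map_neg, map_smul, inner_neg_left, inner_smul_left, inner_smul_right, Complex.conj_I] at h6
    have h7 : Complex.I * (inner ℂ (U t v) (A w) - inner ℂ (U t (A v)) (w : L2)) = 0 := by
      linear_combination h6
    rcases mul_eq_zero.1 h7 with h8 | h8
    · exact absurd h8 Complex.I_ne_zero
    · exact (sub_eq_zero.1 h8).symm
  exact exists_domain_of_isSelfAdjoint hA key

/-- The pairing `(V_s w, U_s v)` has zero derivative for `v`, `w` in the domain, by symmetry of `A`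
and invariance of the domain. So `V_{-s} U_s = 1` by density. -/
theorem unique (hA : IsSelfAdjoint A) (hU : IsUnitaryGroup A U) (hV : IsUnitaryGroup A V) :
    U = V := by
  have key : ∀ (s : ℝ) (v w : A.domain), inner ℂ (V s w) (U s v) = inner ℂ (w : L2) (v : L2) := by
    intro s v w
    have hd : ∀ s, HasDerivAt (fun s => inner ℂ (V s w) (U s v)) 0 s := by
      intro s
      have h1 := (hV.hasDerivAt_apply w s).inner ℂ (hU.hasDerivAt_apply v s)
      obtain ⟨v', hv', hAv⟩ := hU.exists_domain hA s v
      obtain ⟨w', hw', hAw⟩ := hV.exists_domain hA s w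
      have h2 : inner ℂ (V s w) (U s (Complex.I • A v)) +
          inner ℂ (V s (Complex.I • A w)) (U s v) = 0 := by
        rw [map_smul, map_smul, inner_smul_left, inner_smul_right, Complex.conj_I, ← hAv, ← hAw,
          ← hv', ← hw', inner_apply_left_of_isSelfAdjoint hA w' v']
        ring
      rwa [h2] at h1
    have hc := is_const_of_deriv_eq_zero (fun s => (hd s).differentiableAt)
      (fun s => (hd s).deriv) s 0
    simpa [hU.apply_zero, hV.apply_zero] using hc
  funext s
  apply ContinuousLinearMap.ext
  intro v
  refine congrFun (Continuous.ext_on hA.dense_domain (U s).continuous (V s).continuous ?_) v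
  intro v hv
  have h1 : ∀ w : L2, inner ℂ w (V (-s) (U s v)) = inner ℂ w v := by
    intro w
    refine congrFun (Continuous.ext_on hA.dense_domain (f := fun w => inner ℂ w (V (-s) (U s v)))
      (g := fun w => inner ℂ w v) (by fun_prop) (by fun_prop) ?_) w
    intro w hw
    have := key s ⟨v, hv⟩ ⟨w, hw⟩
    rwa [hV.inner_left] at this
  have h2 : V (-s) (U s v) = v := ext_inner_left ℂ h1
  rw [← h2, hV.apply_apply_neg, h2]

/-- Conjugation by translations. -/
theorem conj_transl (hU : IsUnitaryGroup A U) (z : ℝ) :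
    IsUnitaryGroup (translOp A z) fun t =>
      (transl (-z)).toContinuousLinearMap.comp ((U t).comp (transl z).toContinuousLinearMap) where
  zero := by
    ext1 v
    simp [hU.zero]
  add s t := by
    ext1 v
    simp [hU.add]
  norm_map t v := by simp [hU.norm_map]
  continuous v := (transl (-z)).continuous.comp (hU.continuous (transl z v))
  hasDerivAt v := by
    have h1 := hU.hasDerivAt ⟨transl z v, v.2⟩
    have h2 := (((transl (-z)).toContinuousLinearMap.hasFDerivAt
      (x := U 0 (transl z v))).restrictScalars ℝ).comp_hasDerivAt (0 : ℝ) h1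
    refine h2.congr_deriv ?_
    change transl (-z) (Complex.I • A ⟨transl z v, v.2⟩) = _
    rw [map_smul]
    rfl

/-- Conjugating back reduces uniqueness for the translated operator to that for `A`, so
self-adjointness of `translOp A z` is not needed in `expI_translOp`. -/
theorem conj_transl_inv {W : ℝ → L2 →L[ℂ] L2} {z : ℝ} (hW : IsUnitaryGroup (translOp A z) W) :
    IsUnitaryGroup A fun t =>
      (transl z).toContinuousLinearMap.comp ((W t).comp (transl (-z)).toContinuousLinearMap) where
  zero := by
    ext1 v
    simp [hW.zero]
  add s t := by
    ext1 v
    simp [hW.add]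
  norm_map t v := by simp [hW.norm_map]
  continuous v := (transl z).continuous.comp (hW.continuous (transl (-z) v))
  hasDerivAt v := by
    have hv : transl (-z) (v : L2) ∈ (translOp A z).domain := by
      change transl z (transl (-z) (v : L2)) ∈ A.domain
      rw [transl_transl_neg]; exact v.2
    have h1 := hW.hasDerivAt ⟨_, hv⟩
    have h2 := (((transl z).toContinuousLinearMap.hasFDerivAt
      (x := W 0 (transl (-z) (v : L2)))).restrictScalars ℝ).comp_hasDerivAt (0 : ℝ) h1
    refine h2.congr_deriv ?_
    change transl z (Complex.I • transl (-z) (A ⟨transl z (transl (-z) (v : L2)), hv⟩)) = _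
    rw [map_smul, transl_transl_neg]
    congr 2
    exact Subtype.ext (transl_transl_neg z v)

end IsUnitaryGroup

theorem expI_translOp (hA : IsSelfAdjoint A) (hU : IsUnitaryGroup A (expI A)) (z t : ℝ) (v : L2) :
    expI (translOp A z) t v = transl (-z) (expI A t (transl z v)) := by
  have h1 := isUnitaryGroup_expI ⟨_, hU.conj_transl z⟩
  have h2 := IsUnitaryGroup.unique hA h1.conj_transl_inv hU
  rw [← h2]
  simp

end Group

/-! ### The flow on `H¹` and conservation of energy -/

/-- The standing assumptions, except that on `L^r`, together with the existence of the unitary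
group of `A`. -/
structure Setup (A : L2 →ₗ.[ℂ] L2) (B : H1 →L[ℂ] Hneg1) : Prop where
  group : IsUnitaryGroup A (expI A)
  a1 : A1 A B
  a2 : A2 A
  a3 : A3 B
  a4 : A4 A
  a6 : A6 A

open Classical in
/-- The restriction of `e^{itA}` to `H¹`. -/
def flow (A : L2 →ₗ.[ℂ] L2) (t : ℝ) : H1 →L[ℂ] H1 :=
  if h : ∃ T : H1 →L[ℂ] H1, ∀ v, toL2 (T v) = expI A t (toL2 v) then h.choose else 0

/-- The translation on `H¹` as a bounded operator. -/
def translL (z : ℝ) : H1 →L[ℂ] H1 := (translH1 z).toContinuousLinearMap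

@[simp] theorem translL_apply (z : ℝ) (v : H1) : translL z v = translH1 z v := rfl

/-- The map `ψ ↦ e^{itA} τ_x ψ` on `H¹`. -/
def push (A : L2 →ₗ.[ℂ] L2) (t x : ℝ) : H1 →L[ℂ] H1 := (flow A t).comp (translL x)

/-- The map `v ↦ τ_{-x} e^{-itA} v` on `H¹`. -/
def pull (A : L2 →ₗ.[ℂ] L2) (t x : ℝ) : H1 →L[ℂ] H1 := (translL (-x)).comp (flow A (-t))

theorem translExt_apply (B : H1 →L[ℂ] Hneg1) (z : ℝ) (v w : H1) :
    translExt B z v w = B (translH1 z v) (translH1 z w) := rfl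

namespace Setup

variable {A : L2 →ₗ.[ℂ] L2} {B : H1 →L[ℂ] Hneg1}

/-- The elements supplied by `A2` are unique because H¹ embeds in L², hence linear in the datum.
This excludes the default value 0 in `flow`. -/
theorem exists_flow_bound (h : Setup A B) : ∃ M : ℝ, 1 ≤ M ∧ ∀ t (v : H1),
    toL2 (flow A t v) = expI A t (toL2 v) ∧ ‖flow A t v‖ ≤ M * ‖v‖ := by
  obtain ⟨M, hM⟩ := h.a2
  choose w hw hwb using hM
  have hex : ∀ t, ∃ T : H1 →L[ℂ] H1, ∀ v, toL2 (T v) = expI A t (toL2 v) := by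
    intro t
    refine ⟨LinearMap.mkContinuous
      { toFun := fun v => w (-t) v
        map_add' := fun u v => toL2_injective (by simp [hw])
        map_smul' := fun c v => toL2_injective (by simp [hw]) } M (hwb (-t)), fun v => ?_⟩
    change toL2 (w (-t) v) = _
    rw [hw, neg_neg]
  have hflow : ∀ t v, toL2 (flow A t v) = expI A t (toL2 v) := by
    intro t
    rw [flow, dif_pos (hex t)]
    exact (hex t).choose_spec
  refine ⟨max M 1, le_max_right _ _, fun t v => ⟨hflow t v, ?_⟩⟩
  have : flow A t v = w (-t) v := toL2_injective (by rw [hflow, hw, neg_neg])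
  rw [this]
  exact (hwb _ _).trans (mul_le_mul_of_nonneg_right (le_max_left _ _) (norm_nonneg _))

theorem toL2_flow (h : Setup A B) (t : ℝ) (v : H1) : toL2 (flow A t v) = expI A t (toL2 v) := by
  obtain ⟨M, -, hM⟩ := h.exists_flow_bound
  exact (hM t v).1

theorem flow_zero (h : Setup A B) (v : H1) : flow A 0 v = v :=
  toL2_injective (by rw [h.toL2_flow, h.group.apply_zero])

theorem flow_flow (h : Setup A B) (s t : ℝ) (v : H1) :
    flow A s (flow A t v) = flow A (s + t) v :=
  toL2_injective (by rw [h.toL2_flow, h.toL2_flow, h.toL2_flow, h.group.apply_add])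

theorem toL2_push (h : Setup A B) (t x : ℝ) (v : H1) :
    toL2 (push A t x v) = bubble A t x v := h.toL2_flow t _

theorem toL2_push' (h : Setup A B) (t x : ℝ) (v : H1) :
    toL2 (push A t x v) = expI A t (transl x (toL2 v)) := h.toL2_flow t _

theorem toL2_pull (h : Setup A B) (t x : ℝ) (v : H1) :
    toL2 (pull A t x v) = transl (-x) (expI A (-t) (toL2 v)) := by
  change transl (-x) (toL2 (flow A (-t) v)) = _
  rw [h.toL2_flow]

theorem pull_push (h : Setup A B) (t x : ℝ) (v : H1) : pull A t x (push A t x v) = v := by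
  change translH1 (-x) (flow A (-t) (flow A t (translH1 x v))) = v
  rw [h.flow_flow, neg_add_cancel, h.flow_zero, translH1_translH1, neg_add_cancel, translH1_zero]

theorem push_pull (h : Setup A B) (t x : ℝ) (v : H1) : push A t x (pull A t x v) = v := by
  change flow A t (translH1 x (translH1 (-x) (flow A (-t) v))) = v
  rw [translH1_translH1, add_neg_cancel, translH1_zero, h.flow_flow, add_neg_cancel, h.flow_zero]

theorem exists_push_pull_bound (h : Setup A B) : ∃ M : ℝ, 1 ≤ M ∧ ∀ t x (v : H1),
    ‖push A t x v‖ ≤ M * ‖v‖ ∧ ‖pull A t x v‖ ≤ M * ‖v‖ := by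
  obtain ⟨M, hM1, hM⟩ := h.exists_flow_bound
  refine ⟨M, hM1, fun t x v => ⟨?_, ?_⟩⟩
  · refine ((hM t (translH1 x v)).2).trans_eq ?_
    rw [LinearIsometry.norm_map]
  · change ‖translH1 (-x) (flow A (-t) v)‖ ≤ _
    rw [LinearIsometry.norm_map]
    exact (hM _ v).2

theorem norm_toL2_push (h : Setup A B) (t x : ℝ) (v : H1) : ‖toL2 (push A t x v)‖ = ‖toL2 v‖ := by
  rw [h.toL2_push', h.group.norm_map, LinearIsometry.norm_map]

theorem norm_toL2_pull (h : Setup A B) (t x : ℝ) (v : H1) : ‖toL2 (pull A t x v)‖ = ‖toL2 v‖ := by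
  rw [h.toL2_pull, LinearIsometry.norm_map, h.group.norm_map]

theorem exists_equiv (h : Setup A B) : ∃ c₀ > 0, ∃ m > 0, ∃ M > 0, ∀ v : H1,
    m * ‖v‖ ^ 2 ≤ (B v v).re + c₀ * ‖toL2 v‖ ^ 2 ∧
    (B v v).re + c₀ * ‖toL2 v‖ ^ 2 ≤ M * ‖v‖ ^ 2 := by
  obtain ⟨c, hc, m, hm, M, hM, H⟩ := h.a1.equiv
  refine ⟨c, hc, m, hm, M, hM, fun v => ?_⟩
  have := H 0 v
  simpa only [translExt_apply, translH1_zero] using this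

/-- The elements of `H¹` that lie in the domain of `A`. -/
def domH1 (A : L2 →ₗ.[ℂ] L2) : Submodule ℂ H1 := A.domain.comap toL2

theorem apply_domH1 (h : Setup A B) (w : domH1 A) (y : H1) :
    B w y = inner ℂ (toL2 y) (A ⟨toL2 w, w.2⟩) := by
  obtain ⟨w', hw', hB⟩ := h.a1.extends_ ⟨toL2 w, w.2⟩
  rw [← hB, toL2_injective hw']

/-- `D(A)` is dense in `H¹`. -/
theorem dense_domH1 (h : Setup A B) : Dense (domH1 A : Set H1) := by
  obtain ⟨c, hc, m, hm, M, -, hE⟩ := h.exists_equiv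
  -- The form `(Av, v) + c‖v‖²` is coercive on H¹, so the operator `T` representing it is onto, as
  -- in the Lax–Milgram lemma.
  let Q : H1 →L⋆[ℂ] H1 →L[ℂ] ℂ := B.flip + (c : ℂ) • ((innerSL ℂ (E := L2)).flip.comp toL2L).flip.comp toL2L
  let T : H1 →L[ℂ] H1 := InnerProductSpace.continuousLinearMapOfBilin Q
  have hT : ∀ v w, inner ℂ (T v) w = B w v + c * inner ℂ (toL2 v) (toL2 w) := by
    intro v w
    rw [InnerProductSpace.continuousLinearMapOfBilin_apply]
    rfl
  have hre : ∀ v : H1, ((c : ℂ) * inner ℂ (toL2 v) (toL2 v)).re = c * ‖toL2 v‖ ^ 2 := by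
    intro v
    rw [Complex.re_ofReal_mul]
    exact congrArg (c * ·) (inner_self_eq_norm_sq (𝕜 := ℂ) (toL2 v))
  have hbelow : ∀ v, m * ‖v‖ ≤ ‖T v‖ := by
    intro v
    rcases (norm_nonneg v).eq_or_lt with h0 | h0
    · rw [← h0, mul_zero]; exact norm_nonneg _
    · refine le_of_mul_le_mul_right ?_ h0
      calc m * ‖v‖ * ‖v‖ = m * ‖v‖ ^ 2 := by ring
        _ ≤ (B v v).re + c * ‖toL2 v‖ ^ 2 := (hE v).1
        _ = (inner ℂ (T v) v).re := by
          rw [hT, Complex.add_re, hre]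
        _ ≤ ‖inner ℂ (T v) v‖ := Complex.re_le_norm _
        _ ≤ ‖T v‖ * ‖v‖ := norm_inner_le_norm (𝕜 := ℂ) (E := H1) (T v) v
  have hanti : AntilipschitzWith m⁻¹.toNNReal T := by
    refine ContinuousLinearMap.antilipschitz_of_bound T fun v => ?_
    rw [Real.coe_toNNReal _ (inv_pos.2 hm).le, ← div_eq_inv_mul, le_div_iff₀ hm, mul_comm]
    exact hbelow v
  have hclosed : IsClosed (T.range : Set H1) := hanti.isClosed_range T.uniformContinuous
  have hrange : T.range = ⊤ := by
    have : CompleteSpace T.range := hclosed.completeSpace_coe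
    rw [← T.range.orthogonal_orthogonal, Submodule.eq_top_iff']
    intro v w hw
    have hw0 : w = 0 := by
      have h1 : inner ℂ (T w) w = 0 := hw _ ⟨w, rfl⟩
      rw [hT] at h1
      have h2 := congrArg Complex.re h1
      rw [Complex.add_re, hre] at h2
      have h3 : m * ‖w‖ ^ 2 ≤ 0 := by
        refine ((hE w).1).trans (le_of_eq ?_)
        rw [← Complex.zero_re, ← h2]
      have h4 : ‖w‖ ^ 2 = 0 := le_antisymm (by nlinarith) (by positivity)
      exact norm_eq_zero.1 (pow_eq_zero_iff (by norm_num) |>.1 h4)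
    rw [hw0, inner_zero_left]
  have hortho : (domH1 A)ᗮ = ⊥ := by
    rw [Submodule.eq_bot_iff]
    intro f hf
    obtain ⟨y, hy⟩ : f ∈ T.range := by rw [hrange]; trivial
    -- Orthogonality of `T y` to D(A) in H¹ means that `y` is orthogonal in L² to the range of `A +
    -- c`. Then `y` is in D(A) with `A y = -c y`, which nonnegativity allows only for `y = 0`.
    have key : ∀ w : A.domain, inner ℂ (toL2 y) (A w + (c : ℂ) • (w : L2)) = 0 := by
      intro w
      obtain ⟨w', hw', hB⟩ := h.a1.extends_ w
      have h1 : inner ℂ f w' = 0 := by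
        exact inner_eq_zero_symm.1
          (hf w' (by change toL2 w' ∈ A.domain; rw [hw']; exact w.2))
      rw [← hy] at h1
      change inner ℂ (T y) w' = 0 at h1
      rw [hT, hB, hw'] at h1
      rw [inner_add_right, inner_smul_right, h1]
    have key2 : ∀ w : A.domain, inner ℂ (-(c : ℂ) • toL2 y) (w : L2) = inner ℂ (toL2 y) (A w) := by
      intro w
      have h1 := key w
      rw [inner_add_right, inner_smul_right] at h1
      rw [inner_smul_left, map_neg, Complex.conj_ofReal]
      linear_combination -h1
    have hmem : toL2 y ∈ A.adjoint.domain := LinearPMap.mem_adjoint_domain_of_exists _ ⟨_, key2⟩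
    have happ := LinearPMap.adjoint_apply_eq h.a1.selfAdjoint.dense_domain ⟨_, hmem⟩ key2
    have hA' : A.adjoint = A := h.a1.selfAdjoint
    generalize hTA : A.adjoint = T' at hmem happ
    rw [hA'] at hTA
    subst hTA
    have hn := h.a1.nonneg ⟨toL2 y, hmem⟩
    rw [happ] at hn
    change 0 ≤ (inner ℂ (toL2 y) (-(c : ℂ) • toL2 y)).re at hn
    rw [inner_smul_right, inner_self_eq_norm_sq_to_K] at hn
    have h5 : (-(c : ℂ) * ((‖toL2 y‖ : ℝ) : ℂ) ^ 2).re = -(c * ‖toL2 y‖ ^ 2) := by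
      rw [neg_mul, Complex.neg_re]; norm_cast
    have h6 : 0 ≤ -(c * ‖toL2 y‖ ^ 2) := by rw [← h5]; exact hn
    have h7 : ‖toL2 y‖ ^ 2 = 0 := le_antisymm (by nlinarith) (by positivity)
    have h8 : y = 0 := toL2_injective (by
      rw [map_zero]; exact norm_eq_zero.1 (pow_eq_zero_iff (by norm_num) |>.1 h7))
    rw [← hy, h8]; exact map_zero T
  exact Submodule.dense_iff_topologicalClosure_eq_top.2
    (Submodule.topologicalClosure_eq_top_iff.2 hortho)

theorem hermitian (h : Setup A B) (v w : H1) : B v w = starRingEnd ℂ (B w v) := by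
  have step : ∀ v ∈ domH1 A, ∀ w : H1, B v w = starRingEnd ℂ (B w v) := by
    intro v hv w
    refine congrFun (Continuous.ext_on h.dense_domH1 (f := fun w => B v w)
      (g := fun w => starRingEnd ℂ (B w v)) (by fun_prop) (by fun_prop) ?_) w
    intro w hw
    change B v w = starRingEnd ℂ (B w v)
    rw [h.apply_domH1 ⟨v, hv⟩ w, h.apply_domH1 ⟨w, hw⟩ v, inner_conj_symm]
    exact (inner_apply_left_of_isSelfAdjoint h.a1.selfAdjoint ⟨toL2 w, hw⟩ ⟨toL2 v, hv⟩).symm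
  refine congrFun (Continuous.ext_on h.dense_domH1 (f := fun v => B v w)
      (g := fun v => starRingEnd ℂ (B w v)) (by fun_prop) (by fun_prop) ?_) v
  intro v hv
  exact step v hv w

/-- Conservation of energy: on D(A) the flow commutes with `A` and preserves L² pairings, and D(A)
is dense in H¹. -/
theorem form_flow (h : Setup A B) (t : ℝ) (v w : H1) : B (flow A t v) (flow A t w) = B v w := by
  refine congrFun (Continuous.ext_on h.dense_domH1 (f := fun v => B (flow A t v) (flow A t w))
      (g := fun v => B v w) (by fun_prop) (by fun_prop) ?_) v
  intro v hv
  change B (flow A t v) (flow A t w) = B v w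
  obtain ⟨v', hv', hAv⟩ := h.group.exists_domain h.a1.selfAdjoint t ⟨toL2 v, hv⟩
  have hd : flow A t v ∈ domH1 A := by
    change toL2 (flow A t v) ∈ A.domain
    rw [h.toL2_flow, ← hv']; exact v'.2
  have he : (⟨toL2 (flow A t v), hd⟩ : A.domain) = v' := Subtype.ext (by
    rw [hv']; exact h.toL2_flow t v)
  rw [h.apply_domH1 ⟨_, hd⟩, h.apply_domH1 ⟨v, hv⟩]
  change inner ℂ _ (A ⟨toL2 (flow A t v), hd⟩) = _
  rw [he, hAv, h.toL2_flow, h.group.inner_map_map]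

/-- Moves the flow to the other entry: what remains of the profile is the functional `A_x ψ`, to
which `A3` applies. -/
theorem form_push_left (h : Setup A B) (t x : ℝ) (ψ v : H1) :
    B (push A t x ψ) v = translExt B x ψ (pull A t x v) := by
  conv_lhs => rw [← h.push_pull t x v]
  exact h.form_flow t _ _

theorem form_push_self (h : Setup A B) (t x : ℝ) (ψ : H1) :
    B (push A t x ψ) (push A t x ψ) = B (translH1 x ψ) (translH1 x ψ) := h.form_flow t _ _

end Setup

/-! ### Point evaluation on `H¹` -/

open Classical in
/-- The element of `L²` given by a real function on the interval `(0, δ]`. -/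
def kerL2 (δ : ℝ) (k : ℝ → ℝ) : L2 :=
  if h : MemLp (fun x => ((indicator (Ioc 0 δ) k x : ℝ) : ℂ)) 2 volume then h.toLp _ else 0

theorem memLp_ker (δ : ℝ) {k : ℝ → ℝ} (hk : Continuous k) :
    MemLp (fun x => ((indicator (Ioc 0 δ) k x : ℝ) : ℂ)) 2 volume := by
  obtain ⟨C, hC⟩ := isCompact_Icc.exists_bound_of_continuousOn (s := Icc 0 δ) hk.continuousOn
  have h : MemLp (indicator (Ioc 0 δ) fun _ : ℝ => C) 2 volume :=
    memLp_indicator_const 2 measurableSet_Ioc C (Or.inr measure_Ioc_lt_top.ne)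
  refine h.mono (Complex.measurable_ofReal.comp
    (hk.measurable.indicator measurableSet_Ioc)).aestronglyMeasurable
    (Eventually.of_forall fun x => ?_)
  by_cases hx : x ∈ Ioc 0 δ
  · rw [indicator_of_mem hx, indicator_of_mem hx, Complex.norm_real]
    exact (hC x ⟨hx.1.le, hx.2⟩).trans (le_abs_self C)
  · rw [indicator_of_notMem hx, indicator_of_notMem hx]; simp

theorem kerL2_ae (δ : ℝ) {k : ℝ → ℝ} (hk : Continuous k) :
    ∀ᵐ x : ℝ, kerL2 δ k x = ((indicator (Ioc 0 δ) k x : ℝ) : ℂ) := by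
  rw [kerL2, dif_pos (memLp_ker δ hk)]
  exact MemLp.coeFn_toLp _

theorem inner_kerL2 (δ : ℝ) {k : ℝ → ℝ} (hk : Continuous k) (f : L2) :
    inner ℂ (kerL2 δ k) f = ∫ y, indicator (Ioc 0 δ) k y • f y := by
  rw [L2.inner_def]
  refine integral_congr_ae ?_
  filter_upwards [kerL2_ae δ hk] with x hx
  rw [hx]
  simp [mul_comm]

theorem norm_kerL2_le {δ : ℝ} (hδ : 0 < δ) {k : ℝ → ℝ} (hk : Continuous k) {C : ℝ}
    (hC : ∀ x ∈ Ioc 0 δ, |k x| ≤ C) : ‖kerL2 δ k‖ ≤ C * √δ := by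
  have hC0 : 0 ≤ C := (abs_nonneg _).trans (hC δ ⟨hδ, le_rfl⟩)
  rw [Lp.norm_def]
  refine ENNReal.toReal_le_of_le_ofReal (by positivity) ?_
  have h1 : eLpNorm (kerL2 δ k) 2 volume ≤
      eLpNorm (indicator (Ioc 0 δ) fun _ : ℝ => C) 2 volume := by
    refine eLpNorm_mono_ae ?_
    filter_upwards [kerL2_ae δ hk] with x hx
    rw [hx]
    by_cases hx' : x ∈ Ioc 0 δ
    · rw [indicator_of_mem hx', indicator_of_mem hx', Complex.norm_real]
      exact (hC x hx').trans (le_abs_self C)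
    · rw [indicator_of_notMem hx', indicator_of_notMem hx']; simp
  refine h1.trans (le_of_eq ?_)
  rw [eLpNorm_indicator_const measurableSet_Ioc (by norm_num) (by norm_num), Real.volume_Ioc,
    sub_zero, ENNReal.ofReal_mul hC0, Real.enorm_eq_ofReal hC0]
  congr 1
  rw [Real.sqrt_eq_rpow, ENNReal.ofReal_rpow_of_pos hδ]
  norm_num

theorem inner_kerL2_transl (δ : ℝ) {k : ℝ → ℝ} (hk : Continuous k) (f : L2) (x : ℝ) :
    inner ℂ (kerL2 δ k) (transl (-x) f) = ∫ y, indicator (Ioc 0 δ) k y • f (x + y) := by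
  rw [inner_kerL2 δ hk]
  refine integral_congr_ae ?_
  filter_upwards [transl_ae (-x) f] with y hy
  rw [hy, sub_neg_eq_add, add_comm]

theorem locallyIntegrable_L2 (f : L2) : LocallyIntegrable f volume :=
  (Lp.memLp f).locallyIntegrable (by norm_num)

/-- Exchange of a pairing with a test function and an average over translations. -/
theorem integral_smul_inner_kerL2 (δ : ℝ) {k θ : ℝ → ℝ} (hk : Continuous k) (hθ : Continuous θ)
    (hc : HasCompactSupport θ) (f : L2) :
    ∫ x, θ x • inner ℂ (kerL2 δ k) (transl (-x) f) =
      ∫ y, indicator (Ioc 0 δ) k y • ∫ x, θ x • f (x + y) := by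
  obtain ⟨C, hC⟩ := hθ.bounded_above_of_compact_support hc
  let K : Set ℝ := (fun p : ℝ × ℝ => p.1 + p.2) '' (tsupport θ ×ˢ Icc 0 δ)
  have hK : IsCompact K := (hc.isCompact.prod isCompact_Icc).image (by fun_prop)
  have hf : Integrable (indicator K f) volume :=
    ((locallyIntegrable_L2 f).integrableOn_isCompact hK).integrable_indicator hK.measurableSet
  have hκ : Integrable (indicator (Ioc 0 δ) k) volume :=
    ((hk.integrableOn_Icc (a := 0) (b := δ)).mono_set Ioc_subset_Icc_self).integrable_indicator
      measurableSet_Ioc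
  have hprod : Integrable (fun z : ℝ × ℝ => indicator (Ioc 0 δ) k z.1 • indicator K f z.2)
      (volume.prod volume) := hκ.smul_prod hf
  have hprod2 : Integrable (fun z : ℝ × ℝ => indicator (Ioc 0 δ) k z.1 •
      indicator K f (z.1 + z.2)) (volume.prod volume) :=
    ((measurePreserving_prod_add volume volume).integrable_comp hprod.aestronglyMeasurable).2 hprod
  have hint : Integrable (Function.uncurry fun x y : ℝ =>
      θ x • indicator (Ioc 0 δ) k y • f (x + y)) (volume.prod volume) := by
    have h1 : Integrable (fun z : ℝ × ℝ => θ z.1 • (indicator (Ioc 0 δ) k z.2 •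
        indicator K f (z.2 + z.1))) (volume.prod volume) := by
      refine (hprod2.swap).bdd_smul C (hθ.comp continuous_fst).aestronglyMeasurable
        (Eventually.of_forall fun z => hC z.1)
    refine h1.congr (Eventually.of_forall fun z => ?_)
    simp only [Function.uncurry]
    by_cases h1 : z.2 ∈ Ioc 0 δ
    · by_cases h2 : z.1 ∈ tsupport θ
      · rw [indicator_of_mem (s := K), add_comm]
        exact ⟨(z.1, z.2), ⟨h2, h1.1.le, h1.2⟩, add_comm _ _⟩
      · rw [image_eq_zero_of_notMem_tsupport h2, zero_smul, zero_smul]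
    · rw [indicator_of_notMem h1, zero_smul, zero_smul]
  calc ∫ x, θ x • inner ℂ (kerL2 δ k) (transl (-x) f)
      = ∫ x, ∫ y, θ x • indicator (Ioc 0 δ) k y • f (x + y) := by
        simp_rw [inner_kerL2_transl δ hk, integral_smul]
    _ = ∫ y, ∫ x, θ x • indicator (Ioc 0 δ) k y • f (x + y) := integral_integral_swap hint
    _ = _ := by
        refine integral_congr_ae (Eventually.of_forall fun y => ?_)
        simp only
        rw [← integral_smul]
        refine integral_congr_ae (Eventually.of_forall fun x => ?_)
        simp only
        rw [smul_comm]

theorem continuous_integral_smul_add {θ : ℝ → ℝ} (hθ : Continuous θ) (hc : HasCompactSupport θ)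
    (f : L2) : Continuous fun y => ∫ x, θ x • f (x + y) := by
  have h : (fun y => ∫ x, θ x • f (x + y)) = fun y => inner ℂ (testL2 θ hθ hc) (transl (-y) f) := by
    funext y
    rw [inner_testL2]
    refine integral_congr_ae ?_
    filter_upwards [transl_ae (-y) f] with x hx
    rw [hx, sub_neg_eq_add]
  rw [h]
  exact continuous_const.inner ((continuous_transl f).comp continuous_neg)

theorem hasDerivAt_integral_smul_add {θ : ℝ → ℝ} (hθ : ContDiff ℝ ∞ θ) (hc : HasCompactSupport θ)
    (v : H1) (y : ℝ) :
    HasDerivAt (fun y => ∫ x, θ x • toL2 v (x + y)) (∫ x, θ x • derivL v (x + y)) y := by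
  let θ' : ℝ → ℝ := fun x => θ (-x)
  have hθ' : ContDiff ℝ 1 θ' := (hθ.of_le (by simp)).comp contDiff_neg
  have hc' : HasCompactSupport θ' := hc.comp_homeomorph (Homeomorph.neg ℝ)
  have h := hc'.hasDerivAt_convolution_left (ContinuousLinearMap.lsmul ℝ ℝ) hθ'
    (locallyIntegrable_L2 (toL2 v)) y (μ := volume)
  have h1 : (convolution θ' (toL2 v) (ContinuousLinearMap.lsmul ℝ ℝ) volume) =
      fun y => ∫ x, θ x • toL2 v (x + y) := by
    funext y
    rw [convolution, ← integral_neg_eq_self]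
    refine integral_congr_ae (Eventually.of_forall fun x => ?_)
    simp [θ', add_comm]
  rw [h1] at h
  refine h.congr_deriv ?_
  rw [convolution, ← integral_neg_eq_self]
  have hd : ∀ x, deriv θ' (-x) = - deriv θ x := by
    intro x
    have := deriv_comp_neg θ (-x)
    rwa [neg_neg] at this
  have hw := isWeakDeriv v (fun x => θ (x - y)) (hθ.comp (contDiff_id.sub contDiff_const))
    (hc.comp_homeomorph (Homeomorph.subRight y))
  have hd2 : deriv (fun x => θ (x - y)) = fun x => deriv θ (x - y) := by
    funext x; exact deriv_comp_sub_const θ y x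
  rw [hd2] at hw
  have e1 : ∫ x, θ x • derivL v (x + y) = ∫ x, θ (x - y) • derivL v x := by
    rw [← integral_sub_right_eq_self (fun x => θ x • derivL v (x + y)) y]
    simp
  have e2 : ∫ x, deriv θ x • toL2 v (x + y) = ∫ x, deriv θ (x - y) • toL2 v x := by
    rw [← integral_sub_right_eq_self (fun x => deriv θ x • toL2 v (x + y)) y]
    simp
  rw [e1, ← neg_neg (∫ x, θ (x - y) • derivL v x), ← hw, ← e2, ← integral_neg]
  refine integral_congr_ae (Eventually.of_forall fun x => ?_)
  simp [hd, add_comm]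

/-- A bounded functional on `H¹` which is evaluation at `0`, computed on the interval `(0, δ]`. -/
def evL (δ : ℝ) : H1 →L[ℂ] ℂ :=
  (innerSL ℂ (kerL2 δ fun _ => δ⁻¹)).comp toL2L +
    (innerSL ℂ (kerL2 δ fun y => -(1 - y / δ))).comp derivL

theorem evL_apply (δ : ℝ) (v : H1) : evL δ v = inner ℂ (kerL2 δ fun _ => δ⁻¹) (toL2 v) +
    inner ℂ (kerL2 δ fun y => -(1 - y / δ)) (derivL v) := rfl

/-- The two kernels have L² norms at most `δ^{-1/2}` and `δ^{1/2}`. The free width `δ` is what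
permits interpolation between L² and H¹ later. -/
theorem norm_evL_le {δ : ℝ} (hδ : 0 < δ) (v : H1) :
    ‖evL δ v‖ ≤ (√δ)⁻¹ * ‖toL2 v‖ + √δ * ‖v‖ := by
  rw [evL_apply]
  refine (norm_add_le _ _).trans (add_le_add ?_ ?_)
  · refine (norm_inner_le_norm _ _).trans (mul_le_mul_of_nonneg_right ?_ (norm_nonneg _))
    refine (norm_kerL2_le hδ (by fun_prop) (C := δ⁻¹) fun x _ => ?_).trans (le_of_eq ?_)
    · rw [abs_of_pos (inv_pos.2 hδ)]
    · have := Real.sq_sqrt hδ.le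
      have h2 : √δ ≠ 0 := (Real.sqrt_pos.2 hδ).ne'
      field_simp
      exact this
  · refine (norm_inner_le_norm _ _).trans (mul_le_mul ?_ (norm_derivL_le v) (norm_nonneg _)
      (Real.sqrt_nonneg _))
    refine (norm_kerL2_le hδ (by fun_prop) (C := 1) fun x hx => ?_).trans (le_of_eq (one_mul _))
    have h1 : x / δ ≤ 1 := (div_le_one hδ).2 hx.2
    have h2 : 0 ≤ x / δ := div_nonneg hx.1.le hδ.le
    rw [abs_neg, abs_le]; constructor <;> linarith

/-- Integrate the derivative of `-(1 - y/δ) v(x + y)` over `0 ≤ y ≤ δ`: only the value at `y = 0`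
survives. Since `v` is an L² class, the computation is done after pairing with a test function,
which makes the dependence on `y` differentiable. -/
theorem eval_ae {δ : ℝ} (hδ : 0 < δ) (v : H1) :
    ∀ᵐ x : ℝ, toL2 v x = evL δ (translH1 (-x) v) := by
  have hcont : Continuous fun x => evL δ (translH1 (-x) v) := by
    simp only [evL_apply, toL2_translH1, derivL_translH1]
    exact (continuous_const.inner ((continuous_transl _).comp continuous_neg)).add
      (continuous_const.inner ((continuous_transl _).comp continuous_neg))
  have h0 : ∀ᵐ x : ℝ, evL δ (translH1 (-x) v) - toL2 v x = 0 := by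
    refine ae_eq_zero_of_integral_contDiff_smul_eq_zero
      (hcont.locallyIntegrable.sub (locallyIntegrable_L2 _)) fun θ hθ hc => ?_
    have hθc := hθ.continuous
    have i1 : Integrable (fun x => θ x • evL δ (translH1 (-x) v)) volume :=
      hcont.locallyIntegrable.integrable_smul_left_of_hasCompactSupport hθc hc
    simp_rw [smul_sub]
    rw [integral_sub i1 (integrable_test hθc hc _), sub_eq_zero]
    have c1 : Continuous fun x => inner ℂ (kerL2 δ fun _ => δ⁻¹) (transl (-x) (toL2 v)) :=
      continuous_const.inner ((continuous_transl _).comp continuous_neg)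
    have c2 : Continuous fun x =>
        inner ℂ (kerL2 δ fun y => -(1 - y / δ)) (transl (-x) (derivL v)) :=
      continuous_const.inner ((continuous_transl _).comp continuous_neg)
    simp only [evL_apply, toL2_translH1, derivL_translH1, smul_add]
    rw [integral_add (c1.locallyIntegrable.integrable_smul_left_of_hasCompactSupport hθc hc)
      (c2.locallyIntegrable.integrable_smul_left_of_hasCompactSupport hθc hc),
      integral_smul_inner_kerL2 δ (by fun_prop) hθc hc,
      integral_smul_inner_kerL2 δ (by fun_prop) hθc hc]
    set H : ℝ → ℂ := fun y => ∫ x, θ x • toL2 v (x + y) with hH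
    set H' : ℝ → ℂ := fun y => ∫ x, θ x • derivL v (x + y) with hH'
    have cH : Continuous H := continuous_integral_smul_add hθc hc _
    have cH' : Continuous H' := continuous_integral_smul_add hθc hc _
    have hsmul : ∀ (k : ℝ → ℝ) (G : ℝ → ℂ), ∫ y, indicator (Ioc 0 δ) k y • G y =
        ∫ y in (0 : ℝ)..δ, k y • G y := by
      intro k G
      rw [intervalIntegral.integral_of_le hδ.le, ← integral_indicator measurableSet_Ioc]
      refine integral_congr_ae (Eventually.of_forall fun y => ?_)
      by_cases hy : y ∈ Ioc 0 δ
      · simp only [indicator_of_mem hy]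
      · simp only [indicator_of_notMem hy, zero_smul]
    rw [hsmul, hsmul, ← intervalIntegral.integral_add]
    · have hd : ∀ y ∈ uIcc 0 δ, HasDerivAt (fun y => (-(1 - y / δ)) • H y)
          (δ⁻¹ • H y + (-(1 - y / δ)) • H' y) y := by
        intro y _
        have e1 : HasDerivAt (fun y : ℝ => -(1 - y / δ)) δ⁻¹ y := by
          exact (((hasDerivAt_id y).div_const δ).const_sub 1).fun_neg.congr_deriv (by simp)
        have e2 := e1.smul (hasDerivAt_integral_smul_add hθ hc v y)
        rw [add_comm]
        exact e2
      rw [intervalIntegral.integral_eq_sub_of_hasDerivAt hd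
        (Continuous.intervalIntegrable (by fun_prop) _ _)]
      simp [hδ.ne', H]
    · exact (show Continuous fun y => δ⁻¹ • H y by fun_prop).intervalIntegrable _ _
    · exact (show Continuous fun y => -(1 - y / δ) • H' y by fun_prop).intervalIntegrable _ _
  filter_upwards [h0] with x hx
  exact (sub_eq_zero.1 hx).symm

theorem norm_ae_le (v : H1) : ∀ᵐ x : ℝ, ‖toL2 v x‖ ≤ 2 * ‖v‖ := by
  filter_upwards [eval_ae one_pos v] with x hx
  rw [hx]
  refine (norm_evL_le one_pos _).trans ?_
  have := norm_toL2_le (translH1 (-x) v)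
  rw [LinearIsometry.norm_map] at this ⊢
  simp only [Real.sqrt_one, inv_one, one_mul]
  linarith

theorem eLpNorm_top_le (v : H1) : eLpNorm (toL2 v) ⊤ volume ≤ ENNReal.ofReal (2 * ‖v‖) :=
  by
  rw [eLpNorm_exponent_top]
  exact eLpNormEssSup_le_of_ae_bound (norm_ae_le v)

/-! ### Compactness along ultrafilters -/

section Compactness

/-- If the range were not totally bounded, it would contain an infinite ε-separated sequence, none
of whose subsequences is precompact. This turns assumptions on sequences into one compact set
uniform in all parameters. -/
theorem isCompact_closure_range_of_subseq {X ι : Type*} [PseudoMetricSpace X] [CompleteSpace X]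
    (S : ι → X)
    (h : ∀ i : ℕ → ι, ∃ κ : ℕ → ℕ, StrictMono κ ∧ Precompact fun k => S (i (κ k))) :
    IsCompact (closure (range S)) := by
  have htb : TotallyBounded (range S) := by
    rw [Metric.totallyBounded_iff]
    by_contra! hcon
    obtain ⟨ε, hε, hcov⟩ := hcon
    have hex : ∀ s : Finset ι, ∃ j, ∀ i ∈ s, ε ≤ dist (S j) (S i) := by
      intro s
      have h1 := hcov (S '' s) (s.finite_toSet.image S)
      rw [not_subset] at h1
      obtain ⟨_, ⟨j, rfl⟩, hj⟩ := h1
      refine ⟨j, fun i hi => ?_⟩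
      by_contra! hlt
      exact hj (mem_biUnion (mem_image_of_mem S hi) hlt)
    obtain ⟨i, -, hi⟩ := exists_seq_of_forall_finset_exists (fun _ => True)
      (fun i j => ε ≤ dist (S j) (S i)) (fun s _ => (hex s).imp fun j hj => ⟨trivial, hj⟩)
    obtain ⟨κ, hκ, hpre⟩ := h i
    obtain ⟨a, -, φ, hφ, hlim⟩ := hpre.tendsto_subseq fun k =>
      subset_closure (mem_range_self k)
    have hc := hlim.cauchySeq
    rw [Metric.cauchySeq_iff] at hc
    obtain ⟨N, hN⟩ := hc ε hε
    have h1 := hN (N + 1) (by omega) N le_rfl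
    have h2 := hi (κ (φ N)) (κ (φ (N + 1))) (hκ (hφ (by omega)))
    exact absurd h1 (not_lt.2 h2)
  exact isCompact_iff_totallyBounded_isComplete.2 ⟨htb.closure, isClosed_closure.isComplete⟩

theorem _root_.IsCompact.exists_tendsto_ultrafilter {X ι : Type*} [TopologicalSpace X] {K : Set X}
    (hK : IsCompact K) (U : Ultrafilter ι) {f : ι → X} (hf : ∀ᶠ i in U, f i ∈ K) :
    ∃ a, Tendsto f U (𝓝 a) := by
  obtain ⟨a, -, ha⟩ := hK.ultrafilter_le_nhds (U.map f) (le_principal_iff.2 hf)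
  exact ⟨a, ha⟩

theorem _root_.Ultrafilter.bounded_or_tendsto_atTop {ι : Type*} (U : Ultrafilter ι) (f : ι → ℝ) :
    (∃ N, ∀ᶠ i in U, f i ≤ N) ∨ Tendsto f U atTop := by
  by_cases h : ∃ N, ∀ᶠ i in U, f i ≤ N
  · exact Or.inl h
  · right
    push Not at h
    rw [tendsto_atTop]
    intro b
    exact (h b).mono fun i hi => hi.le

theorem _root_.Ultrafilter.exists_tendsto_of_abs_le {ι : Type*} (U : Ultrafilter ι) {f : ι → ℝ}
    {N : ℝ} (h : ∀ᶠ i in U, |f i| ≤ N) : ∃ a, Tendsto f U (𝓝 a) :=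
  (isCompact_Icc (a := -N) (b := N)).exists_tendsto_ultrafilter U
    (h.mono fun _ hi => abs_le.1 hi)

end Compactness

/-! ### Approximate orthogonality of profiles -/

/-- Bounded functions with bounded support. -/
def HasBoundedSupport (φ : L2) : Prop :=
  ∃ N C : ℝ, ∀ᵐ x : ℝ, ‖φ x‖ ≤ C ∧ (N < |x| → φ x = 0)

theorem exists_hasBoundedSupport (φ : L2) {ε : ℝ} (hε : 0 < ε) :
    ∃ φ₀ : L2, HasBoundedSupport φ₀ ∧ ‖φ - φ₀‖ ≤ ε := by
  obtain ⟨g, hgc, hg, hcont, hmem⟩ := (Lp.memLp φ).exists_hasCompactSupport_eLpNorm_sub_le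
    (by norm_num) (ε := ENNReal.ofReal ε) (by simpa using hε)
  obtain ⟨C, hC⟩ := hcont.bounded_above_of_compact_support hgc
  obtain ⟨N, hN⟩ := hgc.isCompact.isBounded.exists_norm_le
  refine ⟨hmem.toLp g, ⟨N, C, ?_⟩, ?_⟩
  · filter_upwards [hmem.coeFn_toLp] with x hx
    rw [hx]
    refine ⟨hC x, fun hlt => image_eq_zero_of_notMem_tsupport fun hmem => ?_⟩
    exact absurd (hN x hmem) (not_le.2 hlt)
  · rw [Lp.norm_def]
    refine ENNReal.toReal_le_of_le_ofReal hε.le (le_trans (le_of_eq ?_) hg)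
    refine eLpNorm_congr_ae ?_
    filter_upwards [hmem.coeFn_toLp, Lp.coeFn_sub φ (hmem.toLp g)] with x hx hx'
    rw [hx', Pi.sub_apply, Pi.sub_apply, hx]

theorem tendsto_inner_transl_of_hasBoundedSupport {ι : Type*} {l : Filter ι} {y : ι → ℝ}
    {w : ι → L2} {C : ℝ} (hw : ∀ i, ‖w i‖ ≤ C)
    (h : ∀ φ, HasBoundedSupport φ → Tendsto (fun i => inner ℂ (transl (y i) φ) (w i)) l (𝓝 0))
    (φ : L2) : Tendsto (fun i => inner ℂ (transl (y i) φ) (w i)) l (𝓝 0) := by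
  rw [Metric.tendsto_nhds]
  intro ε hε
  obtain ⟨φ₀, hφ₀, hd⟩ := exists_hasBoundedSupport φ (ε := ε / (2 * (|C| + 1))) (by positivity)
  have h1 := (Metric.tendsto_nhds.1 (h φ₀ hφ₀)) (ε / 2) (half_pos hε)
  filter_upwards [h1] with i hi
  rw [dist_zero_right] at hi ⊢
  have h2 : inner ℂ (transl (y i) φ) (w i) =
      inner ℂ (transl (y i) φ₀) (w i) + inner ℂ (transl (y i) (φ - φ₀)) (w i) := by
    rw [← inner_add_left, ← map_add, add_sub_cancel]
  have h3 : ‖inner ℂ (transl (y i) (φ - φ₀)) (w i)‖ ≤ ε / 2 := by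
    refine (norm_inner_le_norm _ _).trans ?_
    rw [LinearIsometry.norm_map]
    calc ‖φ - φ₀‖ * ‖w i‖ ≤ (ε / (2 * (|C| + 1))) * (|C| + 1) :=
          mul_le_mul hd ((hw i).trans ((le_abs_self C).trans (by linarith))) (norm_nonneg _)
            (by positivity)
      _ = ε / 2 := by field_simp
  rw [h2]
  exact (norm_add_le _ _).trans_lt (by linarith)

/-- After both functions are approximated by ones of bounded support, the supports are eventually
disjoint. -/
theorem tendsto_inner_transl {ι : Type*} {l : Filter ι} {y : ι → ℝ}
    (hy : Tendsto (fun i => |y i|) l atTop) (φ g : L2) :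
    Tendsto (fun i => inner ℂ (transl (y i) φ) g) l (𝓝 0) := by
  refine tendsto_inner_transl_of_hasBoundedSupport (C := ‖g‖) (fun _ => le_rfl) ?_ φ
  rintro φ ⟨N, C, hφ⟩
  have key : Tendsto (fun i => inner ℂ (transl (-y i) g) φ) l (𝓝 0) := by
    refine tendsto_inner_transl_of_hasBoundedSupport (y := fun i => -y i) (w := fun _ => φ)
      (C := ‖φ‖) (fun _ => le_rfl) ?_ g
    rintro g ⟨N', C', hg⟩
    refine tendsto_const_nhds.congr' ?_
    filter_upwards [hy.eventually_gt_atTop (N + N')] with i hi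
    symm
    rw [L2.inner_def]
    refine integral_eq_zero_of_ae ?_
    have hq := (measurePreserving_sub_right volume (-y i)).quasiMeasurePreserving.ae hg
    filter_upwards [hφ, hq, transl_ae (-y i) g] with x h1 h2 h3
    rw [h3]
    by_cases hx : N < |x|
    · rw [h1.2 hx]; simp
    · have : N' < |x - -y i| := by
        have := abs_sub_abs_le_abs_sub (y i) (-x)
        rw [abs_neg] at this
        have e : |x - -y i| = |y i - -x| := by congr 1; ring
        rw [e]; linarith
      rw [h2.2 this]; simp
  have := (Complex.continuous_conj.tendsto _).comp key
  rw [map_zero] at this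
  refine this.congr fun i => ?_
  simp only [Function.comp, inner_conj_symm]
  rw [inner_transl_left]

/-- A function with bounded values and support lies in the dual exponent space, with norm unchanged
by translations, so Hölder applies; the L² bound on `w` covers general `φ`. -/
theorem tendsto_inner_transl_of_eLpNorm {ι : Type*} {l : Filter ι} (r : ℝ≥0∞) [Fact (1 ≤ r)]
    {y : ι → ℝ} {w : ι → L2} {C : ℝ} (hw : ∀ i, ‖w i‖ ≤ C)
    (h : Tendsto (fun i => eLpNorm (w i) r volume) l (𝓝 0)) (φ : L2) :
    Tendsto (fun i => inner ℂ (transl (y i) φ) (w i)) l (𝓝 0) := by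
  refine tendsto_inner_transl_of_hasBoundedSupport hw ?_ φ
  rintro φ ⟨N, C, hφ⟩
  have hr1 : (1 : ℝ≥0∞) ≤ r := Fact.out
  let q := r.conjExponent
  have hq : ENNReal.HolderConjugate q r := (ENNReal.HolderConjugate.conjExponent hr1).symm
  have hφq : eLpNorm φ q volume < ⊤ := by
    have hm : MemLp (indicator (Icc (-N) N) fun _ : ℝ => C) q volume :=
      memLp_indicator_const q measurableSet_Icc C (Or.inr measure_Icc_lt_top.ne)
    refine (eLpNorm_mono_ae ?_).trans_lt hm.2
    filter_upwards [hφ] with x hx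
    by_cases h1 : x ∈ Icc (-N) N
    · rw [indicator_of_mem h1]
      exact hx.1.trans (le_abs_self C)
    · rw [hx.2 (by by_contra! hcon; exact h1 (abs_le.1 hcon))]; simp
  rw [tendsto_zero_iff_norm_tendsto_zero]
  have hb : ∀ i, ‖inner ℂ (transl (y i) φ) (w i)‖ₑ ≤ eLpNorm φ q volume * eLpNorm (w i) r volume := by
    intro i
    rw [L2.inner_def]
    refine (enorm_integral_le_lintegral_enorm _).trans ?_
    rw [← eLpNorm_one_eq_lintegral_enorm, ← eLpNorm_transl q (y i) φ]
    have := eLpNorm_smul_le_mul_eLpNorm (p := q) (q := r) (r := 1) (μ := volume)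
      (Lp.aestronglyMeasurable (w i))
      (Complex.continuous_conj.comp_aestronglyMeasurable (Lp.aestronglyMeasurable (transl (y i) φ)))
    refine (le_of_eq ?_).trans (this.trans (le_of_eq ?_))
    · refine eLpNorm_congr_ae (Eventually.of_forall fun x => ?_)
      simp [mul_comm]
    · congr 1
      refine eLpNorm_congr_norm_ae (Eventually.of_forall fun x => ?_)
      simp
  have h2 : Tendsto (fun i => eLpNorm φ q volume * eLpNorm (w i) r volume) l (𝓝 0) := by
    simpa using ENNReal.Tendsto.const_mul h (Or.inr hφq.ne)
  have h3 := tendsto_of_tendsto_of_tendsto_of_le_of_le tendsto_const_nhds h2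
    (fun _ => zero_le) hb
  have h4 := (ENNReal.tendsto_toReal ENNReal.zero_ne_top).comp h3
  exact h4.congr fun i => toReal_enorm _

/-! ### Translated flows -/

/-- The flow of the translated operator, `τ_{-x} e^{isA} τ_x`, on `H¹`. -/
def conjFlow (A : L2 →ₗ.[ℂ] L2) (x s : ℝ) : H1 →L[ℂ] H1 := (translL (-x)).comp (push A s x)

namespace Setup

variable {A : L2 →ₗ.[ℂ] L2} {B : H1 →L[ℂ] Hneg1} {ι : Type*}

theorem toL2_conjFlow (h : Setup A B) (x s : ℝ) (v : H1) :
    toL2 (conjFlow A x s v) = transl (-x) (expI A s (transl x (toL2 v))) := by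
  change transl (-x) (toL2 (push A s x v)) = _
  rw [h.toL2_push']

theorem toL2_conjFlow_eq_expI (h : Setup A B) (x s : ℝ) (v : H1) :
    toL2 (conjFlow A x s v) = expI (translOp A x) s (toL2 v) := by
  rw [h.toL2_conjFlow, expI_translOp h.a1.selfAdjoint h.group]

theorem norm_toL2_conjFlow (h : Setup A B) (x s : ℝ) (v : H1) :
    ‖toL2 (conjFlow A x s v)‖ = ‖toL2 v‖ := by
  rw [h.toL2_conjFlow, LinearIsometry.norm_map, h.group.norm_map, LinearIsometry.norm_map]

theorem isCompact_conjFlow (h : Setup A B) (ψ : H1) (N : ℝ) :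
    ∃ K : Set H1, IsCompact K ∧ ∀ x s, |s| ≤ N → conjFlow A x s ψ ∈ K := by
  let S : ℝ × Icc (-N) N → H1 := fun p => conjFlow A p.1 p.2 ψ
  refine ⟨closure (range S), isCompact_closure_range_of_subseq S fun i => ?_, fun x s hs =>
    subset_closure ⟨(x, ⟨s, abs_le.1 hs⟩), rfl⟩⟩
  obtain ⟨s', -, κ, hκ, hs'⟩ := isCompact_Icc.tendsto_subseq (x := fun k => ((i k).2 : ℝ))
    fun k => (i k).2.2
  obtain ⟨w, hw, hpre⟩ := h.a4 ψ (fun k => (i (κ k)).1) (fun k => -((i (κ k)).2 : ℝ)) (-s') hs'.neg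
  refine ⟨κ, hκ, ?_⟩
  have hwS : w = fun k => S (i (κ k)) := funext fun k =>
    toL2_injective (by rw [hw k, neg_neg, h.toL2_conjFlow_eq_expI])
  rw [hwS] at hpre
  exact hpre

theorem isCompact_translExt (h : Setup A B) (ψ : H1) :
    ∃ K : Set Hneg1, IsCompact K ∧ ∀ x, translExt B x ψ ∈ K := by
  have hK := isCompact_closure_range_of_subseq (fun x => translExt B x ψ) fun i =>
    ⟨id, strictMono_id, h.a3 ψ i⟩
  exact ⟨closure (range fun x => translExt B x ψ), hK, fun x => subset_closure ⟨x, rfl⟩⟩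

/-- Dispersion: the translated flows tend to `0` in `L^r`, uniformly in the translation. -/
theorem eLpNorm_conjFlow_le (h : Setup A B) {r : ℝ≥0∞} [Fact (1 ≤ r)] (h5 : A5 A r) (ψ : H1)
    {ε : ℝ≥0∞} (hε : 0 < ε) :
    ∃ T : ℝ, ∀ x s, T ≤ |s| → eLpNorm (toL2 (conjFlow A x s ψ)) r volume ≤ ε := by
  by_contra! hcon
  choose x s hs hlt using fun k : ℕ => hcon k
  obtain ⟨w, hw, κ, hκ, hnull⟩ := h.a6 ψ x s (tendsto_atTop_mono hs tendsto_natCast_atTop_atTop)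
  obtain ⟨w', hw', hpre⟩ := h5 ψ (x ∘ κ) (fun k => -s (κ k))
  have hww' : ∀ k, (w' k : ℝ → ℂ) =ᵐ[volume] toL2 (w (κ k)) := by
    intro k
    rw [hw]
    simpa using hw' k
  obtain ⟨g, -, κ₂, hκ₂, hlim⟩ := hpre.tendsto_subseq fun k => subset_closure (mem_range_self k)
  have hmeas := tendstoInMeasure_of_tendsto_Lp hlim
  obtain ⟨κ₃, hκ₃, hae⟩ := hmeas.exists_seq_tendsto_ae
  have hev : ∀ᵐ y : ℝ, ∀ k, toL2 (w (κ k)) y = evL 1 (translL (-y) (w (κ k))) :=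
    ae_all_iff.2 fun k => eval_ae one_pos _
  -- Point evaluation is a bounded functional on H¹, so weak nullity gives pointwise convergence to
  -- 0, which identifies the `L^r` limit.
  have hg : ∀ᵐ y : ℝ, g y = 0 := by
    filter_upwards [hae, hev, ae_all_iff.2 hww'] with y h1 h2 h3
    have h4 := hnull ((evL 1).comp (translL (-y)))
    have h5 := h4.comp ((hκ₂.comp hκ₃).tendsto_atTop)
    refine tendsto_nhds_unique h1 (h5.congr fun k => ?_)
    simp only [Function.comp, ContinuousLinearMap.comp_apply]
    rw [h3, h2]
  have hg0 : g = 0 := by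
    apply Lp.ext
    filter_upwards [hg, Lp.coeFn_zero ℂ r (volume : Measure ℝ)] with y h1 h2
    rw [h1, h2]; rfl
  rw [hg0] at hlim
  have hn : Tendsto (fun k => ENNReal.ofReal ‖w' (κ₂ k)‖) atTop (𝓝 0) := by
    have := ENNReal.tendsto_ofReal hlim.norm
    simpa using this
  obtain ⟨k, hk⟩ := ((tendsto_order.1 hn).2 ε hε).exists
  rw [Lp.norm_def, ENNReal.ofReal_toReal (Lp.eLpNorm_ne_top _), eLpNorm_congr_ae (hww' _)] at hk
  have h2 := hlt (κ (κ₂ k))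
  have h3 : conjFlow A (x (κ (κ₂ k))) (s (κ (κ₂ k))) ψ = w (κ (κ₂ k)) :=
    toL2_injective (by rw [hw, h.toL2_conjFlow_eq_expI])
  rw [h3] at h2
  exact absurd hk (not_lt.2 h2.le)

theorem tendsto_eLpNorm_conjFlow (h : Setup A B) {r : ℝ≥0∞} [Fact (1 ≤ r)] (h5 : A5 A r) (ψ : H1)
    {l : Filter ι} {x s : ι → ℝ} (hs : Tendsto (fun i => |s i|) l atTop) :
    Tendsto (fun i => eLpNorm (toL2 (conjFlow A (x i) (s i) ψ)) r volume) l (𝓝 0) := by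
  rw [ENNReal.tendsto_nhds_zero]
  intro ε hε
  obtain ⟨T, hT⟩ := h.eLpNorm_conjFlow_le h5 ψ hε
  filter_upwards [hs.eventually_ge_atTop T] with i hi
  exact hT _ _ hi

theorem inner_pull_push (h : Setup A B) (t x t' x' : ℝ) (φ ψ : H1) :
    inner ℂ (toL2 φ) (toL2 (pull A t x (push A t' x' ψ))) =
      inner ℂ (transl (x - x') (toL2 φ)) (toL2 (conjFlow A x' (t' - t) ψ)) := by
  rw [h.toL2_pull, h.toL2_push', h.toL2_conjFlow, ← h.group.apply_add, inner_transl_right,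
    inner_transl_right, transl_transl, neg_neg, neg_neg]
  congr 3 <;> ring_nf

theorem pull_push_eq (h : Setup A B) (t x t' x' : ℝ) (ψ : H1) :
    pull A t x (push A t' x' ψ) = translH1 (x' - x) (conjFlow A x' (t' - t) ψ) := by
  apply toL2_injective
  rw [h.toL2_pull, h.toL2_push', toL2_translH1, h.toL2_conjFlow, ← h.group.apply_add,
    transl_transl]
  ring_nf

/-- Profiles with diverging parameters are asymptotically orthogonal. -/
theorem weakTendsto_pull_push (h : Setup A B) {r : ℝ≥0∞} [Fact (1 ≤ r)] (h5 : A5 A r) (ψ : H1)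
    {l : Filter ι} {t x t' x' : ι → ℝ}
    (hd : Tendsto (fun i => |t' i - t i| + |x' i - x i|) l atTop) :
    WeakTendsto l (fun i => pull A (t i) (x i) (push A (t' i) (x' i) ψ)) 0 := by
  obtain ⟨M, hM1, hM⟩ := h.exists_push_pull_bound
  refine weakTendsto_of_toL2 (C := M * (M * ‖ψ‖)) (Eventually.of_forall fun i => ?_) fun φ => ?_
  · exact ((hM _ _ _).2).trans (mul_le_mul_of_nonneg_left (hM _ _ _).1 (by linarith))
  rw [map_zero, inner_zero_right]
  simp_rw [h.inner_pull_push]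
  rw [tendsto_iff_ultrafilter]
  intro U hU
  have hd' := hd.mono_left hU
  -- With bounded time differences the flows of `ψ` converge strongly and the positions must
  -- separate, so the translates of `φ` are weakly null. With unbounded ones, the decay in `L^r`
  -- applies whatever the positions do.
  rcases U.bounded_or_tendsto_atTop fun i => |t' i - t i| with ⟨N, hN⟩ | hs
  · obtain ⟨K, hK, hmem⟩ := h.isCompact_conjFlow ψ N
    obtain ⟨a, ha⟩ := hK.exists_tendsto_ultrafilter U (f := fun i =>
      conjFlow A (x' i) (t' i - t i) ψ) (hN.mono fun i hi => hmem _ _ hi)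
    have hy : Tendsto (fun i => |x i - x' i|) U atTop := by
      have h1 := tendsto_atTop_add_const_right (U : Filter ι) (-N) hd'
      refine tendsto_atTop_mono' (U : Filter ι) ?_ h1
      filter_upwards [hN] with i hi
      rw [abs_sub_comm (x i)]; linarith
    have hw : WeakTendsto (U : Filter ι) (fun i => transl (x i - x' i) (toL2 φ)) 0 := by
      intro g
      rw [inner_zero_right]
      have := (Complex.continuous_conj.tendsto _).comp (tendsto_inner_transl hy (toL2 φ) g)
      rw [map_zero] at this
      exact this.congr fun i => by simp only [Function.comp, inner_conj_symm]
    have h2 := hw.inner_strong ((continuous_toL2.tendsto a).comp ha) (C := ‖toL2 φ‖)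
      (Eventually.of_forall fun i => (LinearIsometry.norm_map _ _).le)
    rw [inner_zero_right] at h2
    have := (Complex.continuous_conj.tendsto _).comp h2
    rw [map_zero] at this
    exact this.congr fun i => by simp only [Function.comp, inner_conj_symm]
  · exact tendsto_inner_transl_of_eLpNorm r (C := ‖toL2 ψ‖)
      (fun i => (h.norm_toL2_conjFlow _ _ _).le) (h.tendsto_eLpNorm_conjFlow h5 ψ hs) _

theorem weakTendsto_push (h : Setup A B) {r : ℝ≥0∞} [Fact (1 ≤ r)] (h5 : A5 A r) (ψ : H1)
    {l : Filter ι} {t x : ι → ℝ} (hd : Tendsto (fun i => |t i| + |x i|) l atTop) :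
    WeakTendsto l (fun i => push A (t i) (x i) ψ) 0 := by
  have h1 := h.weakTendsto_pull_push h5 ψ (l := l) (t := fun _ => 0) (x := fun _ => 0)
    (t' := t) (x' := x) (by simpa using hd)
  have h2 : ∀ v, pull A 0 0 v = v := by
    intro v
    apply toL2_injective
    rw [h.toL2_pull, neg_zero, h.group.apply_zero, transl_zero]
  simpa only [h2] using h1

/-- The change of frame between two frames at bounded distance is a bounded translation after a
bounded-time flow; both have limits along the ultrafilter. -/
theorem exists_tendsto_pull_push (h : Setup A B) (U : Ultrafilter ι) {t x t' x' : ι → ℝ} {N : ℝ}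
    (hN : ∀ᶠ i in U, |t' i - t i| + |x' i - x i| ≤ N) (φ : H1) :
    ∃ γ : H1, Tendsto (fun i => toL2 (pull A (t i) (x i) (push A (t' i) (x' i) φ))) U
      (𝓝 (toL2 γ)) := by
  obtain ⟨K, hK, hmem⟩ := h.isCompact_conjFlow φ N
  obtain ⟨a, ha⟩ := hK.exists_tendsto_ultrafilter U (f := fun i =>
      conjFlow A (x' i) (t' i - t i) φ) (hN.mono fun i hi => hmem _ _ (by
        have := abs_nonneg (x' i - x i); linarith))
  obtain ⟨y, hy⟩ := U.exists_tendsto_of_abs_le (f := fun i => x' i - x i) (hN.mono fun i hi => by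
        have := abs_nonneg (t' i - t i); linarith)
  refine ⟨translH1 y a, ?_⟩
  simp_rw [h.pull_push_eq, toL2_translH1]
  have ha' := (continuous_toL2.tendsto a).comp ha
  have h1 : Tendsto (fun i => transl (x' i - x i) (toL2 (conjFlow A (x' i) (t' i - t i) φ) - toL2 a))
      U (𝓝 0) := by
    rw [tendsto_zero_iff_norm_tendsto_zero]
    simp_rw [LinearIsometry.norm_map]
    exact tendsto_iff_norm_sub_tendsto_zero.1 ha'
  have h2 := h1.add (((continuous_transl (toL2 a)).tendsto y).comp hy)
  rw [zero_add] at h2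
  refine h2.congr fun i => ?_
  simp only [Function.comp, map_sub, sub_add_cancel]

theorem inner_pull (h : Setup A B) (t x : ℝ) (φ v : H1) :
    inner ℂ (toL2 φ) (toL2 (pull A t x v)) = inner ℂ (toL2 (push A t x φ)) (toL2 v) := by
  rw [h.toL2_pull, h.toL2_push', inner_transl_right, h.group.inner_left, neg_neg] 

/-- Weak limits of pulled back sequences depend on the parameters only up to bounded changes. -/
theorem exists_weakTendsto_pull (h : Setup A B) (U : Ultrafilter ι) {t x t' x' : ι → ℝ} {N : ℝ}
    (hN : ∀ᶠ i in U, |t' i - t i| + |x' i - x i| ≤ N) {R : ι → H1} {C : ℝ} (hR : ∀ᶠ i in U, ‖R i‖ ≤ C)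
    {ψ : H1} (hψ : WeakTendsto (U : Filter ι) (fun i => pull A (t i) (x i) (R i)) ψ) :
    ∃ ψ' : H1, WeakTendsto (U : Filter ι) (fun i => pull A (t' i) (x' i) (R i)) ψ' ∧
      ‖toL2 ψ'‖ = ‖toL2 ψ‖ := by
  obtain ⟨M, hM1, hM⟩ := h.exists_push_pull_bound
  have hb : ∀ᶠ i in U, ‖pull A (t' i) (x' i) (R i)‖ ≤ M * C := hR.mono fun i hi =>
    ((hM _ _ _).2).trans (mul_le_mul_of_nonneg_left hi (by linarith))
  have hb' : ∀ᶠ i in U, ‖toL2 (pull A (t i) (x i) (R i))‖ ≤ M * C := hR.mono fun i hi =>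
    (norm_toL2_le _).trans
      (((hM _ _ _).2).trans (mul_le_mul_of_nonneg_left hi (by linarith)))
  obtain ⟨γ, hγ⟩ := h.exists_tendsto_pull_push U (t := t') (x := x') (t' := t) (x' := x)
    (hN.mono fun i hi => by rw [abs_sub_comm, abs_sub_comm (x i)]; exact hi) ψ
  refine ⟨γ, weakTendsto_of_toL2 hb fun φ => ?_, ?_⟩
  · obtain ⟨g, hg⟩ := h.exists_tendsto_pull_push U hN φ
    have h1 := WeakTendsto.inner_strong hg (hψ.map toL2L) hb'
    -- The changes of frame in the two directions are adjoint in L², and this passes to their strong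
    -- limits `g` and `γ`.
    have h2 : inner ℂ (toL2 g) (toL2 ψ) = inner ℂ (toL2 φ) (toL2 γ) := by
      refine tendsto_nhds_unique (hg.inner tendsto_const_nhds)
        ((tendsto_const_nhds.inner hγ).congr fun i => ?_)
      rw [h.inner_pull, ← inner_conj_symm, ← h.inner_pull, inner_conj_symm]
    rw [← h2]
    refine h1.congr fun i => ?_
    rw [toL2L_apply, h.inner_pull, h.inner_pull, h.push_pull]
  · refine tendsto_nhds_unique hγ.norm (tendsto_const_nhds.congr fun i => ?_)
    rw [h.norm_toL2_pull, h.norm_toL2_push]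

/-- Every sequence is at bounded distance from a standard one along an ultrafilter. -/
theorem exists_standard (U : Ultrafilter ι) (t : ι → ℝ) : ∃ t' : ι → ℝ,
    (Tendsto t' U atTop ∨ Tendsto t' U atBot ∨ ∀ n, t' n = 0) ∧
    ∃ N, ∀ᶠ i in U, |t' i - t i| ≤ N := by
  rcases U.bounded_or_tendsto_atTop t with ⟨N, hN⟩ | ht
  · rcases U.bounded_or_tendsto_atTop fun i => - t i with ⟨N', hN'⟩ | ht
    · refine ⟨fun _ => 0, Or.inr (Or.inr fun _ => rfl), max N N', ?_⟩
      filter_upwards [hN, hN'] with i h1 h2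
      rw [zero_sub, abs_neg, abs_le]
      exact ⟨by linarith [le_max_right N N'], h1.trans (le_max_left _ _)⟩
    · refine ⟨t, Or.inr (Or.inl ?_), 0, by simp⟩
      exact (tendsto_neg_atTop_atBot.comp ht).congr fun i => neg_neg (t i)
  · exact ⟨t, Or.inl ht, 0, by simp⟩

end Setup

/-! ### Decoupling of the norms -/

section PowerInequality

theorem abs_rpow_sub_rpow_le {ρ s t L : ℝ} (hρ : 1 ≤ ρ) (hs : s ∈ Icc 0 L) (ht : t ∈ Icc 0 L) :
    |s ^ ρ - t ^ ρ| ≤ ρ * L ^ (ρ - 1) * |s - t| := by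
  have hL : 0 ≤ L := hs.1.trans hs.2
  have h := (convex_Icc (0 : ℝ) L).norm_image_sub_le_of_norm_hasDerivWithin_le
    (f := fun x => x ^ ρ) (f' := fun x => ρ * x ^ (ρ - 1)) (C := ρ * L ^ (ρ - 1))
    (fun x _ => (Real.hasDerivAt_rpow_const (Or.inr hρ)).hasDerivWithinAt)
    (fun x hx => by
      rw [Real.norm_eq_abs, abs_of_nonneg (mul_nonneg (by linarith) (Real.rpow_nonneg hx.1 _))]
      exact mul_le_mul_of_nonneg_left (Real.rpow_le_rpow hx.1 hx.2 (by linarith)) (by linarith))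
    ht hs
  simpa [Real.norm_eq_abs] using h

/-- The pointwise inequality behind the Brezis–Lieb lemma, for bounded values. -/
theorem abs_norm_add_rpow_sub_le {ρ L : ℝ} (hρ : 2 ≤ ρ) {a b : ℂ} (ha : ‖a‖ ≤ L) (hb : ‖b‖ ≤ L) :
    |‖a + b‖ ^ ρ - (‖a‖ ^ ρ + ‖b‖ ^ ρ)| ≤ (2 * ρ + 1) * (2 * L) ^ (ρ - 2) * (‖a‖ * ‖b‖) := by
  wlog hab : ‖a‖ ≤ ‖b‖ generalizing a b
  · have := this hb ha (not_le.1 hab).le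
    rw [add_comm a b, add_comm (‖a‖ ^ ρ), mul_comm ‖a‖]
    exact this
  have hL : 0 ≤ L := (norm_nonneg _).trans ha
  have key : |‖a + b‖ ^ ρ - ‖b‖ ^ ρ| ≤ 2 * ρ * (2 * L) ^ (ρ - 2) * (‖a‖ * ‖b‖) := by
    have h1 := abs_rpow_sub_rpow_le (ρ := ρ) (L := 2 * ‖b‖) (s := ‖a + b‖) (t := ‖b‖) (by linarith)
      ⟨norm_nonneg _, (norm_add_le _ _).trans (by linarith)⟩
      ⟨norm_nonneg _, by linarith [norm_nonneg b]⟩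
    have h2 : |‖a + b‖ - ‖b‖| ≤ ‖a‖ := by
      have := abs_norm_sub_norm_le (a + b) b
      rwa [add_sub_cancel_right] at this
    have h3 : (2 * ‖b‖) ^ (ρ - 1) ≤ (2 * L) ^ (ρ - 2) * (2 * ‖b‖) := by
      have e : ρ - 1 = (ρ - 2) + 1 := by ring
      rw [e, Real.rpow_add_one' (by positivity) (by linarith)]
      exact mul_le_mul_of_nonneg_right (Real.rpow_le_rpow (by positivity) (by linarith)
        (by linarith)) (by positivity)
    calc _ ≤ ρ * (2 * ‖b‖) ^ (ρ - 1) * |‖a + b‖ - ‖b‖| := h1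
      _ ≤ ρ * ((2 * L) ^ (ρ - 2) * (2 * ‖b‖)) * ‖a‖ := by gcongr
      _ = _ := by ring
  have h4 : ‖a‖ ^ ρ ≤ (2 * L) ^ (ρ - 2) * (‖a‖ * ‖b‖) := by
    have e : ρ = (ρ - 2) + 2 := by ring
    calc ‖a‖ ^ ρ = ‖a‖ ^ (ρ - 2) * ‖a‖ ^ (2 : ℝ) := by
          conv_lhs => rw [e]
          rw [Real.rpow_add' (norm_nonneg _) (by linarith)]
      _ ≤ (2 * L) ^ (ρ - 2) * (‖a‖ * ‖b‖) := by
        rw [Real.rpow_two, sq]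
        have : ‖a‖ ^ (ρ - 2) ≤ (2 * L) ^ (ρ - 2) :=
          Real.rpow_le_rpow (norm_nonneg _) (by linarith) (by linarith)
        gcongr
  have h5 : 0 ≤ ‖a‖ ^ ρ := Real.rpow_nonneg (norm_nonneg _) _
  rw [← sub_sub, sub_right_comm]
  calc _ ≤ |‖a + b‖ ^ ρ - ‖b‖ ^ ρ| + |‖a‖ ^ ρ| := abs_sub _ _
    _ ≤ _ := by rw [abs_of_nonneg h5]; linarith

end PowerInequality

/-! ### Decoupling in `L^r` for weakly null sequences in H¹ -/

section LebesgueNorm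

theorem integrable_norm_sq (f : L2) : Integrable (fun x => ‖f x‖ ^ 2) volume :=
  (memLp_two_iff_integrable_sq_norm (Lp.aestronglyMeasurable f)).1 (Lp.memLp f)

theorem integral_norm_sq (f : L2) : ∫ x, ‖f x‖ ^ 2 = ‖f‖ ^ 2 := by
  have h : ((∫ x, ‖f x‖ ^ 2 : ℝ) : ℂ) = ((‖f‖ ^ 2 : ℝ) : ℂ) := by
    have h1 : inner ℂ f f = ((‖f‖ ^ 2 : ℝ) : ℂ) := by
      rw [inner_self_eq_norm_sq_to_K]; norm_cast
    rw [← h1, L2.inner_def, ← integral_complex_ofReal]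
    refine integral_congr_ae (Eventually.of_forall fun x => ?_)
    simp only [inner_self_eq_norm_sq_to_K]
    norm_cast
  exact_mod_cast h

variable {r : ℝ≥0∞}

theorem two_lt_toReal (hr : 2 < r) (hr' : r ≠ ⊤) : 2 < r.toReal := by
  have := (ENNReal.toReal_lt_toReal (by norm_num) hr').2 hr
  simpa using this

theorem norm_rpow_le {ρ L y : ℝ} (hρ : 2 ≤ ρ) (hy : 0 ≤ y) (hL : y ≤ L) :
    y ^ ρ ≤ L ^ (ρ - 2) * y ^ 2 := by
  have e : ρ = (ρ - 2) + 2 := by ring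
  conv_lhs => rw [e]
  rw [Real.rpow_add' hy (by linarith), Real.rpow_two]
  exact mul_le_mul_of_nonneg_right (Real.rpow_le_rpow hy hL (by linarith)) (by positivity)

theorem memLp_H1 (hr : 2 < r) (hr' : r ≠ ⊤) (v : H1) : MemLp (toL2 v) r volume := by
  have hρ := two_lt_toReal hr hr'
  rw [← integrable_norm_rpow_iff (Lp.aestronglyMeasurable _) (by positivity) hr']
  refine ((integrable_norm_sq (toL2 v)).const_mul ((2 * ‖v‖) ^ (r.toReal - 2))).mono'
    ((Lp.aestronglyMeasurable (toL2 v)).norm.aemeasurable.pow_const _).aestronglyMeasurable ?_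
  filter_upwards [norm_ae_le v] with x hx
  rw [Real.norm_of_nonneg (Real.rpow_nonneg (norm_nonneg _) _)]
  exact norm_rpow_le hρ.le (norm_nonneg _) hx

theorem lrNormPow_eq (hr : 2 < r) (hr' : r ≠ ⊤) (v : H1) :
    lrNormPow r (toL2 v) = ∫ x, ‖toL2 v x‖ ^ r.toReal := by
  have hρ := two_lt_toReal hr hr'
  have h0 : 0 ≤ ∫ x, ‖toL2 v x‖ ^ r.toReal := integral_nonneg fun x => by positivity
  rw [lrNormPow, (memLp_H1 hr hr' v).eLpNorm_eq_integral_rpow_norm (by positivity) hr',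
    ENNReal.toReal_ofReal (by positivity), ← Real.rpow_mul h0, inv_mul_cancel₀ (by linarith),
    Real.rpow_one]

theorem toReal_eLpNorm_le (hr : 2 < r) (hr' : r ≠ ⊤) (C : ℝ) : ∃ D : ℝ, ∀ v : H1, ‖v‖ ≤ C →
    (eLpNorm (toL2 v) r volume).toReal ≤ D := by
  have hρ := two_lt_toReal hr hr'
  refine ⟨((2 * C) ^ (r.toReal - 2) * C ^ 2) ^ r.toReal⁻¹, fun v hv => ?_⟩
  have h0 : 0 ≤ ∫ x, ‖toL2 v x‖ ^ r.toReal := integral_nonneg fun x => by positivity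
  rw [(memLp_H1 hr hr' v).eLpNorm_eq_integral_rpow_norm (by positivity) hr',
    ENNReal.toReal_ofReal (by positivity)]
  refine Real.rpow_le_rpow h0 ?_ (by positivity)
  have hC : 0 ≤ C := (norm_nonneg _).trans hv
  calc ∫ x, ‖toL2 v x‖ ^ r.toReal ≤ ∫ x, (2 * C) ^ (r.toReal - 2) * ‖toL2 v x‖ ^ 2 := by
        refine integral_mono_ae ?_ ((integrable_norm_sq _).const_mul _) ?_
        · exact (integrable_norm_rpow_iff (Lp.aestronglyMeasurable _) (by positivity) hr').2
            (memLp_H1 hr hr' v)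
        · filter_upwards [norm_ae_le v] with x hx
          exact norm_rpow_le hρ.le (norm_nonneg _) (hx.trans (by linarith))
    _ = (2 * C) ^ (r.toReal - 2) * ‖toL2 v‖ ^ 2 := by
        rw [integral_const_mul, integral_norm_sq]
    _ ≤ _ := by
        have := (norm_toL2_le v).trans hv
        gcongr

/-- Where `‖v_n‖` is much larger than `‖ψ‖`, the product is at most `δ‖v_n‖²`. Elsewhere it is
dominated by `δ⁻¹‖ψ‖²`, and dominated convergence applies because `v_n → 0` pointwise. -/
theorem tendsto_integral_norm_mul_norm (ψ : H1) {v : ℕ → H1} {C : ℝ} (hb : ∀ n, ‖v n‖ ≤ C)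
    (hv : WeakTendsto atTop v 0) :
    Tendsto (fun n => ∫ x, ‖toL2 ψ x‖ * ‖toL2 (v n) x‖) atTop (𝓝 0) := by
  have hC : 0 ≤ C := (norm_nonneg _).trans (hb 0)
  have hpt : ∀ᵐ x : ℝ, Tendsto (fun n => toL2 (v n) x) atTop (𝓝 0) := by
    filter_upwards [ae_all_iff.2 fun n => eval_ae one_pos (v n)] with x hx
    have h1 := hv.dual ((evL 1).comp (translL (-x)))
    rw [map_zero] at h1
    exact h1.congr fun n => (hx n).symm
  have hm : ∀ f : L2, AEStronglyMeasurable (fun x => ‖f x‖) volume := fun f =>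
    (Lp.aestronglyMeasurable f).norm
  have hint : ∀ n, Integrable (fun x => ‖toL2 ψ x‖ * ‖toL2 (v n) x‖) volume := fun n =>
    (Lp.memLp (toL2 ψ)).norm.integrable_mul (Lp.memLp (toL2 (v n))).norm
  rw [Metric.tendsto_nhds]
  intro ε hε
  obtain ⟨δ, hδ, hδε⟩ : ∃ δ : ℝ, 0 < δ ∧ δ * C ^ 2 < ε / 2 :=
    ⟨ε / (4 * (C ^ 2 + 1)), by positivity, by
      rw [div_mul_eq_mul_div, div_lt_iff₀ (by positivity)]; nlinarith⟩
  have hmin : Tendsto (fun n => ∫ x, min (‖toL2 ψ x‖ * ‖toL2 (v n) x‖) (δ⁻¹ * ‖toL2 ψ x‖ ^ 2)) atTop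
      (𝓝 (∫ _ : ℝ, (0 : ℝ))) := by
    refine tendsto_integral_of_dominated_convergence (fun x => δ⁻¹ * ‖toL2 ψ x‖ ^ 2)
      (fun n => ((hm _).mul (hm _)).inf (((hm _).pow 2).const_mul _))
      ((integrable_norm_sq _).const_mul _) (fun n => Eventually.of_forall fun x => ?_) ?_
    · rw [Real.norm_of_nonneg (le_min (by positivity) (by positivity))]
      exact min_le_right _ _
    · filter_upwards [hpt] with x hx
      have h1 : Tendsto (fun n => ‖toL2 ψ x‖ * ‖toL2 (v n) x‖) atTop (𝓝 0) := by
        simpa using hx.norm.const_mul ‖toL2 ψ x‖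
      exact squeeze_zero (fun n => le_min (by positivity) (by positivity))
        (fun n => min_le_left _ _) h1
  rw [integral_zero] at hmin
  filter_upwards [(tendsto_order.1 hmin).2 (ε / 2) (half_pos hε)] with n hn
  rw [dist_zero_right, Real.norm_of_nonneg (integral_nonneg fun x => by positivity)]
  have hint2 : Integrable (fun x => min (‖toL2 ψ x‖ * ‖toL2 (v n) x‖) (δ⁻¹ * ‖toL2 ψ x‖ ^ 2))
      volume := (hint n).inf ((integrable_norm_sq _).const_mul _)
  calc ∫ x, ‖toL2 ψ x‖ * ‖toL2 (v n) x‖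
      ≤ ∫ x, (δ * ‖toL2 (v n) x‖ ^ 2 +
          min (‖toL2 ψ x‖ * ‖toL2 (v n) x‖) (δ⁻¹ * ‖toL2 ψ x‖ ^ 2)) := by
        refine integral_mono (hint n) (((integrable_norm_sq _).const_mul _).add hint2) fun x => ?_
        simp only
        rcases le_total ‖toL2 ψ x‖ (δ * ‖toL2 (v n) x‖) with h1 | h1
        · have h2 : 0 ≤ min (‖toL2 ψ x‖ * ‖toL2 (v n) x‖) (δ⁻¹ * ‖toL2 ψ x‖ ^ 2) :=
            le_min (by positivity) (by positivity)
          nlinarith [norm_nonneg (toL2 (v n) x)]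
        · have h2 : ‖toL2 (v n) x‖ ≤ δ⁻¹ * ‖toL2 ψ x‖ := by
            rw [inv_mul_eq_div, le_div_iff₀ hδ, mul_comm]; exact h1
          rw [min_eq_left]
          · nlinarith [norm_nonneg (toL2 (v n) x), sq_nonneg ‖toL2 (v n) x‖]
          · nlinarith [norm_nonneg (toL2 ψ x)]
    _ = δ * ‖toL2 (v n)‖ ^ 2 +
          ∫ x, min (‖toL2 ψ x‖ * ‖toL2 (v n) x‖) (δ⁻¹ * ‖toL2 ψ x‖ ^ 2) := by
        rw [integral_add ((integrable_norm_sq _).const_mul _) hint2, integral_const_mul,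
          integral_norm_sq]
    _ < ε := by
        have h1 := (norm_toL2_le (v n)).trans (hb n)
        have h2 : δ * ‖toL2 (v n)‖ ^ 2 ≤ δ * C ^ 2 := by gcongr
        linarith

/-- Functions in H¹ are bounded, so the pointwise inequality controls the defect by the integral of
`‖ψ‖‖v_n‖`. -/
theorem tendsto_lrNormPow_add_atTop (hr : 2 < r) (hr' : r ≠ ⊤) (ψ : H1) {v : ℕ → H1} {C : ℝ}
    (hb : ∀ n, ‖v n‖ ≤ C) (hv : WeakTendsto atTop v 0) :
    Tendsto (fun n => lrNormPow r (toL2 (ψ + v n)) -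
      (lrNormPow r (toL2 ψ) + lrNormPow r (toL2 (v n)))) atTop (𝓝 0) := by
  have hρ := two_lt_toReal hr hr'
  let L := max (2 * ‖ψ‖) (2 * C)
  have hi : ∀ w : H1, Integrable (fun x => ‖toL2 w x‖ ^ r.toReal) volume := fun w =>
    (integrable_norm_rpow_iff (Lp.aestronglyMeasurable _) (by positivity) hr').2
      (memLp_H1 hr hr' w)
  have h1 := (tendsto_integral_norm_mul_norm ψ hb hv).const_mul
    ((2 * r.toReal + 1) * (2 * L) ^ (r.toReal - 2))
  rw [mul_zero] at h1
  refine squeeze_zero_norm (fun n => ?_) h1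
  rw [lrNormPow_eq hr hr', lrNormPow_eq hr hr', lrNormPow_eq hr hr',
    ← integral_add (hi ψ) (hi (v n)), ← integral_sub (hi _) ((hi ψ).fun_add (hi (v n))),
    ← integral_const_mul]
  refine norm_integral_le_of_norm_le (((Lp.memLp (toL2 ψ)).norm.integrable_mul
    (Lp.memLp (toL2 (v n))).norm).const_mul _) ?_
  filter_upwards [norm_ae_le ψ, norm_ae_le (v n), Lp.coeFn_add (toL2 ψ) (toL2 (v n))]
    with x h2 h3 h4
  rw [map_add, h4, Pi.add_apply]
  exact abs_norm_add_rpow_sub_le hρ.le (h2.trans (le_max_left _ _))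
    (h3.trans ((by linarith [hb n] : 2 * ‖v n‖ ≤ 2 * C).trans (le_max_right _ _)))

end LebesgueNorm

/-- Sequential continuity at weakly null sequences implies continuity along arbitrary filters. -/
theorem tendsto_of_forall_weakly_null_seq {ι : Type*} {l : Filter ι} {G : H1 → ℝ} {C : ℝ}
    (hG : ∀ v : ℕ → H1, (∀ n, ‖v n‖ ≤ C) → WeakTendsto atTop v 0 →
      Tendsto (fun n => G (v n)) atTop (𝓝 0))
    {w : ι → H1} (hb : ∀ᶠ i in l, ‖w i‖ ≤ C) (hw : WeakTendsto l w 0) :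
    Tendsto (fun i => G (w i)) l (𝓝 0) := by
  by_contra hcon
  rw [Metric.tendsto_nhds] at hcon
  push Not at hcon
  obtain ⟨ε, hε, hfreq⟩ := hcon
  -- Dominated convergence needs sequences. A failure along the filter gives bounded elements on
  -- which `G` stays large while finitely many, and ever more, pairings with a dense sequence are
  -- small.
  have hpick : ∀ n : ℕ, ∃ v : H1, ‖v‖ ≤ C ∧ (∀ k ≤ n,
      ‖inner ℂ (TopologicalSpace.denseSeq H1 k) v‖ < 1 / ((n : ℝ) + 1)) ∧ ε ≤ |G v| := by
    intro n
    have h1 : ∀ᶠ i in l, ∀ k ∈ Finset.range (n + 1),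
        ‖inner ℂ (TopologicalSpace.denseSeq H1 k) (w i)‖ < 1 / ((n : ℝ) + 1) := by
      rw [Filter.eventually_all_finset]
      intro k _
      have h2 := (hw (TopologicalSpace.denseSeq H1 k)).norm
      rw [inner_zero_right, norm_zero] at h2
      exact (tendsto_order.1 h2).2 _ (by positivity)
    obtain ⟨i, hi, hi1, hi2⟩ := (hfreq.and_eventually (h1.and hb)).exists
    refine ⟨w i, hi2, fun k hk => hi1 k (Finset.mem_range.2 (by omega)), ?_⟩
    rwa [dist_zero_right] at hi
  choose v hvC hvk hvG using hpick
  have hnull : WeakTendsto atTop v 0 := by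
    intro g
    rw [tendsto_iff_ultrafilter]
    intro U hU
    obtain ⟨ψ, hψ⟩ := exists_weakTendsto U (Eventually.of_forall hvC)
    have h0 : ∀ k, inner ℂ (TopologicalSpace.denseSeq H1 k) ψ = 0 := by
      intro k
      refine tendsto_nhds_unique (hψ _) (Tendsto.mono_left ?_ hU)
      refine squeeze_zero_norm' ?_ tendsto_one_div_add_atTop_nhds_zero_nat
      filter_upwards [eventually_ge_atTop k] with n hn
      exact (hvk n k hn).le
    have h1 : ∀ f : H1, inner ℂ f ψ = 0 := fun f =>
      congrFun ((TopologicalSpace.denseRange_denseSeq H1).equalizer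
        (show Continuous fun f : H1 => inner ℂ f ψ by fun_prop) (continuous_const (y := (0 : ℂ)))
        (funext h0)) f
    have h2 : ψ = 0 := inner_self_eq_zero.1 (h1 ψ)
    rw [← h2]
    exact hψ g
  have h1 := (hG v hvC hnull).abs
  rw [abs_zero] at h1
  exact absurd (ge_of_tendsto' h1 hvG) (not_le.2 hε)

/-! ### Decoupling of mass, energy and `L^r` norm in a moving frame -/

namespace Setup

variable {A : L2 →ₗ.[ℂ] L2} {B : H1 →L[ℂ] Hneg1} {ι : Type*}

theorem pull_sub_push (h : Setup A B) (t x : ℝ) (R ψ : H1) :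
    pull A t x (R - push A t x ψ) = pull A t x R - ψ := by
  rw [map_sub, h.pull_push]

theorem tendsto_norm_sq (h : Setup A B) {l : Filter ι} {t x : ι → ℝ} {R : ι → H1} {ψ : H1}
    (hψ : WeakTendsto l (fun i => pull A (t i) (x i) (R i)) ψ) :
    Tendsto (fun i => ‖toL2 (R i)‖ ^ 2 -
      (‖toL2 ψ‖ ^ 2 + ‖toL2 (R i - push A (t i) (x i) ψ)‖ ^ 2)) l (𝓝 0) := by
  refine (hψ.map toL2L).norm_sq_sub.congr fun i => ?_
  simp only [toL2L_apply]
  rw [← map_sub, ← h.pull_sub_push, h.norm_toL2_pull, h.norm_toL2_pull]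

/-- By `A3` the functionals `A_{x_i} ψ` converge in norm along every ultrafilter, and a norm
convergent functional tends to 0 on a bounded weakly null family. -/
theorem tendsto_translExt (h : Setup A B) {l : Filter ι} {x : ι → ℝ} {v : ι → H1} {C : ℝ} (ψ : H1)
    (hb : ∀ᶠ i in l, ‖v i‖ ≤ C) (hv : WeakTendsto l v 0) :
    Tendsto (fun i => translExt B (x i) ψ (v i)) l (𝓝 0) := by
  rw [tendsto_iff_ultrafilter]
  intro U hU
  obtain ⟨K, hK, hmem⟩ := h.isCompact_translExt ψ
  obtain ⟨T, hT⟩ := hK.exists_tendsto_ultrafilter U (f := fun i => translExt B (x i) ψ)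
    (Eventually.of_forall fun i => hmem _)
  have h1 : Tendsto (fun i => (translExt B (x i) ψ - T) (v i)) U (𝓝 0) := by
    have h2 : Tendsto (fun i => ‖translExt B (x i) ψ - T‖) U (𝓝 0) :=
      (tendsto_iff_norm_sub_tendsto_zero (E := Hneg1)).1 hT
    replace h2 := h2.mul_const C
    rw [zero_mul] at h2
    refine squeeze_zero_norm' ?_ h2
    filter_upwards [hU hb] with i hi
    exact (ContinuousLinearMap.le_opNorm _ _).trans
      (mul_le_mul_of_nonneg_left hi (ContinuousLinearMap.opNorm_nonneg _))
  let f : H1 →L[ℂ] ℂ := LinearMap.mkContinuous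
    { toFun := fun v => starRingEnd ℂ (T v)
      map_add' := fun a b => by simp
      map_smul' := fun c a => by simp } ‖T‖ fun v => by
        simpa using T.le_opNorm v
  have h3 := (hv.mono hU).dual f
  rw [map_zero] at h3
  have h4 := (Complex.continuous_conj.tendsto _).comp h3
  rw [map_zero] at h4
  have h5 := h1.add h4
  rw [zero_add] at h5
  refine h5.congr fun i => ?_
  simp [f]

/-- By hermitian symmetry the defect is `2 Re (A_x ψ, v)`, where `v` is the weakly null part of the
remainder in the frame. -/
theorem tendsto_form (h : Setup A B) {l : Filter ι} {t x : ι → ℝ} {R : ι → H1} {ψ : H1} {C : ℝ}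
    (hR : ∀ᶠ i in l, ‖R i‖ ≤ C) (hψ : WeakTendsto l (fun i => pull A (t i) (x i) (R i)) ψ) :
    Tendsto (fun i => B (R i) (R i) - (B (translH1 (x i) ψ) (translH1 (x i) ψ) +
      B (R i - push A (t i) (x i) ψ) (R i - push A (t i) (x i) ψ))) l (𝓝 0) := by
  obtain ⟨M, hM1, hM⟩ := h.exists_push_pull_bound
  have hw : WeakTendsto l (fun i => pull A (t i) (x i) (R i) - ψ) 0 := by
    simpa using hψ.sub (weakTendsto_const ψ)
  have h1 := h.tendsto_translExt (x := x) (C := M * C + ‖ψ‖) ψ (hR.mono fun i hi => by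
    refine (norm_sub_le _ _).trans (add_le_add_left ?_ _)
    exact ((hM _ _ _).2).trans (mul_le_mul_of_nonneg_left hi (by linarith))) hw
  have h2 := h1.add ((Complex.continuous_conj.tendsto _).comp h1)
  rw [map_zero, add_zero] at h2
  refine h2.congr fun i => ?_
  simp only [Function.comp]
  rw [← h.pull_sub_push, ← h.form_push_left, ← h.hermitian, ← h.form_push_self (t i)]
  simp only [map_sub, sub_apply]
  ring

theorem eLpNorm_push_eq (h : Setup A B) (p : ℝ≥0∞) (t x : ℝ) (ψ : H1) :
    eLpNorm (toL2 (push A t x ψ)) p volume = eLpNorm (toL2 (conjFlow A x t ψ)) p volume := by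
  rw [h.toL2_conjFlow, eLpNorm_transl, h.toL2_push']

theorem tendsto_lrNormPow (h : Setup A B) {r : ℝ≥0∞} [Fact (1 ≤ r)] (h5 : A5 A r) (hr : 2 < r)
    (hr' : r ≠ ⊤) (U : Ultrafilter ι) {t x : ι → ℝ} {R : ι → H1} {ψ : H1} {C : ℝ}
    (ht : Tendsto (fun i => |t i|) U atTop ∨ ∀ i, t i = 0)
    (hR : ∀ᶠ i in U, ‖R i‖ ≤ C)
    (hψ : WeakTendsto (U : Filter ι) (fun i => pull A (t i) (x i) (R i)) ψ) :
    Tendsto (fun i => lrNormPow r (toL2 (R i)) - (lrNormPow r (toL2 (push A (t i) (x i) ψ)) +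
      lrNormPow r (toL2 (R i - push A (t i) (x i) ψ)))) U (𝓝 0) := by
  obtain ⟨M, hM1, hM⟩ := h.exists_push_pull_bound
  have hρ := two_lt_toReal hr hr'
  rcases ht with ht | ht
  -- For `|t| → ∞` the moving profile vanishes in `L^r`, so the remainders before and after
  -- subtraction have the same limiting norm.
  · let n : H1 → ℝ := fun v => (eLpNorm (toL2 v) r volume).toReal
    have hn0 : Tendsto (fun i => n (push A (t i) (x i) ψ)) U (𝓝 0) := by
      have := (ENNReal.tendsto_toReal ENNReal.zero_ne_top).comp
        (h.tendsto_eLpNorm_conjFlow h5 ψ (x := x) ht)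
      exact this.congr fun i => by simp only [n, Function.comp, h.eLpNorm_push_eq]
    obtain ⟨D, hD⟩ := toReal_eLpNorm_le hr hr' C
    obtain ⟨a, ha⟩ := U.exists_tendsto_of_abs_le (f := fun i => n (R i)) (hR.mono fun i hi => by
      rw [abs_of_nonneg ENNReal.toReal_nonneg]; exact hD _ hi)
    have htri : ∀ v w : H1, n (v + w) ≤ n v + n w := by
      intro v w
      simp only [n]
      rw [← ENNReal.toReal_add (memLp_H1 hr hr' v).2.ne (memLp_H1 hr hr' w).2.ne]
      refine ENNReal.toReal_mono
        (ENNReal.add_ne_top.2 ⟨(memLp_H1 hr hr' v).2.ne, (memLp_H1 hr hr' w).2.ne⟩) ?_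
      rw [map_add, eLpNorm_congr_ae (Lp.coeFn_add _ _)]
      exact eLpNorm_add_le (Lp.aestronglyMeasurable _) (Lp.aestronglyMeasurable _) Fact.out
    have hneg : ∀ v : H1, n (-v) = n v := by
      intro v
      simp only [n]
      rw [map_neg, eLpNorm_congr_ae (Lp.coeFn_neg _), eLpNorm_neg]
    have ha' : Tendsto (fun i => n (R i - push A (t i) (x i) ψ)) U (𝓝 a) := by
      have hd : Tendsto (fun i => n (R i - push A (t i) (x i) ψ) - n (R i)) U (𝓝 0) := by
        refine squeeze_zero_norm (fun i => ?_) hn0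
        have e1 := htri (R i) (-push A (t i) (x i) ψ)
        have e2 := htri (R i - push A (t i) (x i) ψ) (push A (t i) (x i) ψ)
        rw [← sub_eq_add_neg, hneg] at e1
        rw [sub_add_cancel] at e2
        rw [Real.norm_eq_abs, abs_le]
        constructor <;> linarith
      simpa using hd.add ha
    have hpow : ∀ b : ℝ, Tendsto (fun y : ℝ => y ^ r.toReal) (𝓝 b) (𝓝 (b ^ r.toReal)) := fun b =>
      (Real.continuous_rpow_const (by linarith)).tendsto b
    have h1 := ((hpow a).comp ha).sub (((hpow 0).comp hn0).add ((hpow a).comp ha'))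
    rw [Real.zero_rpow (by linarith), zero_add, sub_self] at h1
    exact h1
  -- For `t = 0` the frame is a pure translation, which preserves the `L^r` norm, and the case of a
  -- fixed profile applies.
  · have hw : WeakTendsto (U : Filter ι) (fun i => pull A (t i) (x i) (R i) - ψ) 0 := by
      simpa using hψ.sub (weakTendsto_const ψ)
    have hb : ∀ᶠ i in U, ‖pull A (t i) (x i) (R i) - ψ‖ ≤ M * C + ‖ψ‖ := hR.mono fun i hi => by
      refine (norm_sub_le _ _).trans (add_le_add_left ?_ _)
      exact ((hM _ _ _).2).trans (mul_le_mul_of_nonneg_left hi (by linarith))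
    have h1 := tendsto_of_forall_weakly_null_seq (G := fun v => lrNormPow r (toL2 (ψ + v)) -
      (lrNormPow r (toL2 ψ) + lrNormPow r (toL2 v)))
      (fun v hvb hv => tendsto_lrNormPow_add_atTop hr hr' ψ hvb hv) hb hw
    refine h1.congr fun i => ?_
    have hp : ∀ v : H1, lrNormPow r (toL2 (pull A (t i) (x i) v)) = lrNormPow r (toL2 v) := by
      intro v
      rw [lrNormPow, lrNormPow, h.toL2_pull, eLpNorm_transl, ht i, neg_zero, h.group.apply_zero]
    rw [add_sub_cancel, hp, ← h.pull_sub_push, hp, ← hp (push A (t i) (x i) ψ), h.pull_push]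

end Setup

/-! ### Extraction of profiles along an ultrafilter -/

/-- Standard sequences along a filter. -/
def IsStandardAlong (l : Filter ℕ) (t : ℕ → ℝ) : Prop :=
  Tendsto t l atTop ∨ Tendsto t l atBot ∨ ∀ n, t n = 0

/-- A profile with its sequences of times and positions. -/
structure Profile where
  /-- the times -/
  t : ℕ → ℝ
  /-- the positions -/
  x : ℕ → ℝ
  /-- the profile -/
  ψ : H1

/-- `ψ` is a weak limit of `R` in some moving frame. -/
def IsWeakProfile (A : L2 →ₗ.[ℂ] L2) (l : Filter ℕ) (R : ℕ → H1) (ψ : H1) : Prop :=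
  ∃ t x : ℕ → ℝ, WeakTendsto l (fun n => pull A (t n) (x n) (R n)) ψ

/-- The profile in its moving frame. -/
def Profile.bub (A : L2 →ₗ.[ℂ] L2) (p : Profile) (n : ℕ) : H1 := push A (p.t n) (p.x n) p.ψ

/-- The sequence seen from the moving frame of a profile. -/
def Profile.frame (A : L2 →ₗ.[ℂ] L2) (p : Profile) (R : ℕ → H1) (n : ℕ) : H1 :=
  pull A (p.t n) (p.x n) (R n)

/-- The distance between the parameters of two profiles. -/
def Profile.gap (p q : Profile) (n : ℕ) : ℝ := |p.t n - q.t n| + |p.x n - q.x n|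

/-- The remainder after the subtraction of a list of profiles. -/
def remainder (A : L2 →ₗ.[ℂ] L2) (u : ℕ → H1) : List Profile → ℕ → H1
  | [], n => u n
  | p :: L, n => remainder A u L n - p.bub A n

namespace Setup

variable {A : L2 →ₗ.[ℂ] L2} {B : H1 →L[ℂ] Hneg1} {r : ℝ≥0∞} [Fact (1 ≤ r)]

theorem exists_bound_remainder (h : Setup A B) {u : ℕ → H1} {C : ℝ} (hu : ∀ n, ‖u n‖ ≤ C)
    (L : List Profile) : ∃ D, ∀ n, ‖remainder A u L n‖ ≤ D := by
  obtain ⟨M, -, hM⟩ := h.exists_push_pull_bound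
  induction L with
  | nil => exact ⟨C, hu⟩
  | cons p L ih =>
    obtain ⟨D, hD⟩ := ih
    exact ⟨D + M * ‖p.ψ‖, fun n => (norm_sub_le _ _).trans (add_le_add (hD n) (hM _ _ _).1)⟩

/-- A weak limit whose L² norm exceeds half of a positive supremum exists. Making its parameters
standard is a bounded change, which preserves that norm. -/
theorem exists_profile (h : Setup A B) (U : Ultrafilter ℕ) (hU : (U : Filter ℕ) ≤ atTop)
    {R : ℕ → H1} {C : ℝ} (hR : ∀ n, ‖R n‖ ≤ C) (L : List Profile)
    (hL : ∀ q ∈ L, WeakTendsto (U : Filter ℕ) (q.frame A R) 0) :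
    ∃ p : Profile, IsStandardAlong U p.t ∧ IsStandardAlong U p.x ∧
      WeakTendsto (U : Filter ℕ) (p.frame A R) p.ψ ∧ (∀ q ∈ L, Tendsto (p.gap q) U atTop) ∧
      ∀ ψ, IsWeakProfile A U R ψ → ‖toL2 ψ‖ ≤ 2 * ‖toL2 p.ψ‖ := by
  obtain ⟨M, hM1, hM⟩ := h.exists_push_pull_bound
  have hbd : ∀ t x n, ‖pull A t x (R n)‖ ≤ M * C := fun t x n =>
    ((hM _ _ _).2).trans (mul_le_mul_of_nonneg_left (hR n) (by linarith))
  let S : Set ℝ := {a | ∃ ψ, IsWeakProfile A U R ψ ∧ ‖toL2 ψ‖ = a}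
  have hS : BddAbove S := by
    refine ⟨M * C, ?_⟩
    rintro _ ⟨ψ, ⟨t, x, hψ⟩, rfl⟩
    exact (norm_toL2_le ψ).trans (hψ.norm_le (Eventually.of_forall fun n => hbd _ _ n))
  have hle : ∀ ψ, IsWeakProfile A U R ψ → ‖toL2 ψ‖ ≤ sSup S := fun ψ hψ =>
    le_csSup hS ⟨ψ, hψ, rfl⟩
  rcases le_or_gt (sSup S) 0 with hs | hs
  -- All weak limits vanish, so any frame is optimal; the times `n + T n` exceed those of every
  -- earlier profile by at least `n`.
  · let T : ℕ → ℝ := fun n => (L.map fun q => |q.t n|).sum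
    have hT : ∀ q ∈ L, ∀ n, |q.t n| ≤ T n := by
      intro q hq n
      refine List.single_le_sum ?_ _ (List.mem_map_of_mem (f := fun q : Profile => |q.t n|) hq)
      intro a ha
      obtain ⟨q', -, rfl⟩ := List.mem_map.1 ha
      exact abs_nonneg _
    have hT0 : ∀ n, 0 ≤ T n := by
      intro n
      refine List.sum_nonneg ?_
      intro a ha
      obtain ⟨q', -, rfl⟩ := List.mem_map.1 ha
      exact abs_nonneg _
    have hnat : Tendsto (fun n : ℕ => (n : ℝ)) U atTop := tendsto_natCast_atTop_atTop.mono_left hU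
    obtain ⟨ψ, hψ⟩ := exists_weakTendsto U (w := fun n => pull A (n + T n) 0 (R n))
      (Eventually.of_forall fun n => hbd _ _ n)
    refine ⟨⟨fun n => n + T n, fun _ => 0, ψ⟩, Or.inl ?_, Or.inr (Or.inr fun _ => rfl), hψ, ?_, ?_⟩
    · exact tendsto_atTop_mono (fun n => by linarith [hT0 n]) hnat
    · intro q hq
      refine tendsto_atTop_mono (fun n => ?_) hnat
      have h1 := hT q hq n
      have h2 := le_abs_self (n + T n - q.t n)
      have h3 := le_abs_self (q.t n)
      have h4 := abs_nonneg (0 - q.x n)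
      change (n : ℝ) ≤ |n + T n - q.t n| + |0 - q.x n|
      linarith
    · intro ψ' hψ'
      exact ((hle ψ' hψ').trans hs).trans (by positivity)
  · have hne : S.Nonempty := by
      by_contra hcon
      rw [not_nonempty_iff_eq_empty.1 hcon, Real.sSup_empty] at hs
      exact lt_irrefl _ hs
    obtain ⟨_, ⟨ψ₀, ⟨t₀, x₀, hψ₀⟩, rfl⟩, hlt⟩ := exists_lt_of_lt_csSup hne (half_lt_self hs)
    obtain ⟨t, ht, N, hN⟩ := exists_standard U t₀
    obtain ⟨x, hx, N', hN'⟩ := exists_standard U x₀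
    obtain ⟨ψ, hψ, hnorm⟩ := h.exists_weakTendsto_pull U (t := t₀) (x := x₀) (t' := t) (x' := x)
      (N := N + N') ((hN.and hN').mono fun i hi => add_le_add hi.1 hi.2)
      (Eventually.of_forall hR) hψ₀
    refine ⟨⟨t, x, ψ⟩, ht, hx, hψ, fun q hq => ?_, fun ψ' hψ' => ?_⟩
    -- A bounded gap to an old frame, where the remainder is weakly null, would force `ψ` to have
    -- zero L² norm.
    · rcases U.bounded_or_tendsto_atTop ((⟨t, x, ψ⟩ : Profile).gap q) with ⟨D, hD⟩ | hT
      · obtain ⟨ψ', hψ', hn'⟩ := h.exists_weakTendsto_pull U hD (Eventually.of_forall hR) (hL q hq)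
        rw [hψ'.unique hψ, map_zero, norm_zero, hnorm] at hn'
        linarith
      · exact hT
    · change _ ≤ 2 * ‖toL2 ψ‖
      rw [hnorm]
      linarith [hle ψ' hψ']

theorem weakTendsto_frame_sub_self (h : Setup A B) {l : Filter ℕ} {R : ℕ → H1} {p : Profile}
    (hp : WeakTendsto l (p.frame A R) p.ψ) :
    WeakTendsto l (p.frame A fun n => R n - p.bub A n) 0 := by
  have h1 := hp.sub (weakTendsto_const p.ψ)
  rw [sub_self] at h1
  refine h1.congr' (Eventually.of_forall fun n => ?_)
  exact (h.pull_sub_push _ _ _ _).symm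

theorem weakTendsto_frame_sub (h : Setup A B) (h5 : A5 A r) {l : Filter ℕ} {R : ℕ → H1} {p q : Profile}
    (hg : Tendsto (p.gap q) l atTop) (hq : WeakTendsto l (q.frame A R) 0) :
    WeakTendsto l (q.frame A fun n => R n - p.bub A n) 0 := by
  have h1 := hq.sub (h.weakTendsto_pull_push h5 p.ψ hg)
  rw [sub_self] at h1
  refine h1.congr' (Eventually.of_forall fun n => ?_)
  exact (map_sub (pull A (q.t n) (q.x n)) _ _).symm

/-- In frames near that of `p` the new remainder is weakly null; in frames diverging from it, old
and new remainders have the same weak limits. This is why (b) compares `R_J` with `ψ_J` and not with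
the next profile. -/
theorem norm_isWeakProfile_sub (h : Setup A B) (h5 : A5 A r) (U : Ultrafilter ℕ) {R : ℕ → H1} {C : ℝ}
    (hR : ∀ n, ‖R n‖ ≤ C) {p : Profile} (hp : WeakTendsto (U : Filter ℕ) (p.frame A R) p.ψ)
    {a : ℝ} (ha : ∀ ψ, IsWeakProfile A U R ψ → ‖toL2 ψ‖ ≤ a) {ψ : H1}
    (hψ : IsWeakProfile A U (fun n => R n - p.bub A n) ψ) : ‖toL2 ψ‖ ≤ a := by
  obtain ⟨M, hM1, hM⟩ := h.exists_push_pull_bound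
  obtain ⟨t, x, htx⟩ := hψ
  have ha0 : 0 ≤ a := (norm_nonneg _).trans (ha p.ψ ⟨p.t, p.x, hp⟩)
  rcases U.bounded_or_tendsto_atTop fun n => |t n - p.t n| + |x n - p.x n| with ⟨D, hD⟩ | hT
  · have hb : ∀ n, ‖R n - p.bub A n‖ ≤ C + M * ‖p.ψ‖ := fun n =>
      (norm_sub_le _ _).trans (add_le_add (hR n) (hM _ _ _).1)
    obtain ⟨ψ', hψ', hn'⟩ := h.exists_weakTendsto_pull U hD (Eventually.of_forall hb)
      (h.weakTendsto_frame_sub_self hp)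
    rw [hψ'.unique htx, map_zero, norm_zero] at hn'
    rw [hn']; exact ha0
  · refine ha ψ ⟨t, x, ?_⟩
    have h1 := htx.add (h.weakTendsto_pull_push h5 p.ψ (l := (U : Filter ℕ)) (t := t) (x := x)
      (t' := p.t) (x' := p.x) (hT.congr fun n => by rw [abs_sub_comm, abs_sub_comm (x n)]))
    rw [add_zero] at h1
    refine h1.congr' (Eventually.of_forall fun n => ?_)
    simp only
    rw [← map_add, Profile.bub, sub_add_cancel]

/-- The successive extraction of almost optimal profiles. -/
theorem exists_profiles (h : Setup A B) (h5 : A5 A r) (U : Ultrafilter ℕ)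
    (hU : (U : Filter ℕ) ≤ atTop) {u : ℕ → H1} {C : ℝ} (hu : ∀ n, ‖u n‖ ≤ C) :
    ∃ p : ℕ → Profile, ∃ R : ℕ → ℕ → H1, (∀ n, R 0 n = u n) ∧
      (∀ J n, R (J + 1) n = R J n - (p J).bub A n) ∧ (∀ J, ∃ D, ∀ n, ‖R J n‖ ≤ D) ∧
      (∀ j, IsStandardAlong U (p j).t ∧ IsStandardAlong U (p j).x) ∧
      (∀ J, WeakTendsto (U : Filter ℕ) ((p J).frame A (R J)) (p J).ψ) ∧
      (∀ j k, j < k → Tendsto ((p k).gap (p j)) U atTop) ∧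
      (∀ J ψ, IsWeakProfile A U (R J) ψ → ‖toL2 ψ‖ ≤ 2 * ‖toL2 (p J).ψ‖) ∧
      (∀ J ψ, IsWeakProfile A U (R (J + 1)) ψ → ‖toL2 ψ‖ ≤ 2 * ‖toL2 (p J).ψ‖) := by
  -- The invariant of the recursion: the current remainder is weakly null in the frame of every
  -- profile already subtracted.
  let Inv : List Profile → Prop := fun L =>
    ∀ q ∈ L, WeakTendsto (U : Filter ℕ) (q.frame A (remainder A u L)) 0
  have hstep : ∀ L : {L : List Profile // Inv L}, ∃ p : Profile, Inv (p :: L.1) ∧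
      (IsStandardAlong U p.t ∧ IsStandardAlong U p.x) ∧
      WeakTendsto (U : Filter ℕ) (p.frame A (remainder A u L.1)) p.ψ ∧
      (∀ q ∈ L.1, Tendsto (p.gap q) U atTop) ∧
      (∀ ψ, IsWeakProfile A U (remainder A u L.1) ψ → ‖toL2 ψ‖ ≤ 2 * ‖toL2 p.ψ‖) := by
    rintro ⟨L, hL⟩
    obtain ⟨D, hD⟩ := h.exists_bound_remainder hu L
    obtain ⟨p, h1, h2, h3, h4, h6⟩ := h.exists_profile U hU hD L hL
    refine ⟨p, ?_, ⟨h1, h2⟩, h3, h4, h6⟩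
    intro q hq
    rcases List.mem_cons.1 hq with rfl | hq
    · exact h.weakTendsto_frame_sub_self h3
    · exact h.weakTendsto_frame_sub h5 (h4 q hq) (hL q hq)
  choose next hInv hstd hweak hgap hmax using hstep
  let st : ℕ → {L : List Profile // Inv L} := fun J =>
    Nat.rec ⟨[], fun q hq => absurd hq List.not_mem_nil⟩ (fun _ L => ⟨next L :: L.1, hInv L⟩) J
  have hst : ∀ J, (st (J + 1)).1 = next (st J) :: (st J).1 := fun J => rfl
  have hmem : ∀ j k, j < k → next (st j) ∈ (st k).1 := by
    intro j k hjk
    induction k with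
    | zero => omega
    | succ k ih =>
      rw [hst]
      rcases Nat.lt_succ_iff_lt_or_eq.1 hjk with h1 | rfl
      · exact List.mem_cons_of_mem _ (ih h1)
      · exact List.mem_cons_self
  refine ⟨fun J => next (st J), fun J => remainder A u (st J).1, fun n => rfl, fun J n => rfl,
    fun J => h.exists_bound_remainder hu _, fun j => hstd _, fun J => hweak _, fun j k hjk =>
    hgap _ _ (hmem j k hjk), fun J => hmax _, fun J ψ hψ => ?_⟩
  obtain ⟨D, hD⟩ := h.exists_bound_remainder hu (st J).1
  exact h.norm_isWeakProfile_sub h5 U hD (hweak (st J)) (hmax (st J)) hψ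

/-! ### The dispersive norm of the remainder -/

theorem linftyFlowNorm_le (h : Setup A B) : ∃ M : ℝ, 0 ≤ M ∧ ∀ v : H1,
    linftyFlowNorm A (toL2 v) ≤ ENNReal.ofReal (M * ‖v‖) := by
  obtain ⟨M, hM1, hM⟩ := h.exists_flow_bound
  refine ⟨2 * M, by linarith, fun v => essSup_le_of_ae_le _ (Eventually.of_forall fun t => ?_)⟩
  change eLpNorm (expI A (-t) (toL2 v) : L2) ⊤ volume ≤ _
  rw [← h.toL2_flow]
  refine (eLpNorm_top_le _).trans (ENNReal.ofReal_le_ofReal ?_)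
  have := (hM (-t) v).2
  linarith

/-- Optimization of the evaluation bound over the widths `δ = 1/(k+1)`; the best one is about `α/D`.
-/
theorem le_three_mul_sqrt {α D b : ℝ} (hα : 0 ≤ α) (hαD : α ≤ D) (hb : 0 < b)
    (h : ∀ k : ℕ, b ≤ √((k : ℝ) + 1) * α + (√((k : ℝ) + 1))⁻¹ * D) : b ≤ 3 * (√α * √D) := by
  rcases hα.eq_or_lt with rfl | hα
  · exfalso
    have h1 : Tendsto (fun k : ℕ => √((k : ℝ) + 1) * 0 + (√((k : ℝ) + 1))⁻¹ * D) atTop (𝓝 0) := by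
      have h2 : Tendsto (fun k : ℕ => √((k : ℝ) + 1)) atTop atTop :=
        Real.tendsto_sqrt_atTop.comp (tendsto_atTop_add_const_right _ 1 tendsto_natCast_atTop_atTop)
      simpa using h2.inv_tendsto_atTop.mul_const D
    exact absurd (ge_of_tendsto' h1 h) (not_le.2 hb)
  · have hD : 0 < D := hα.trans_le hαD
    -- Since `D / α ≥ 1`, the number `k + 1` lies between `D / α` and `4 D / α`, at the price of the
    -- factors 1 and 2.
    let k := ⌊D / α⌋₊
    have h1 : D / α < k + 1 := Nat.lt_floor_add_one _
    have h2 : (k : ℝ) ≤ D / α := Nat.floor_le (by positivity)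
    have h3 : 1 ≤ D / α := (one_le_div hα).2 hαD
    have e1 : √((k : ℝ) + 1) * α ≤ 2 * (√α * √D) := by
      have : √((k : ℝ) + 1) ≤ 2 * √(D / α) := by
        rw [← Real.sqrt_sq (by norm_num : (0 : ℝ) ≤ 2), ← Real.sqrt_mul (by norm_num)]
        exact Real.sqrt_le_sqrt (by linarith)
      calc √((k : ℝ) + 1) * α ≤ 2 * √(D / α) * α := by gcongr
        _ = 2 * (√α * √D) := by
          rw [Real.sqrt_div hD.le]
          have := Real.mul_self_sqrt hα.le
          have h0 : √α ≠ 0 := (Real.sqrt_pos.2 hα).ne'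
          field_simp
          nlinarith
    have e2 : (√((k : ℝ) + 1))⁻¹ * D ≤ √α * √D := by
      have : √(D / α) ≤ √((k : ℝ) + 1) := Real.sqrt_le_sqrt h1.le
      calc (√((k : ℝ) + 1))⁻¹ * D ≤ (√(D / α))⁻¹ * D := by gcongr
        _ = √α * √D := by
          rw [Real.sqrt_div hD.le, inv_div]
          have := Real.mul_self_sqrt hD.le
          have h0 : √D ≠ 0 := (Real.sqrt_pos.2 hD).ne'
          field_simp
          nlinarith
    linarith [h k]

/-- If the bound fails along `U`, recentre at times and points where the flow exceeds `b`. The weak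
limit keeps that value at 0, and the interpolation bound for it contradicts the choice of `b`. -/
theorem eventually_linftyFlowNorm_le (h : Setup A B) : ∃ M : ℝ, 1 ≤ M ∧
    ∀ (U : Ultrafilter ℕ) (R : ℕ → H1) (C a b : ℝ), (∀ᶠ n in U, ‖R n‖ ≤ C) →
      (∀ ψ, IsWeakProfile A U R ψ → ‖toL2 ψ‖ ≤ a) → 0 < b → 3 * (√a * √(M * C)) < b →
      ∀ᶠ n in U, linftyFlowNorm A (toL2 (R n)) ≤ ENNReal.ofReal b := by
  obtain ⟨M, hM1, hM⟩ := h.exists_push_pull_bound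
  refine ⟨M, hM1, fun U R C a b hR ha hb0 hb => ?_⟩
  by_contra hcon
  rw [← Ultrafilter.eventually_not] at hcon
  have hpick : ∀ n, ¬ linftyFlowNorm A (toL2 (R n)) ≤ ENNReal.ofReal b → ∃ t x : ℝ, ∀ k : ℕ,
      b ≤ ‖evL (((k : ℝ) + 1)⁻¹) (pull A t x (R n))‖ := by
    intro n hn
    have h1 : ∃ t : ℝ, ENNReal.ofReal b < eLpNorm (expI A (-t) (toL2 (R n)) : L2) ⊤ volume := by
      by_contra! hc
      exact hn (essSup_le_of_ae_le _ (Eventually.of_forall hc))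
    obtain ⟨t, ht⟩ := h1
    rw [← h.toL2_flow] at ht
    have h2 : ∃ᵐ x : ℝ, b < ‖toL2 (flow A (-t) (R n)) x‖ := by
      intro hc
      refine absurd ht (not_lt.2 ?_)
      rw [eLpNorm_exponent_top]
      exact eLpNormEssSup_le_of_ae_bound (hc.mono fun x hx => not_lt.1 hx)
    -- Only countably many widths are used, so one point `x` serves for all of them.
    have h3 : ∀ᵐ x : ℝ, ∀ k : ℕ, toL2 (flow A (-t) (R n)) x =
        evL (((k : ℝ) + 1)⁻¹) (translH1 (-x) (flow A (-t) (R n))) :=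
      ae_all_iff.2 fun k => eval_ae (by positivity) _
    obtain ⟨x, hx, hx'⟩ := (h2.and_eventually h3).exists
    refine ⟨t, x, fun k => ?_⟩
    rw [hx' k] at hx
    exact hx.le
  choose! t x htx using hpick
  obtain ⟨ψ, hψ⟩ := exists_weakTendsto U (w := fun n => pull A (t n) (x n) (R n)) (C := M * C)
    (hR.mono fun n hn => ((hM _ _ _).2).trans (mul_le_mul_of_nonneg_left hn (by linarith)))
  have hψC : ‖ψ‖ ≤ M * C := hψ.norm_le (hR.mono fun n hn =>
    ((hM _ _ _).2).trans (mul_le_mul_of_nonneg_left hn (by linarith)))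
  have hψa := ha ψ ⟨t, x, hψ⟩
  have hk : ∀ k : ℕ, b ≤ √((k : ℝ) + 1) * ‖toL2 ψ‖ + (√((k : ℝ) + 1))⁻¹ * (M * C) := by
    intro k
    have h1 : b ≤ ‖evL (((k : ℝ) + 1)⁻¹) ψ‖ :=
      ge_of_tendsto (hψ.dual (evL (((k : ℝ) + 1)⁻¹))).norm (hcon.mono fun n hn => htx n hn k)
    have h2 := norm_evL_le (δ := ((k : ℝ) + 1)⁻¹) (by positivity) ψ
    rw [Real.sqrt_inv, inv_inv] at h2
    have h3 : (√((k : ℝ) + 1))⁻¹ * ‖ψ‖ ≤ (√((k : ℝ) + 1))⁻¹ * (M * C) := by gcongr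
    linarith
  have h1 := le_three_mul_sqrt (norm_nonneg _) ((norm_toL2_le ψ).trans hψC) hb0 hk
  have h2 : √‖toL2 ψ‖ * √(M * C) ≤ √a * √(M * C) :=
    mul_le_mul_of_nonneg_right (Real.sqrt_le_sqrt hψa) (Real.sqrt_nonneg _)
  linarith

end Setup

/-! ### Extraction of subsequences -/

section Extract

/-- The property `P` of subsequences can be achieved by a countably generated condition which
holds along the ultrafilter `U`. -/
def Extractable (U : Ultrafilter ℕ) (P : (ℕ → ℕ) → Prop) : Prop :=
  ∃ G : Filter ℕ, G.IsCountablyGenerated ∧ (U : Filter ℕ) ≤ G ∧ ∀ φ, Tendsto φ atTop G → P φ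

variable {U : Ultrafilter ℕ}

theorem extractable_of_tendsto {X : Type*} {F : Filter X} [F.IsCountablyGenerated] {a : ℕ → X}
    (h : Tendsto a U F) : Extractable U fun φ => Tendsto (fun n => a (φ n)) atTop F :=
  ⟨comap a F, inferInstance, tendsto_iff_comap.1 h, fun _ hφ => tendsto_comap_iff.1 hφ⟩

theorem extractable_of_eventually {p : ℕ → Prop} (h : ∀ᶠ n in U, p n) :
    Extractable U fun φ => ∀ᶠ n in atTop, p (φ n) :=
  ⟨𝓟 {n | p n}, inferInstance, le_principal_iff.2 h, fun _ hφ => tendsto_principal.1 hφ⟩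

theorem Extractable.mono {P Q : (ℕ → ℕ) → Prop} (h : Extractable U P) (hPQ : ∀ φ, P φ → Q φ) :
    Extractable U Q := by
  obtain ⟨G, h1, h2, h3⟩ := h
  exact ⟨G, h1, h2, fun φ hφ => hPQ φ (h3 φ hφ)⟩

theorem Extractable.and {P Q : (ℕ → ℕ) → Prop} (h : Extractable U P) (h' : Extractable U Q) :
    Extractable U fun φ => P φ ∧ Q φ := by
  obtain ⟨G, h1, h2, h3⟩ := h
  obtain ⟨G', h1', h2', h3'⟩ := h'
  exact ⟨G ⊓ G', inferInstance, le_inf h2 h2', fun φ hφ =>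
    ⟨h3 φ (hφ.mono_right inf_le_left), h3' φ (hφ.mono_right inf_le_right)⟩⟩

theorem Extractable.forall {ι : Sort*} [Countable ι] {P : ι → (ℕ → ℕ) → Prop}
    (h : ∀ i, Extractable U (P i)) : Extractable U fun φ => ∀ i, P i φ := by
  choose G h1 h2 h3 using h
  exact ⟨⨅ i, G i, inferInstance, le_iInf h2, fun φ hφ i =>
    h3 i φ (hφ.mono_right (iInf_le G i))⟩

/-- The ultrafilter refines `G ⊓ atTop`, which is thus nontrivial; being countably generated, it is
the limit of some sequence. -/
theorem Extractable.exists (hU : (U : Filter ℕ) ≤ atTop) {P : (ℕ → ℕ) → Prop}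
    (h : Extractable U P) : ∃ φ, StrictMono φ ∧ P φ := by
  obtain ⟨G, h1, h2, h3⟩ := h
  have hne : (G ⊓ atTop).NeBot := neBot_of_le (le_inf h2 hU)
  obtain ⟨φ, hφ⟩ := exists_seq_tendsto (G ⊓ atTop)
  obtain ⟨κ, hκ, hκ'⟩ := strictMono_subseq_of_tendsto_atTop (hφ.mono_right inf_le_right)
  exact ⟨φ ∘ κ, hκ', h3 _ ((hφ.mono_right inf_le_left).comp hκ.tendsto_atTop)⟩

theorem IsStandardAlong.extractable {t : ℕ → ℝ} (h : IsStandardAlong U t) :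
    Extractable U fun φ => IsStandard fun n => t (φ n) := by
  rcases h with h | h | h
  · exact (extractable_of_tendsto h).mono fun φ hφ => Or.inl hφ
  · exact (extractable_of_tendsto h).mono fun φ hφ => Or.inr (Or.inl hφ)
  · exact ⟨⊤, inferInstance, le_top, fun φ _ => Or.inr (Or.inr fun n => h _)⟩

end Extract

/-! ### The energy -/

/-- The quadratic form `(Av, v) + c ‖v‖²`. -/
def energy (B : H1 →L[ℂ] Hneg1) (c : ℝ) (v : H1) : ℝ := (B v v).re + c * ‖toL2 v‖ ^ 2

/-- The cross term of the energy. -/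
def crossEnergy (B : H1 →L[ℂ] Hneg1) (c : ℝ) (v w : H1) : ℝ :=
  (B v w).re + c * (inner ℂ (toL2 w) (toL2 v)).re

theorem IsStandard.tendsto_abs {t : ℕ → ℝ} (h : IsStandard t) :
    Tendsto (fun n => |t n|) atTop atTop ∨ ∀ n, t n = 0 := by
  rcases h with h | h | h
  · exact Or.inl (tendsto_abs_atTop_atTop.comp h)
  · exact Or.inl (tendsto_abs_atBot_atTop.comp h)
  · exact Or.inr h

namespace Setup

variable {A : L2 →ₗ.[ℂ] L2} {B : H1 →L[ℂ] Hneg1} {r : ℝ≥0∞} [Fact (1 ≤ r)]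

theorem energy_sub (h : Setup A B) (c : ℝ) (v w : H1) :
    energy B c (v - w) = energy B c v + energy B c w - 2 * crossEnergy B c w v := by
  have h1 : (B v w).re = (B w v).re := by rw [h.hermitian v w, Complex.conj_re]
  have h2 := @norm_sub_sq ℂ _ _ _ _ (toL2 v) (toL2 w)
  simp only [RCLike.re_to_complex] at h2
  simp only [energy, crossEnergy, map_sub, sub_apply, Complex.sub_re]
  rw [← map_sub, map_sub, h2, h1]
  ring

theorem energy_push (h : Setup A B) (c t x : ℝ) (ψ : H1) :
    energy B c (push A t x ψ) = energy B c (translH1 x ψ) := by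
  rw [energy, energy, h.form_push_self, h.norm_toL2_push, toL2_translH1, LinearIsometry.norm_map]

theorem tendsto_crossEnergy (_h : Setup A B) (c : ℝ) {ι : Type*} {l : Filter ι} {w : ι → H1}
    (hw : WeakTendsto l w 0) (f : H1) :
    Tendsto (fun i => crossEnergy B c (w i) f) l (𝓝 0) := by
  have h1 := hw.dual (B.flip f)
  have h2 := (hw.map toL2L) (toL2 f)
  rw [map_zero] at h1 h2
  rw [inner_zero_right] at h2
  have h3 := ((Complex.continuous_re.tendsto _).comp h1).add
    (((Complex.continuous_re.tendsto _).comp h2).const_mul c)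
  simp only [Complex.zero_re, mul_zero, add_zero] at h3
  exact h3

/-- Modification of finitely many parameters of each profile, so that all the remainders are
bounded in energy, uniformly in the number of profiles. -/
theorem exists_bounded_remainder (h : Setup A B) (h5 : A5 A r) {c m M₁ : ℝ} (hm : 0 < m) (hM₁ : 0 ≤ M₁)
    (hE : ∀ v : H1, m * ‖v‖ ^ 2 ≤ energy B c v ∧ energy B c v ≤ M₁ * ‖v‖ ^ 2)
    (p : ℕ → Profile) (R : ℕ → ℕ → H1)
    (hR : ∀ J n, R (J + 1) n = R J n - (p J).bub A n)
    (hstd : ∀ j, IsStandard (p j).t ∧ IsStandard (p j).x)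
    (horth : ∀ j k, j < k → Tendsto ((p k).gap (p j)) atTop atTop)
    {K S : ℝ} (hK : 0 < K) (hK0 : ∀ n, energy B c (R 0 n) ≤ K)
    (hKJ : ∀ J, ∀ᶠ n in atTop, energy B c (R J n) ≤ K)
    (hS : ∀ J, ∑ j ∈ Finset.range J, energy B c ((p j).ψ) ≤ S) :
    ∃ (t' x' : ℕ → ℕ → ℝ) (R' : ℕ → ℕ → H1),
      (∀ j, IsStandard (t' j) ∧ IsStandard (x' j)) ∧
      (∀ j, ∀ᶠ n in atTop, t' j n = (p j).t n ∧ x' j n = (p j).x n) ∧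
      (∀ n, R' 0 n = R 0 n) ∧
      (∀ J n, R' (J + 1) n = R' J n - push A (t' J n) (x' J n) (p J).ψ) ∧
      (∀ J, ∀ᶠ n in atTop, R' J n = R J n) ∧
      (∀ J n, energy B c (R' J n) ≤ 2 * (2 * K + M₁ / m * S)) := by
  classical
  have hE0 : ∀ v, 0 ≤ energy B c v := fun v => le_trans (by positivity) (hE v).1
  have hpush : ∀ x ψ, energy B c (translH1 x ψ) ≤ M₁ / m * energy B c ψ := by
    intro x ψ
    refine ((hE _).2).trans ?_
    rw [LinearIsometry.norm_map, div_mul_eq_mul_div, le_div_iff₀ hm]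
    nlinarith [(hE ψ).1]
  -- The bound includes `J + 1`, so that when `Q J n` holds the remainder produced by step `J` also
  -- obeys it. Since `Q` is inherited by smaller `J`, nothing has been modified before.
  let Q : ℕ → ℕ → Prop := fun J n => ∀ J' ≤ J + 1, energy B c (R J' n) ≤ K
  have hQ : ∀ J, ∀ᶠ n in atTop, Q J n := by
    intro J
    have : ∀ᶠ n in atTop, ∀ J' ∈ Finset.range (J + 2), energy B c (R J' n) ≤ K :=
      (Filter.eventually_all_finset _).2 fun J' _ => hKJ J'
    exact this.mono fun n hn J' hJ' => hn J' (Finset.mem_range.2 (by omega))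
  let Exc : ℕ → Prop := fun J => (∀ n, (p J).t n = 0) ∧ ∀ n, (p J).x n = 0
  -- A profile with all parameters 0 cannot be made almost orthogonal to anything, but divergence of
  -- the gaps allows at most one.
  have hexc : ∀ j k, j < k → Exc k → ¬ Exc j := by
    intro j k hjk hk hj
    have h1 : (p k).gap (p j) = fun _ => 0 := by
      funext n
      simp [Profile.gap, hk.1, hk.2, hj.1, hj.2]
    have h2 := horth j k hjk
    rw [h1] at h2
    exact not_tendsto_const_atTop _ _ h2
  -- Any other moving profile is weakly null, so some index makes its cross term with the given `f`
  -- as small as desired; the geometric bounds have a finite sum over `J`.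
  have hsmall : ∀ J f, ¬ Exc J → ∃ k, |2 * crossEnergy B c ((p J).bub A k) f| ≤
      K * (1 / 2) ^ (J + 1) := by
    intro J f hJ
    have hd : Tendsto (fun n => |(p J).t n| + |(p J).x n|) atTop atTop := by
      rcases (hstd J).1.tendsto_abs with ht | ht
      · exact tendsto_atTop_mono (fun n => by linarith [abs_nonneg ((p J).x n)]) ht
      · rcases (hstd J).2.tendsto_abs with hx | hx
        · exact tendsto_atTop_mono (fun n => by linarith [abs_nonneg ((p J).t n)]) hx
        · exact absurd ⟨ht, hx⟩ hJ
    have h1 := ((h.tendsto_crossEnergy c (h.weakTendsto_push h5 (p J).ψ hd) f).const_mul 2).abs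
    rw [mul_zero, abs_zero] at h1
    obtain ⟨k, hk⟩ := ((tendsto_order.1 h1).2 (K * (1 / 2) ^ (J + 1)) (by positivity)).exists
    exact ⟨k, hk.le⟩
  -- The index depends on the current remainder `f`, so parameters and remainders are built
  -- together. For fixed `J`, only finitely many `n` are affected.
  let pick : ℕ → ℕ → H1 → ℕ := fun J n f =>
    if Q J n then n else if hJ : Exc J then n else (hsmall J f hJ).choose
  let R' : ℕ → ℕ → H1 := fun J n =>
    Nat.rec (R 0 n) (fun J f => f - (p J).bub A (pick J n f)) J
  have hR' : ∀ J n, R' (J + 1) n = R' J n - (p J).bub A (pick J n (R' J n)) := fun J n => rfl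
  have heq : ∀ J n, (∀ J' < J, Q J' n) → R' J n = R J n := by
    intro J n
    induction J with
    | zero => intro _; rfl
    | succ J ih =>
      intro hq
      rw [hR', hR, ih fun J' hJ' => hq J' (by omega)]
      simp only [pick, if_pos (hq J (by omega))]
  refine ⟨fun J n => (p J).t (pick J n (R' J n)), fun J n => (p J).x (pick J n (R' J n)), R',
    ?_, ?_, fun n => rfl, hR', ?_, ?_⟩
  · have hcongr : ∀ J (a : ℕ → ℝ), IsStandard a → IsStandard fun n => a (pick J n (R' J n)) := by
      intro J a ha
      have he : (fun n => a n) =ᶠ[atTop] fun n => a (pick J n (R' J n)) :=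
        (hQ J).mono fun n hn => by simp only [pick, if_pos hn]
      rcases ha with ha | ha | ha
      · exact Or.inl (ha.congr' he)
      · exact Or.inr (Or.inl (ha.congr' he))
      · exact Or.inr (Or.inr fun n => ha _)
    exact fun j => ⟨hcongr j _ (hstd j).1, hcongr j _ (hstd j).2⟩
  · intro j
    exact (hQ j).mono fun n hn => by simp only [pick, if_pos hn, and_self]
  · intro J
    have : ∀ᶠ n in atTop, ∀ J' ∈ Finset.range J, Q J' n :=
      (Filter.eventually_all_finset _).2 fun J' _ => hQ J'
    exact this.mono fun n hn => heq J n fun J' hJ' => hn J' (Finset.mem_range.2 hJ')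
  -- The exceptional profile is subtracted by the parallelogram inequality, which doubles the bound;
  -- this happens at most once.
  · let fac : ℕ → ℝ := fun J => if ∃ j < J, Exc j then 2 else 1
    have hfac1 : ∀ J, 1 ≤ fac J := fun J => by simp only [fac]; split_ifs <;> norm_num
    have hfac2 : ∀ J, fac J ≤ 2 := fun J => by simp only [fac]; split_ifs <;> norm_num
    have hfacm : ∀ J, fac J ≤ fac (J + 1) := by
      intro J
      simp only [fac]
      split_ifs with h1 h2
      · exact le_rfl
      · obtain ⟨j, hj, hj'⟩ := h1
        exact absurd ⟨j, by omega, hj'⟩ h2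
      · norm_num
      · exact le_rfl
    have hMm : ∀ v, 0 ≤ M₁ / m * energy B c v := fun v =>
      (hE0 (translH1 0 v)).trans (hpush 0 v)
    have hind : ∀ J n, energy B c (R' J n) ≤ fac J * (K * (2 - (1 / 2) ^ J) +
        M₁ / m * ∑ j ∈ Finset.range J, energy B c ((p j).ψ)) := by
      intro J n
      have hpos : ∀ J, 0 ≤ M₁ / m * ∑ j ∈ Finset.range J, energy B c ((p j).ψ) := fun J => by
        rw [Finset.mul_sum]; exact Finset.sum_nonneg fun j _ => hMm _
      have hhalf : ∀ J : ℕ, K ≤ K * (2 - (1 / 2) ^ J) := by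
        intro J
        have : (1 / 2 : ℝ) ^ J ≤ 1 := pow_le_one₀ (by norm_num) (by norm_num)
        nlinarith
      induction J with
      | zero =>
        have h1 := hK0 n
        have h2 : fac 0 = 1 := by simp [fac]
        rw [h2]
        simpa [R'] using h1.trans (by linarith : K ≤ K * (2 - 1))
      | succ J ih =>
        by_cases hq : Q J n
        · have h1 : R' (J + 1) n = R (J + 1) n :=
            heq (J + 1) n fun J' hJ' J'' hJ'' => hq J'' (by omega)
          rw [h1]
          have h2 := hq (J + 1) le_rfl
          have h3 := hfac1 (J + 1)
          have h4 := hpos (J + 1)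
          have h6 := hhalf (J + 1)
          nlinarith
        · have hb : energy B c ((p J).bub A (pick J n (R' J n))) ≤
              M₁ / m * energy B c ((p J).ψ) := by
            rw [Profile.bub, h.energy_push]
            exact hpush _ _
          have hsum : M₁ / m * ∑ j ∈ Finset.range (J + 1), energy B c ((p j).ψ) =
              M₁ / m * ∑ j ∈ Finset.range J, energy B c ((p j).ψ) +
                M₁ / m * energy B c ((p J).ψ) := by
            rw [Finset.sum_range_succ, mul_add]
          have hpow : K * (2 - (1 / 2 : ℝ) ^ (J + 1)) =
              K * (2 - (1 / 2) ^ J) + K * (1 / 2) ^ (J + 1) := by ring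
          have hkp : 0 ≤ K * (1 / 2 : ℝ) ^ (J + 1) := by positivity
          have hX : 0 ≤ K * (2 - (1 / 2) ^ J) +
              M₁ / m * ∑ j ∈ Finset.range J, energy B c ((p j).ψ) := by
            linarith [hpos J, hhalf J]
          have hY := hMm ((p J).ψ)
          by_cases hJ : Exc J
          · have h1 : fac J = 1 := by
              simp only [fac]
              rw [if_neg]
              rintro ⟨j, hj, hj'⟩
              exact hexc j J hj hJ hj'
            have h2 : fac (J + 1) = 2 := by
              simp only [fac]
              exact if_pos ⟨J, by omega, hJ⟩
            rw [h1, one_mul] at ih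
            have hneg : ∀ v w, energy B c (v - w) ≤ 2 * energy B c v + 2 * energy B c w := by
              intro v w
              have e1 := h.energy_sub c v w
              have e2 := h.energy_sub c v (-w)
              have e3 : energy B c (-w) = energy B c w := by simp [energy]
              have e4 : crossEnergy B c (-w) v = - crossEnergy B c w v := by
                simp [crossEnergy]; ring
              rw [e3, e4] at e2
              linarith [hE0 (v - -w)]
            rw [h2, hR', hsum, hpow]
            refine (hneg _ _).trans ?_
            linarith
          · have hcross : |2 * crossEnergy B c ((p J).bub A (pick J n (R' J n))) (R' J n)| ≤
                K * (1 / 2) ^ (J + 1) := by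
              simp only [pick, if_neg hq, dif_neg hJ]
              exact (hsmall J (R' J n) hJ).choose_spec
            have h1 : energy B c (R' (J + 1) n) ≤ energy B c (R' J n) +
                M₁ / m * energy B c ((p J).ψ) + K * (1 / 2) ^ (J + 1) := by
              rw [hR', h.energy_sub]
              linarith [neg_abs_le (2 * crossEnergy B c ((p J).bub A (pick J n (R' J n))) (R' J n))]
            refine h1.trans ?_
            rw [hsum, hpow]
            have h2 := hfacm J
            have h3 := hfac1 (J + 1)
            have h4 : fac J * (K * (2 - (1 / 2) ^ J) +
                M₁ / m * ∑ j ∈ Finset.range J, energy B c ((p j).ψ)) ≤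
                fac (J + 1) * (K * (2 - (1 / 2) ^ J) +
                M₁ / m * ∑ j ∈ Finset.range J, energy B c ((p j).ψ)) := by gcongr
            nlinarith
    intro J n
    refine (hind J n).trans ?_
    have h1 : K * (2 - (1 / 2 : ℝ) ^ J) ≤ 2 * K := by
      have : (0 : ℝ) < (1 / 2) ^ J := by positivity
      nlinarith
    have hfrac : 0 ≤ M₁ / m := div_nonneg hM₁ hm.le
    have h2 : M₁ / m * ∑ j ∈ Finset.range J, energy B c ((p j).ψ) ≤ M₁ / m * S :=
      mul_le_mul_of_nonneg_left (hS J) hfrac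
    have h3 : 0 ≤ K * (2 - (1 / 2 : ℝ) ^ J) +
        M₁ / m * ∑ j ∈ Finset.range J, energy B c ((p j).ψ) := by
      have := (hE0 (R' J n)).trans (hind J n)
      exact nonneg_of_mul_nonneg_right this (by linarith [hfac1 J])
    nlinarith [hfac2 J]

end Setup

/-! ### The profile decomposition -/

/-- The conclusion of the profile decomposition theorem for the sequence `u`. -/
def HasProfileDecomposition (A : L2 →ₗ.[ℂ] L2) (B : H1 →L[ℂ] Hneg1) (r : ℝ≥0∞) (C : ℝ)
    (u : ℕ → H1) : Prop :=
  ∃ (φ : ℕ → ℕ) (ψ : ℕ → H1) (t x : ℕ → ℕ → ℝ) (R : ℕ → ℕ → H1),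
    StrictMono φ ∧
    (∀ j, 1 ≤ j → IsStandard (t j) ∧ IsStandard (x j)) ∧
    (∀ J, 1 ≤ J → ∀ n, toL2 (u (φ n)) =
      (∑ j ∈ Finset.Icc 1 J, bubble A (t j n) (x j n) (ψ j)) + toL2 (R J n)) ∧
    (∀ j k, 1 ≤ j → 1 ≤ k → j ≠ k →
      Tendsto (fun n => |t j n - t k n| + |x j n - x k n|) atTop atTop) ∧
    (∀ J, 1 ≤ J → limsup (fun n => linftyFlowNorm A (toL2 (R J n))) atTop ≤
      ENNReal.ofReal (C * (√‖toL2 (ψ J)‖ * √(⨆ n, ‖u (φ n)‖)))) ∧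
    Tendsto (fun J => √‖toL2 (ψ J)‖ * √(⨆ n, ‖u (φ n)‖)) atTop (𝓝 0) ∧
    Tendsto (fun J => limsup (fun n => linftyFlowNorm A (toL2 (R J n))) atTop)
      atTop (𝓝 0) ∧
    (∀ J, 1 ≤ J →
      Tendsto (fun n => ‖toL2 (u (φ n))‖ ^ 2 -
        ((∑ j ∈ Finset.Icc 1 J, ‖toL2 (ψ j)‖ ^ 2) + ‖toL2 (R J n)‖ ^ 2)) atTop (𝓝 0) ∧
      Tendsto (fun n => B (u (φ n)) (u (φ n)) -
        ((∑ j ∈ Finset.Icc 1 J, B (translH1 (x j n) (ψ j)) (translH1 (x j n) (ψ j))) +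
          B (R J n) (R J n))) atTop (𝓝 0) ∧
      Tendsto (fun n => lrNormPow r (toL2 (u (φ n))) -
        ((∑ j ∈ Finset.Icc 1 J, lrNormPow r (bubble A (t j n) (x j n) (ψ j))) +
          lrNormPow r (toL2 (R J n)))) atTop (𝓝 0)) ∧
    (∀ J, 1 ≤ J → ψ J = 0 → ∀ j, J ≤ j → ψ j = 0) ∧
    (∀ j J n, 1 ≤ j → 1 ≤ J → ‖ψ j‖ + ‖R J n‖ ≤ C * ⨆ m, ‖u (φ m)‖)

theorem sum_Icc_one_sub_one {X : Type*} [AddCommMonoid X] (f : ℕ → X) (J : ℕ) :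
    ∑ j ∈ Finset.Icc 1 J, f (j - 1) = ∑ j ∈ Finset.range J, f j := by
  induction J with
  | zero => simp
  | succ J ih =>
    rw [Finset.sum_Icc_succ_top (by omega), ih, Finset.sum_range_succ, Nat.add_sub_cancel]

theorem tendsto_telescope {X ι : Type*} [AddCommGroup X] [TopologicalSpace X]
    [IsTopologicalAddGroup X] {l : Filter ι} {f b : ℕ → ι → X}
    (h : ∀ J, Tendsto (fun n => f J n - (b J n + f (J + 1) n)) l (𝓝 0)) (J : ℕ) :
    Tendsto (fun n => f 0 n - ((∑ j ∈ Finset.range J, b j n) + f J n)) l (𝓝 0) := by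
  induction J with
  | zero => simpa using tendsto_const_nhds
  | succ J ih =>
    have h1 := ih.add (h J)
    rw [add_zero] at h1
    refine h1.congr fun n => ?_
    rw [Finset.sum_range_succ]
    abel

namespace Setup

variable {A : L2 →ₗ.[ℂ] L2} {B : H1 →L[ℂ] Hneg1} {r : ℝ≥0∞}

/-- The profiles of a sequence with a strongly null subsequence vanish. -/
theorem hasProfileDecomposition_of_tendsto_zero (h : Setup A B) (hr : 2 < r) (hr' : r ≠ ⊤) {C : ℝ}
    (hC : 1 ≤ C) {u : ℕ → H1} {D : ℝ} (hu : ∀ n, ‖u n‖ ≤ D) {φ : ℕ → ℕ} (hφ : StrictMono φ)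
    (h0 : Tendsto (fun n => ‖u (φ n)‖) atTop (𝓝 0)) : HasProfileDecomposition A B r C u := by
  obtain ⟨M, hM0, hM⟩ := h.linftyFlowNorm_le
  have hlim : limsup (fun n => linftyFlowNorm A (toL2 (u (φ n)))) atTop = 0 := by
    refine Tendsto.limsup_eq ?_
    have h1 : Tendsto (fun n => ENNReal.ofReal (M * ‖u (φ n)‖)) atTop (𝓝 0) := by
      have := ENNReal.tendsto_ofReal (h0.const_mul M)
      simpa using this
    exact tendsto_of_tendsto_of_tendsto_of_le_of_le tendsto_const_nhds h1 (fun _ => zero_le)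
      fun n => hM _
  have hbub : ∀ t x : ℝ, bubble A t x 0 = 0 := by intro t x; simp [bubble]
  have hlr : lrNormPow r (0 : L2) = 0 := by
    have hρ := two_lt_toReal hr hr'
    rw [lrNormPow, eLpNorm_congr_ae (Lp.coeFn_zero ℂ 2 volume), eLpNorm_zero, ENNReal.toReal_zero,
      Real.zero_rpow (by linarith)]
  have hσ : ∀ n, ‖u (φ n)‖ ≤ ⨆ m, ‖u (φ m)‖ := fun n =>
    le_ciSup (f := fun m => ‖u (φ m)‖) ⟨D, by rintro _ ⟨m, rfl⟩; exact hu _⟩ n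
  -- The profiles vanish, so the parameters need only be standard and divergent from each other; the
  -- times `j n` with `j ≥ 1` are.
  refine ⟨φ, fun _ => 0, fun j n => j * n, fun _ _ => 0, fun _ n => u (φ n), hφ, ?_, ?_, ?_, ?_, ?_,
    ?_, ?_, ?_, ?_⟩
  · intro j hj
    refine ⟨Or.inl ?_, Or.inr (Or.inr fun _ => rfl)⟩
    exact tendsto_natCast_atTop_atTop.const_mul_atTop (by exact_mod_cast hj)
  · intro J _ n
    simp [hbub]
  · intro j k _ _ hjk
    have h1 : (0 : ℝ) < |(j : ℝ) - k| := abs_pos.2 (sub_ne_zero.2 (by exact_mod_cast hjk))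
    refine (tendsto_natCast_atTop_atTop.const_mul_atTop h1).congr fun n => ?_
    rw [← sub_mul, abs_mul, Nat.abs_cast]
    simp
  · intro J _
    rw [hlim]; exact zero_le
  · simp
  · simp only [hlim]; exact tendsto_const_nhds
  · intro J _
    refine ⟨?_, ?_, ?_⟩
    · simp
    · simp
    · simp [hbub, hlr]
  · intro J _ _ j _; rfl
  · intro j J n _ _
    rw [norm_zero, zero_add]
    have := (norm_nonneg _).trans (hσ n)
    nlinarith [hσ n]

/-- Decoupling of form and mass, iterated; the energy of each translated profile is at least `m
‖ψ_j‖²`. This bounds the sum of all profiles and every remainder, independently of `J`. -/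
theorem eventually_energy_le (h : Setup A B) {U : Ultrafilter ℕ} {c m M₁ ℓ : ℝ}
    (hE : ∀ v : H1, m * ‖v‖ ^ 2 ≤ energy B c v ∧ energy B c v ≤ M₁ * ‖v‖ ^ 2)
    {p : ℕ → Profile} {R : ℕ → ℕ → H1}
    (hR : ∀ J n, R (J + 1) n = R J n - (p J).bub A n) (hb : ∀ J, ∃ D, ∀ n, ‖R J n‖ ≤ D)
    (hw : ∀ J, WeakTendsto (U : Filter ℕ) ((p J).frame A (R J)) (p J).ψ)
    (hℓ : Tendsto (fun n => ‖R 0 n‖) U (𝓝 ℓ)) (J : ℕ) : ∀ ε : ℝ, 0 < ε → ∀ᶠ n in U,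
      m * ∑ j ∈ Finset.range J, ‖(p j).ψ‖ ^ 2 + energy B c (R J n) ≤ M₁ * ℓ ^ 2 + ε := by
  induction J with
  | zero =>
    intro ε hε
    have h1 := (hℓ.pow 2).const_mul M₁
    filter_upwards [(tendsto_order.1 h1).2 (M₁ * ℓ ^ 2 + ε) (by linarith)] with n hn
    simp only [Finset.range_zero, Finset.sum_empty, mul_zero, zero_add]
    exact ((hE _).2).trans hn.le
  | succ J ih =>
    intro ε hε
    obtain ⟨D, hD⟩ := hb J
    have h1 := (Complex.continuous_re.tendsto _).comp
      (h.tendsto_form (Eventually.of_forall hD) (hw J))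
    have h2 := (h.tendsto_norm_sq (hw J)).const_mul c
    have h3 := h1.add h2
    simp only [Complex.zero_re, mul_zero, add_zero] at h3
    filter_upwards [ih (ε / 2) (half_pos hε),
      (tendsto_order.1 h3).1 (-(ε / 2)) (by linarith)] with n hn hn'
    have h4 : m * ‖(p J).ψ‖ ^ 2 ≤ energy B c (translH1 ((p J).x n) (p J).ψ) := by
      have := (hE (translH1 ((p J).x n) (p J).ψ)).1
      rwa [LinearIsometry.norm_map] at this
    rw [energy, toL2_translH1, LinearIsometry.norm_map] at h4
    rw [Finset.sum_range_succ, mul_add, hR]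
    simp only [Function.comp, Complex.sub_re, Complex.add_re] at hn'
    rw [energy] at hn ⊢
    rw [Profile.bub]
    linarith

/-- The profile decomposition theorem. -/
theorem exists_hasProfileDecomposition [Fact (1 ≤ r)] (h : Setup A B) (h5 : A5 A r) (hr : 2 < r) (hr' : r ≠ ⊤) :
    ∃ C : ℝ, 0 < C ∧ ∀ u : ℕ → H1, (∃ M : ℝ, ∀ n, ‖u n‖ ≤ M) →
      HasProfileDecomposition A B r C u := by
  obtain ⟨c, hc, m, hm, M₁, hM₁, hE⟩ := h.exists_equiv
  replace hE : ∀ v : H1, m * ‖v‖ ^ 2 ≤ energy B c v ∧ energy B c v ≤ M₁ * ‖v‖ ^ 2 := hE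
  obtain ⟨M, hM1, hM⟩ := h.eventually_linftyFlowNorm_le
  -- `D` bounds the remainders along the ultrafilter, `C₁` comes from the dispersive norm, `C₂` from
  -- a single profile, and `C₃` from the modified remainders; the summand 1 serves the case of a
  -- strongly null subsequence.
  let D : ℝ := √(2 * M₁ / m)
  let C₁ : ℝ := 3 * (√2 * √(M * D))
  let C₂ : ℝ := √(M₁ / m)
  let C₃ : ℝ := √(2 * (2 * (2 * M₁) + M₁ / m * (M₁ * (M₁ / m))) / m)
  have hC₁ : 0 ≤ C₁ := by positivity
  have hC₂ : 0 ≤ C₂ := by positivity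
  have hC₃ : 0 ≤ C₃ := by positivity
  refine ⟨1 + C₁ + C₂ + C₃, by positivity, fun u ⟨D₀, hu⟩ => ?_⟩
  let U : Ultrafilter ℕ := hyperfilter ℕ
  have hU : (U : Filter ℕ) ≤ atTop := Nat.hyperfilter_le_atTop
  obtain ⟨ℓ, hℓ⟩ := U.exists_tendsto_of_abs_le (f := fun n => ‖u n‖) (N := D₀)
    (Eventually.of_forall fun n => by rw [abs_norm]; exact hu n)
  have hℓ0 : 0 ≤ ℓ := ge_of_tendsto' hℓ fun n => norm_nonneg _
  -- For `ℓ > 0` the error terms can be absorbed into multiples of `ℓ`; for `ℓ = 0` there is no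
  -- room, but a subsequence is strongly null.
  rcases hℓ0.eq_or_lt with rfl | hℓpos
  · obtain ⟨φ, hφ, hlim⟩ := (extractable_of_tendsto hℓ).exists hU
    exact h.hasProfileDecomposition_of_tendsto_zero hr hr' (by linarith) hu hφ hlim
  obtain ⟨p, R, hR0, hR, hb, hstd, hw, hgap, hmax, hmax'⟩ := h.exists_profiles h5 U hU hu
  have hA := h.eventually_energy_le hE hR hb hw (by simpa only [hR0] using hℓ)
  have hE0 : ∀ v, 0 ≤ energy B c v := fun v => le_trans (by positivity) (hE v).1
  have hsum : ∀ J, ∑ j ∈ Finset.range J, ‖(p j).ψ‖ ^ 2 ≤ M₁ / m * ℓ ^ 2 := by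
    intro J
    rw [div_mul_eq_mul_div, le_div_iff₀ hm]
    refine le_of_forall_pos_le_add fun ε hε => ?_
    obtain ⟨n, hn⟩ := (hA J ε hε).exists
    linarith [hE0 (R J n)]
  have hRE : ∀ J, ∀ᶠ n in U, energy B c (R J n) ≤ 2 * M₁ * ℓ ^ 2 := by
    intro J
    filter_upwards [hA J (M₁ * ℓ ^ 2) (by positivity)] with n hn
    have : 0 ≤ m * ∑ j ∈ Finset.range J, ‖(p j).ψ‖ ^ 2 := by positivity
    linarith
  have hRD : ∀ J, ∀ᶠ n in U, ‖R J n‖ ≤ D * ℓ := by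
    intro J
    filter_upwards [hRE J] with n hn
    have h1 : ‖R J n‖ ^ 2 ≤ 2 * M₁ / m * ℓ ^ 2 := by
      rw [div_mul_eq_mul_div, le_div_iff₀ hm]
      linarith [(hE (R J n)).1]
    refine (Real.le_sqrt_of_sq_le h1).trans (le_of_eq ?_)
    rw [Real.sqrt_mul (by positivity), Real.sqrt_sq hℓ0]
  -- The term `1 / (k + 1)` provides the strict inequality; countably many `k` can be kept in the
  -- extraction, and `k → ∞` removes it afterwards.
  have hL : ∀ J (k : ℕ), ∀ᶠ n in U, linftyFlowNorm A (toL2 (R (J + 1) n)) ≤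
      ENNReal.ofReal (C₁ * (√‖toL2 (p J).ψ‖ * √ℓ) + 1 / ((k : ℝ) + 1)) := by
    intro J k
    refine hM U (R (J + 1)) (D * ℓ) (2 * ‖toL2 (p J).ψ‖) _ (hRD (J + 1)) (hmax' J)
      (by positivity) ?_
    have e : 3 * (√(2 * ‖toL2 (p J).ψ‖) * √(M * (D * ℓ))) = C₁ * (√‖toL2 (p J).ψ‖ * √ℓ) := by
      rw [Real.sqrt_mul (by norm_num), ← mul_assoc M, Real.sqrt_mul (by positivity)]
      simp only [C₁]
      ring
    rw [e]
    have : 0 < 1 / ((k : ℝ) + 1) := by positivity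
    linarith
  have hstdt : ∀ J, Tendsto (fun n => |(p J).t n|) U atTop ∨ ∀ n, (p J).t n = 0 := by
    intro J
    rcases (hstd J).1 with ht | ht | ht
    · exact Or.inl (tendsto_abs_atTop_atTop.comp ht)
    · exact Or.inl (tendsto_abs_atBot_atTop.comp ht)
    · exact Or.inr ht
  have hc1 := fun J => tendsto_telescope (l := (U : Filter ℕ))
    (f := fun J n => ‖toL2 (R J n)‖ ^ 2) (b := fun J _ => ‖toL2 (p J).ψ‖ ^ 2)
    (fun J => by
      simp only [hR]
      exact h.tendsto_norm_sq (hw J)) J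
  have hc2 := fun J => tendsto_telescope (l := (U : Filter ℕ)) (f := fun J n => B (R J n) (R J n))
    (b := fun J n => B (translH1 ((p J).x n) (p J).ψ) (translH1 ((p J).x n) (p J).ψ))
    (fun J => by
      simp only [hR]
      obtain ⟨D', hD'⟩ := hb J
      exact h.tendsto_form (Eventually.of_forall hD') (hw J)) J
  have hc3 := fun J => tendsto_telescope (l := (U : Filter ℕ))
    (f := fun J n => lrNormPow r (toL2 (R J n)))
    (b := fun J n => lrNormPow r (bubble A ((p J).t n) ((p J).x n) (p J).ψ))
    (fun J => by
      simp only [hR, ← h.toL2_push]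
      obtain ⟨D', hD'⟩ := hb J
      exact h.tendsto_lrNormPow h5 hr hr' U (hstdt J) (Eventually.of_forall hD') (hw J)) J
  obtain ⟨φ, hφ, hxℓ, hxstd, hxgap, hxE, hxL, hx1, hx2, hx3⟩ :=
    ((extractable_of_tendsto hℓ).and
    ((Extractable.forall fun j => (hstd j).1.extractable.and (hstd j).2.extractable).and
    ((Extractable.forall fun j => Extractable.forall fun k => Extractable.forall fun hjk : j < k =>
      extractable_of_tendsto (hgap j k hjk)).and
    ((Extractable.forall fun J => extractable_of_eventually (hRE J)).and
    ((Extractable.forall fun J => Extractable.forall fun k =>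
      extractable_of_eventually (hL J k)).and
    ((Extractable.forall fun J => extractable_of_tendsto (hc1 J)).and
    ((Extractable.forall fun J => extractable_of_tendsto (hc2 J)).and
    (Extractable.forall fun J => extractable_of_tendsto (hc3 J))))))))).exists hU
  set σ : ℝ := ⨆ n, ‖u (φ n)‖ with hσdef
  have hσ : ∀ n, ‖u (φ n)‖ ≤ σ := fun n =>
    le_ciSup (f := fun m => ‖u (φ m)‖) ⟨D₀, by rintro _ ⟨m, rfl⟩; exact hu _⟩ n
  have hℓσ : ℓ ≤ σ := le_of_tendsto' hxℓ hσ
  have hσ0 : 0 < σ := hℓpos.trans_le hℓσ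
  have hℓσ2 : ℓ ^ 2 ≤ σ ^ 2 := by gcongr
  let q : ℕ → Profile := fun j => ⟨fun n => (p j).t (φ n), fun n => (p j).x (φ n), (p j).ψ⟩
  -- `K` comes from the energy bound on the remainders and `S` from the summability of the profiles,
  -- both with `ℓ` replaced by the larger `σ`.
  obtain ⟨t', x', R', hstd', htx', hR'0, hR', hRR', hbound⟩ := h.exists_bounded_remainder h5 hm
    hM₁.le hE q (fun J n => R J (φ n)) (fun J n => hR J (φ n)) hxstd hxgap
    (K := 2 * M₁ * σ ^ 2) (S := M₁ * (M₁ / m * σ ^ 2)) (by positivity)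
    (fun n => by
      rw [hR0]
      have h1 := hσ n
      calc energy B c (u (φ n)) ≤ M₁ * ‖u (φ n)‖ ^ 2 := (hE _).2
        _ ≤ M₁ * σ ^ 2 := by gcongr
        _ ≤ 2 * M₁ * σ ^ 2 := by nlinarith [sq_nonneg σ])
    (fun J => (hxE J).mono fun n hn => hn.trans (by gcongr))
    (fun J => by
      calc ∑ j ∈ Finset.range J, energy B c (p j).ψ
          ≤ ∑ j ∈ Finset.range J, M₁ * ‖(p j).ψ‖ ^ 2 :=
            Finset.sum_le_sum fun j _ => (hE _).2
        _ = M₁ * ∑ j ∈ Finset.range J, ‖(p j).ψ‖ ^ 2 := (Finset.mul_sum _ _ _).symm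
        _ ≤ M₁ * (M₁ / m * σ ^ 2) := by
            refine mul_le_mul_of_nonneg_left ((hsum J).trans ?_) hM₁.le
            gcongr)
  have htx : ∀ J, ∀ᶠ n in atTop, ∀ j ∈ Finset.range J,
      t' j n = (p j).t (φ n) ∧ x' j n = (p j).x (φ n) := fun J =>
    (Filter.eventually_all_finset _).2 fun j _ => htx' j
  have hgap' : ∀ j k, j < k →
      Tendsto (fun n => |t' k n - t' j n| + |x' k n - x' j n|) atTop atTop := by
    intro j k hjk
    refine (hxgap j k hjk).congr' ?_
    filter_upwards [htx' j, htx' k] with n h1 h2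
    rw [h1.1, h1.2, h2.1, h2.2]
    rfl
  have hlimsup : ∀ J, limsup (fun n => linftyFlowNorm A (toL2 (R' (J + 1) n))) atTop ≤
      ENNReal.ofReal ((1 + C₁ + C₂ + C₃) * (√‖toL2 (p J).ψ‖ * √σ)) := by
    intro J
    have h1 : ∀ k : ℕ, limsup (fun n => linftyFlowNorm A (toL2 (R' (J + 1) n))) atTop ≤
        ENNReal.ofReal (C₁ * (√‖toL2 (p J).ψ‖ * √ℓ) + 1 / ((k : ℝ) + 1)) := by
      intro k
      refine limsup_le_of_le (by isBoundedDefault) ?_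
      filter_upwards [hxL J k, hRR' (J + 1)] with n hn hn'
      rw [hn']
      exact hn
    have h2 : Tendsto (fun k : ℕ => ENNReal.ofReal
        (C₁ * (√‖toL2 (p J).ψ‖ * √ℓ) + 1 / ((k : ℝ) + 1))) atTop
        (𝓝 (ENNReal.ofReal (C₁ * (√‖toL2 (p J).ψ‖ * √ℓ) + 0))) :=
      ENNReal.tendsto_ofReal (tendsto_const_nhds.add tendsto_one_div_add_atTop_nhds_zero_nat)
    refine (ge_of_tendsto' h2 h1).trans (ENNReal.ofReal_le_ofReal ?_)
    rw [add_zero]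
    have h3 : √ℓ ≤ √σ := Real.sqrt_le_sqrt hℓσ
    have h4 : C₁ ≤ 1 + C₁ + C₂ + C₃ := by linarith
    gcongr
  have hψ0 : Tendsto (fun J => √‖toL2 (p J).ψ‖ * √σ) atTop (𝓝 0) := by
    have h1 : Summable fun j => ‖(p j).ψ‖ ^ 2 :=
      summable_of_sum_range_le (fun j => by positivity) hsum
    have h2 : Tendsto (fun j => ‖toL2 (p j).ψ‖ ^ 2) atTop (𝓝 0) :=
      squeeze_zero (fun j => by positivity)
        (fun j => by have := norm_toL2_le (p j).ψ; gcongr) h1.tendsto_atTop_zero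
    have h3 := (Real.continuous_sqrt.tendsto 0).comp h2
    rw [Real.sqrt_zero] at h3
    have h4 : Tendsto (fun j => ‖toL2 (p j).ψ‖) atTop (𝓝 0) :=
      h3.congr fun j => Real.sqrt_sq (norm_nonneg _)
    have h6 := ((Real.continuous_sqrt.tendsto 0).comp h4).mul_const √σ
    rw [Real.sqrt_zero, zero_mul] at h6
    exact h6
  -- Profiles are shifted to start at 1, remainders are not: `R' J` is what is left after the first
  -- `J` profiles.
  refine ⟨φ, fun j => (p (j - 1)).ψ, fun j => t' (j - 1), fun j => x' (j - 1), R', hφ,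
    fun j _ => hstd' (j - 1), ?_, ?_, ?_, ?_, ?_, ?_, ?_, ?_⟩
  · intro J _ n
    rw [sum_Icc_one_sub_one (fun j => bubble A (t' j n) (x' j n) (p j).ψ)]
    clear * - hR' hR'0 hR0 h
    induction J with
    | zero => rw [hR'0, hR0]; simp
    | succ J ih =>
      rw [ih, Finset.sum_range_succ, hR', map_sub, ← h.toL2_push]
      abel
  · intro j k hj hk hjk
    rcases Nat.lt_or_gt_of_ne hjk with hlt | hlt
    · refine (hgap' (j - 1) (k - 1) (by omega)).congr fun n => ?_
      rw [abs_sub_comm, abs_sub_comm (x' (k - 1) n)]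
    · exact hgap' (k - 1) (j - 1) (by omega)
  · intro J hJ
    have h1 := hlimsup (J - 1)
    rwa [Nat.sub_add_cancel hJ] at h1
  · exact hψ0.comp (tendsto_sub_atTop_nat 1)
  · have h1 := ENNReal.tendsto_ofReal ((hψ0.comp (tendsto_sub_atTop_nat 1)).const_mul
      (1 + C₁ + C₂ + C₃))
    rw [mul_zero, ENNReal.ofReal_zero] at h1
    refine tendsto_of_tendsto_of_tendsto_of_le_of_le' tendsto_const_nhds h1
      (Eventually.of_forall fun _ => zero_le) ?_
    filter_upwards [eventually_ge_atTop 1] with J hJ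
    have h2 := hlimsup (J - 1)
    rwa [Nat.sub_add_cancel hJ] at h2
  · intro J _
    refine ⟨?_, ?_, ?_⟩
    · rw [sum_Icc_one_sub_one (fun j => ‖toL2 (p j).ψ‖ ^ 2)]
      refine (hx1 J).congr' ?_
      filter_upwards [hRR' J] with n hn
      rw [hn, hR0]
    · refine (hx2 J).congr' ?_
      filter_upwards [hRR' J, htx J] with n hn hn'
      rw [sum_Icc_one_sub_one (fun j => B (translH1 (x' j n) (p j).ψ) (translH1 (x' j n) (p j).ψ)),
        hn, hR0]
      congr 2
      refine Finset.sum_congr rfl fun j hj => ?_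
      rw [(hn' j hj).2]
    · refine (hx3 J).congr' ?_
      filter_upwards [hRR' J, htx J] with n hn hn'
      rw [sum_Icc_one_sub_one (fun j => lrNormPow r (bubble A (t' j n) (x' j n) (p j).ψ)), hn, hR0]
      congr 2
      refine Finset.sum_congr rfl fun j hj => ?_
      rw [(hn' j hj).1, (hn' j hj).2]
  · intro J hJ hJ0 j hj
    replace hJ0 : (p (J - 1)).ψ = 0 := hJ0
    -- The next profile is itself a weak limit of the remainder left by the current one, so its L²
    -- norm is at most twice that of the current profile.
    have hstep : ∀ i, toL2 (p i).ψ = 0 → toL2 (p (i + 1)).ψ = 0 := by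
      intro i hi
      have h1 := hmax' i (p (i + 1)).ψ ⟨_, _, hw (i + 1)⟩
      rw [hi, norm_zero, mul_zero] at h1
      exact norm_le_zero_iff.1 h1
    have hall : ∀ i, J - 1 ≤ i → toL2 (p i).ψ = 0 := by
      intro i hi
      induction i, hi using Nat.le_induction with
      | base => rw [hJ0, map_zero]
      | succ i _ ih => exact hstep i ih
    exact toL2_injective (by rw [hall (j - 1) (by omega), map_zero])
  · intro j J n _ _
    have h1 : ‖(p (j - 1)).ψ‖ ≤ C₂ * σ := by
      have h2 : ‖(p (j - 1)).ψ‖ ^ 2 ≤ M₁ / m * σ ^ 2 := by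
        refine (Finset.single_le_sum (f := fun j => ‖(p j).ψ‖ ^ 2) (fun i _ => by positivity)
          (Finset.self_mem_range_succ (j - 1))).trans ((hsum _).trans ?_)
        gcongr
      refine (Real.le_sqrt_of_sq_le h2).trans (le_of_eq ?_)
      rw [Real.sqrt_mul (by positivity), Real.sqrt_sq hσ0.le]
    have h3 : ‖R' J n‖ ≤ C₃ * σ := by
      have h2 : ‖R' J n‖ ^ 2 ≤
          2 * (2 * (2 * M₁) + M₁ / m * (M₁ * (M₁ / m))) / m * σ ^ 2 := by
        rw [div_mul_eq_mul_div, le_div_iff₀ hm]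
        have h4 := (hE (R' J n)).1
        have h6 := hbound J n
        calc ‖R' J n‖ ^ 2 * m ≤ energy B c (R' J n) := by linarith
          _ ≤ _ := h6
          _ = _ := by ring
      refine (Real.le_sqrt_of_sq_le h2).trans (le_of_eq ?_)
      rw [Real.sqrt_mul (by positivity), Real.sqrt_sq hσ0.le]
    have h5 : 0 ≤ (1 + C₁) * σ := by positivity
    calc ‖(p (j - 1)).ψ‖ + ‖R' J n‖ ≤ C₂ * σ + C₃ * σ := add_le_add h1 h3
      _ ≤ (1 + C₁) * σ + (C₂ * σ + C₃ * σ) := by linarith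
      _ = (1 + C₁ + C₂ + C₃) * σ := by ring

end Setup

end ProfileDecomposition

end

open ProfileDecomposition in
theorem theorem2p4 (r : ℝ≥0∞) [Fact (1 ≤ r)] (hr : 2 < r) (hr' : r ≠ ⊤)
    (A : L2 →ₗ.[ℂ] L2) (B : H1 →L[ℂ] Hneg1)
    (h1 : A1 A B) (h2 : A2 A) (h3 : A3 B) (h4 : A4 A) (h5 : A5 A r) (h6 : A6 A) :
    ∃ C : ℝ, 0 < C ∧ ∀ u : ℕ → H1, (∃ M : ℝ, ∀ n, ‖u n‖ ≤ M) →
      ∃ (φ : ℕ → ℕ) (ψ : ℕ → H1) (t x : ℕ → ℕ → ℝ) (R : ℕ → ℕ → H1),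
        StrictMono φ ∧
        (∀ j, 1 ≤ j → IsStandard (t j) ∧ IsStandard (x j)) ∧
        (∀ J, 1 ≤ J → ∀ n, toL2 (u (φ n)) =
          (∑ j ∈ Finset.Icc 1 J, bubble A (t j n) (x j n) (ψ j)) + toL2 (R J n)) ∧
        (∀ j k, 1 ≤ j → 1 ≤ k → j ≠ k →
          Tendsto (fun n => |t j n - t k n| + |x j n - x k n|) atTop atTop) ∧
        (∀ J, 1 ≤ J → limsup (fun n => linftyFlowNorm A (toL2 (R J n))) atTop ≤
          ENNReal.ofReal (C * (√‖toL2 (ψ J)‖ * √(⨆ n, ‖u (φ n)‖)))) ∧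
        Tendsto (fun J => √‖toL2 (ψ J)‖ * √(⨆ n, ‖u (φ n)‖)) atTop (𝓝 0) ∧
        Tendsto (fun J => limsup (fun n => linftyFlowNorm A (toL2 (R J n))) atTop)
          atTop (𝓝 0) ∧
        (∀ J, 1 ≤ J →
          Tendsto (fun n => ‖toL2 (u (φ n))‖ ^ 2 -
            ((∑ j ∈ Finset.Icc 1 J, ‖toL2 (ψ j)‖ ^ 2) + ‖toL2 (R J n)‖ ^ 2)) atTop (𝓝 0) ∧
          Tendsto (fun n => B (u (φ n)) (u (φ n)) -
            ((∑ j ∈ Finset.Icc 1 J, B (translH1 (x j n) (ψ j)) (translH1 (x j n) (ψ j))) +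
              B (R J n) (R J n))) atTop (𝓝 0) ∧
          Tendsto (fun n => lrNormPow r (toL2 (u (φ n))) -
            ((∑ j ∈ Finset.Icc 1 J, lrNormPow r (bubble A (t j n) (x j n) (ψ j))) +
              lrNormPow r (toL2 (R J n)))) atTop (𝓝 0)) ∧
        (∀ J, 1 ≤ J → ψ J = 0 → ∀ j, J ≤ j → ψ j = 0) ∧
        (∀ j J n, 1 ≤ j → 1 ≤ J → ‖ψ j‖ + ‖R J n‖ ≤ C * ⨆ m, ‖u (φ m)‖) := by
  exact (Setup.mk (isUnitaryGroup_expI h1.exists_isUnitaryGroup) h1 h2 h3 h4 h6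
    ).exists_hasProfileDecomposition h5 hr hr'
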